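/- **Language.** Types are $\theta ::= \mathtt{unit}\mid\mathtt{int}\mid\theta\times\theta\mid\theta\to\theta$. Fix a set of binary operations $\oplus$, each interpreted as a total function $\mathbb Z\times\mathbb Z\to\mathbb Z$, and typed names, countably infinitely many of each sort: method names $m\in\mathrm{Meths}_{\theta,\theta'}$ (of type $\theta\to\theta'$), global references $r\in\mathrm{Refs}_\theta$ ($\theta$ not a product), variables $x\in\mathrm{Vars}_\theta$; also symbolic integers $\kappa\in\mathrm{SInts}$. Terms are $$M ::= m\mid i\mid ()\mid x\mid \lambda x.M\mid r:=M\mid {!r}\mid M\oplus M\mid\langle M,M\rangle\mid\pi_1M\mid\pi_2M\mid MM\mid \mathtt{if}\,M\,\mathtt{then}\,M\,\mathtt{else}\,M\mid\mathtt{letrec}\,x=\lambda x.M\,\mathtt{in}\,M\mid\mathtt{let}\,x=M\,\mathtt{in}\,M\mid\mathtt{assert}(M),$$ simply typed as usual ($\mathtt{assert}$ and $\mathtt{if}$ test an $\mathtt{int}$). At run time there are also boxes $[\![M]\!]$ (a call that has not yet returned) and, in the symbolic semantics, symbolic integers $\kappa:\mathtt{int}$. A library $L$ is a finite list of declarations $\mathtt{abstract}\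 m$ followed by a finite list of definitions $\mathtt{public}\ m=\lambda x.M$, $m=\lambda x.M$ (private), $\mathtt{global}\ r:=i$, $\mathtt{global}\ r:=\lambda x.M$. It is well typed if every method and every reference is declared at most once, all definitions are well typed, and their bodies mention only methods and references that are defined or abstract in $L$. $L$ *builds* to $(R,S,\mathcal P,\mathcal A)$, where $R$ (method repository) is a finite partial map that sends each defined method to its abstraction, $S$ (store) sends each reference to its initial value ($r:=\lambda x.M$ adds $m\mapsto\lambda x.M$ to $R$ and $r\mapsto m$ to $S$ for a fresh $m$), $\mathcal P$ is the set of public methods and $\mathcal A$ the set of abstract methods. **Concrete term evaluation.** Values are $v::=m\mid i\mid()\mid\langle v,v\rangle$; evaluation contexts $E$ are call-by-value, left to right, including $E\,M$, $m\,E$ and $[\![E]\!]$. The steps on $(M,R,S,k)$, $k\in\mathbb N$, are the usual ones for $\mathtt{let}$, projections, assignment, dereferencing, $i_1\oplus i_2$ and $\mathtt{if}\,i$ (true iff $i\ne0$), together with: $E[\mathtt{assert}(i)]\to E[()]$ if $i\neq0$; $E[\lambda x.M]\to E[m]$, adding $m\mapsto\lambda x.M$ to $R$ for a fresh $m$ of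 the same type; $E[\mathtt{letrec}\,f=\lambda x.M\,\mathtt{in}\,M']\to E[M'\{m/f\}]$, adding $m\mapsto\lambda x.M\{m/f\}$ for a fresh $m$ of the same type; $(E[mv],k)\to(E[[\![M\{v/x\}]\!]],k+1)$ if $R(m)=\lambda x.M$; $(E[[\![v]\!]],k+1)\to(E[v],k)$. **Concrete trace semantics.** Configurations are $(\mathcal E,M,R,S,\mathcal P,\mathcal A,k)_p$ and $(\mathcal E,l,R,S,\mathcal P,\mathcal A,k)_o$, where $\mathcal E$ is a stack of pairs $(m,E)$ or $(m,l)$ with $l\in\mathbb N$. The transitions are: * internal steps in $p$-configurations, which pick names that are fresh for $R$ and $\mathcal A$; * (PQ) $(\mathcal E,E[mv],\dots)_p\xrightarrow{\mathtt{call}(m,v)}((m,E)::\mathcal E,0,\dots)_o$ if $m\in\mathcal A$; * (PA) $((m,l)::\mathcal E,v,\dots)_p\xrightarrow{\mathtt{ret}(m,v)}(\mathcal E,l,\dots)_o$; * (OQ) $(\mathcal E,l,\dots)_o\xrightarrow{\mathtt{call}(m,v)}((m,l+1)::\mathcal E,mv,\dots)_p$ if $m\in\mathcal P\cap\mathrm{dom}(R)$;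 * (OA) $((m,E)::\mathcal E,l,\dots)_o\xrightarrow{\mathtt{ret}(m,v)}(\mathcal E,E[v],\dots)_p$. In (PQ) and (PA) the method names of $v$ that lie in $\mathrm{dom}(R)$ are added to $\mathcal P$. In (OQ) and (OA) $v$ is any value of the argument type, resp. result type, of $m$ whose method names in $\mathrm{dom}(R)$ all belong to $\mathcal P$, and its method names outside $\mathrm{dom}(R)$ are added to $\mathcal A$. $[\![L]\!]$ is the set of all $(\tau,\rho)$ such that, for some $(R,S,\mathcal P,\mathcal A)$ to which $L$ builds, a finite sequence of transitions with trace $\tau$ leads from $(\varepsilon,0,R,S,\mathcal P,\mathcal A,0)_o$ to $\rho$. It *fails* if it contains some $(\tau,\rho)$ with $\rho=(\mathcal E,E[\mathtt{assert}(0)],\dots)_p$. **Symbolic semantics.** Symbolic values are $\tilde v::=m\mid i\mid()\mid\kappa\mid\tilde v\oplus\tilde v\mid\langle\tilde v,\tilde v\rangle$, where in $\tilde v\oplus\tilde v$ the operands are not both integer constants. The store is replaced by a symbolic environment $\sigma$, a finite partial map from $\mathrm{Refs}\cup\mathrm{SInts}$ to symbolic values, and there is a path condition $pc$, a quantifier-free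 formula over symbolic integers; $\mathcal A$ may also contain symbolic integers. The steps of term evaluation are those above, with symbolic values for values, together with $$E[\mathtt{assert}(\kappa)]\to E[\mathtt{assert}(0)]\ \text{with } pc\wedge\kappa=0,\qquad E[\mathtt{assert}(\kappa)]\to E[()]\ \text{with } pc\wedge\kappa\ne0,$$ $$E[\mathtt{if}\,\kappa\,\mathtt{then}\,M_1\,\mathtt{else}\,M_0]\to E[M_0]\ \text{with } pc\wedge\kappa=0,\qquad E[\mathtt{if}\,\kappa\,\mathtt{then}\,M_1\,\mathtt{else}\,M_0]\to E[M_1]\ \text{with } pc\wedge\kappa\neq0,$$ $$E[\tilde v_1\oplus\tilde v_2]\to E[\kappa]\ \text{with } \sigma\uplus\{\kappa\mapsto\tilde v_1\oplus\tilde v_2\},\ \kappa \text{ fresh, if } \tilde v_1\oplus\tilde v_2 \text{ is a symbolic value.}$$ The game transitions are as above, except that O (in (OQ) and (OA)) plays only values of the required type that are built by pairing from $()$ and pairwise distinct fresh symbolic integers (at type $\mathtt{int}$) and fresh method names (at arrow types), all of which are added to $\mathcal A$. A model is a finite partial map $\mathcal M:\mathrm{SInts}\rightharpoonup\mathbb Z$;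 $\mathcal M\models\phi$ means that all symbolic integers of $\phi$ are in the domain of $\mathcal M$ and $\phi$ is true under $\mathcal M$; $\sigma^\circ$ is the conjunction of the equations $\kappa=\tilde v$ over all $\kappa\mapsto\tilde v$ in $\sigma$ with $\kappa\in\mathrm{SInts}$. $[\![L]\!]_s$ is the set of all $(\tau,\rho)$ such that, for some $(R,S,\mathcal P,\mathcal A)$ to which $L$ builds, $\rho$ is reached with trace $\tau$ from $(\varepsilon,0,R,\mathcal P,\mathcal A,\sigma=S,pc=\top,0)_o$ and some model satisfies $\sigma^\circ\wedge pc$ for the $\sigma$ and $pc$ of $\rho$. It *fails* if it contains some $(\tau,\rho)$ with $\rho=(\mathcal E,E[\mathtt{assert}(0)],\dots)_p$. **Theorem (Soundness).** For every well-typed library $L$, $[\![L]\!]$ fails if and only if $[\![L]\!]_s$ fails. -/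

import Mathlib

namespace HOLi

universe u

/-! ## Types and typed names -/

/-- Types `θ ::= unit | int | θ × θ | θ → θ`. -/
inductive Ty : Type where
  | unit : Ty
  | int : Ty
  | prod : Ty → Ty → Ty
  | arrow : Ty → Ty → Ty
  deriving DecidableEq

/-- Method names: countably many in each `Meths_{θ,θ'}`. -/
structure MName : Type where
  dom : Ty
  cod : Ty
  idx : ℕ
  deriving DecidableEq

/-- The type of a method name. -/
def MName.ty (m : MName) : Ty := Ty.arrow m.dom m.cod

/-- Global reference names: countably many for each non-product type. -/
structure RName : Type where
  ty : Ty
  idx : ℕ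
  notProd : ∀ a b : Ty, ty ≠ Ty.prod a b
  deriving DecidableEq

/-- Variables: countably many of each type. -/
structure VName : Type where
  ty : Ty
  idx : ℕ
  deriving DecidableEq

/-- Symbolic integers. -/
structure SInt : Type where
  idx : ℕ
  deriving DecidableEq

/-- Finite partial maps. -/
abbrev FMap (α β : Type*) := AList (fun _ : α => β)

/-! ## Terms -/

/-- Terms over a set `Op` of binary integer operations, including evaluation boxes and symbolic
integers. Terms of libraries contain neither of these two (see `Term.Source`). -/
inductive Term (Op : Type u) : Type u where
  | meth : MName → Term Op
  | int : ℤ → Term Op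
  | unit : Term Op
  | var : VName → Term Op
  | lam : VName → Term Op → Term Op
  | assign : RName → Term Op → Term Op
  | deref : RName → Term Op
  | op : Op → Term Op → Term Op → Term Op
  | pair : Term Op → Term Op → Term Op
  | fst : Term Op → Term Op
  | snd : Term Op → Term Op
  | app : Term Op → Term Op → Term Op
  /-- `ite M M₁ M₀` is `if M then M₁ else M₀`. -/
  | ite : Term Op → Term Op → Term Op → Term Op
  /-- `letrec f x M N` is `letrec f = λx.M in N`. -/
  | letrec : VName → VName → Term Op → Term Op → Term Op
  /-- `letin x M N` is `let x = M in N`. -/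
  | letin : VName → Term Op → Term Op → Term Op
  | assert : Term Op → Term Op
  /-- Evaluation box: a method call that has not yet returned. -/
  | box : Term Op → Term Op
  | sint : SInt → Term Op

namespace Term

variable {Op : Type u}

/-- The terms of the source language: no evaluation box and no symbolic integer. -/
def Source : Term Op → Prop
  | meth _ => True
  | int _ => True
  | unit => True
  | var _ => True
  | lam _ M => M.Source
  | assign _ M => M.Source
  | deref _ => True
  | op _ M N => M.Source ∧ N.Source
  | pair M N => M.Source ∧ N.Source
  | fst M => M.Source
  | snd M => M.Source
  | app M N => M.Source ∧ N.Source
  | ite M N P => M.Source ∧ N.Source ∧ P.Source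
  | letrec _ _ M N => M.Source ∧ N.Source
  | letin _ M N => M.Source ∧ N.Source
  | assert M => M.Source
  | box _ => False
  | sint _ => False

/-- The method names that occur in a term. -/
def meths : Term Op → Finset MName
  | meth m => {m}
  | int _ => ∅
  | unit => ∅
  | var _ => ∅
  | lam _ M => M.meths
  | assign _ M => M.meths
  | deref _ => ∅
  | op _ M N => M.meths ∪ N.meths
  | pair M N => M.meths ∪ N.meths
  | fst M => M.meths
  | snd M => M.meths
  | app M N => M.meths ∪ N.meths
  | ite M N P => M.meths ∪ N.meths ∪ P.meths
  | letrec _ _ M N => M.meths ∪ N.meths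
  | letin _ M N => M.meths ∪ N.meths
  | assert M => M.meths
  | box M => M.meths
  | sint _ => ∅

/-- The reference names that occur in a term. -/
def refs : Term Op → Finset RName
  | meth _ => ∅
  | int _ => ∅
  | unit => ∅
  | var _ => ∅
  | lam _ M => M.refs
  | assign r M => insert r M.refs
  | deref r => {r}
  | op _ M N => M.refs ∪ N.refs
  | pair M N => M.refs ∪ N.refs
  | fst M => M.refs
  | snd M => M.refs
  | app M N => M.refs ∪ N.refs
  | ite M N P => M.refs ∪ N.refs ∪ P.refs
  | letrec _ _ M N => M.refs ∪ N.refs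
  | letin _ M N => M.refs ∪ N.refs
  | assert M => M.refs
  | box M => M.refs
  | sint _ => ∅

/-- The symbolic integers that occur in a term. -/
def sints : Term Op → Finset SInt
  | meth _ => ∅
  | int _ => ∅
  | unit => ∅
  | var _ => ∅
  | lam _ M => M.sints
  | assign _ M => M.sints
  | deref _ => ∅
  | op _ M N => M.sints ∪ N.sints
  | pair M N => M.sints ∪ N.sints
  | fst M => M.sints
  | snd M => M.sints
  | app M N => M.sints ∪ N.sints
  | ite M N P => M.sints ∪ N.sints ∪ P.sints
  | letrec _ _ M N => M.sints ∪ N.sints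
  | letin _ M N => M.sints ∪ N.sints
  | assert M => M.sints
  | box M => M.sints
  | sint κ => {κ}

/-- Substitution `M{v/x}`. Only values are ever substituted; they have no free variables, so no
renaming of bound variables is needed. -/
def subst (M : Term Op) (x : VName) (v : Term Op) : Term Op :=
  match M with
  | meth m => meth m
  | int i => int i
  | unit => unit
  | var y => if y = x then v else var y
  | lam y M => lam y (if y = x then M else M.subst x v)
  | assign r M => assign r (M.subst x v)
  | deref r => deref r
  | op o M N => op o (M.subst x v) (N.subst x v)
  | pair M N => pair (M.subst x v) (N.subst x v)
  | fst M => fst (M.subst x v)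
  | snd M => snd (M.subst x v)
  | app M N => app (M.subst x v) (N.subst x v)
  | ite M N P => ite (M.subst x v) (N.subst x v) (P.subst x v)
  | letrec f y M N =>
      letrec f y (if f = x ∨ y = x then M else M.subst x v) (if f = x then N else N.subst x v)
  | letin y M N => letin y (M.subst x v) (if y = x then N else N.subst x v)
  | assert M => assert (M.subst x v)
  | box M => box (M.subst x v)
  | sint κ => sint κ

end Term

/-- Typing. Variables, references and methods carry their types, so there is no context. The last
two rules extend the typing of source terms to run-time terms. -/
inductive HasType {Op : Type u} : Term Op → Ty → Prop where
  | unit : HasType Term.unit Ty.unit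
  | int (i : ℤ) : HasType (Term.int i) Ty.int
  | var (x : VName) : HasType (Term.var x) x.ty
  | meth (m : MName) : HasType (Term.meth m) m.ty
  | op (o : Op) {M N : Term Op} :
      HasType M Ty.int → HasType N Ty.int → HasType (Term.op o M N) Ty.int
  | ite {M M₁ M₀ : Term Op} {θ : Ty} :
      HasType M Ty.int → HasType M₁ θ → HasType M₀ θ → HasType (Term.ite M M₁ M₀) θ
  | pair {M N : Term Op} {θ₁ θ₂ : Ty} :
      HasType M θ₁ → HasType N θ₂ → HasType (Term.pair M N) (Ty.prod θ₁ θ₂)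
  | fst {M : Term Op} {θ₁ θ₂ : Ty} : HasType M (Ty.prod θ₁ θ₂) → HasType (Term.fst M) θ₁
  | snd {M : Term Op} {θ₁ θ₂ : Ty} : HasType M (Ty.prod θ₁ θ₂) → HasType (Term.snd M) θ₂
  | deref (r : RName) : HasType (Term.deref r) r.ty
  | assign (r : RName) {M : Term Op} : HasType M r.ty → HasType (Term.assign r M) Ty.unit
  | app {M N : Term Op} {θ θ' : Ty} :
      HasType M (Ty.arrow θ θ') → HasType N θ → HasType (Term.app M N) θ'
  | lam (x : VName) {M : Term Op} {θ : Ty} :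
      HasType M θ → HasType (Term.lam x M) (Ty.arrow x.ty θ)
  | letin (x : VName) {M N : Term Op} {θ : Ty} :
      HasType M x.ty → HasType N θ → HasType (Term.letin x M N) θ
  | letrec (f x : VName) {M N : Term Op} {θ : Ty} :
      HasType (Term.lam x M) f.ty → HasType N θ → HasType (Term.letrec f x M N) θ
  | assert {M : Term Op} : HasType M Ty.int → HasType (Term.assert M) Ty.unit
  | box {M : Term Op} {θ : Ty} : HasType M θ → HasType (Term.box M) θ
  | sint (κ : SInt) : HasType (Term.sint κ) Ty.int

/-- Values `v ::= m | i | () | ⟨v,v⟩`. -/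
inductive IsVal {Op : Type u} : Term Op → Prop where
  | meth (m : MName) : IsVal (Term.meth m)
  | int (i : ℤ) : IsVal (Term.int i)
  | unit : IsVal Term.unit
  | pair {v w : Term Op} : IsVal v → IsVal w → IsVal (Term.pair v w)

/-- Symbolic values `v ::= m | i | () | κ | v ⊕ v | ⟨v,v⟩`, where the operands of `v ⊕ v` are not
both integer constants. -/
inductive IsSVal {Op : Type u} : Term Op → Prop where
  | meth (m : MName) : IsSVal (Term.meth m)
  | int (i : ℤ) : IsSVal (Term.int i)
  | unit : IsSVal Term.unit
  | sint (κ : SInt) : IsSVal (Term.sint κ)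
  | op (o : Op) {v w : Term Op} : IsSVal v → IsSVal w →
      (¬ ∃ i j : ℤ, v = Term.int i ∧ w = Term.int j) → IsSVal (Term.op o v w)
  | pair {v w : Term Op} : IsSVal v → IsSVal w → IsSVal (Term.pair v w)

/-! ## Evaluation contexts -/

/-- Evaluation contexts (left-to-right, call-by-value). The terms to the left of the hole have to
be values, which is what `ECtx.Valid` says. -/
inductive ECtx (Op : Type u) : Type u where
  | hole : ECtx Op
  | assert : ECtx Op → ECtx Op
  | assign : RName → ECtx Op → ECtx Op
  | opL : Op → ECtx Op → Term Op → ECtx Op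
  | opR : Op → Term Op → ECtx Op → ECtx Op
  | pairL : ECtx Op → Term Op → ECtx Op
  | pairR : Term Op → ECtx Op → ECtx Op
  | fst : ECtx Op → ECtx Op
  | snd : ECtx Op → ECtx Op
  | appL : ECtx Op → Term Op → ECtx Op
  | appR : MName → ECtx Op → ECtx Op
  | letin : VName → ECtx Op → Term Op → ECtx Op
  | ite : ECtx Op → Term Op → Term Op → ECtx Op
  | box : ECtx Op → ECtx Op

namespace ECtx

variable {Op : Type u}

/-- `E.plug M` is `E[M]`. -/
def plug : ECtx Op → Term Op → Term Op
  | hole, M => M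
  | assert E, M => Term.assert (E.plug M)
  | assign r E, M => Term.assign r (E.plug M)
  | opL o E N, M => Term.op o (E.plug M) N
  | opR o v E, M => Term.op o v (E.plug M)
  | pairL E N, M => Term.pair (E.plug M) N
  | pairR v E, M => Term.pair v (E.plug M)
  | fst E, M => Term.fst (E.plug M)
  | snd E, M => Term.snd (E.plug M)
  | appL E N, M => Term.app (E.plug M) N
  | appR m E, M => Term.app (Term.meth m) (E.plug M)
  | letin x E N, M => Term.letin x (E.plug M) N
  | ite E M₁ M₀, M => Term.ite (E.plug M) M₁ M₀
  | box E, M => Term.box (E.plug M)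

/-- `E` is an evaluation context with respect to the values given by `V`. -/
def Valid (V : Term Op → Prop) : ECtx Op → Prop
  | hole => True
  | assert E => E.Valid V
  | assign _ E => E.Valid V
  | opL _ E _ => E.Valid V
  | opR _ v E => V v ∧ E.Valid V
  | pairL E _ => E.Valid V
  | pairR v E => V v ∧ E.Valid V
  | fst E => E.Valid V
  | snd E => E.Valid V
  | appL E _ => E.Valid V
  | appR _ E => E.Valid V
  | letin _ E _ => E.Valid V
  | ite E _ _ => E.Valid V
  | box E => E.Valid V

end ECtx

/-! ## Libraries -/

/-- Definitions in a block. -/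
inductive Decl (Op : Type u) : Type u where
  /-- `public m = λx.M` -/
  | pub : MName → VName → Term Op → Decl Op
  /-- `m = λx.M` -/
  | priv : MName → VName → Term Op → Decl Op
  /-- `global r := i` -/
  | refInt : RName → ℤ → Decl Op
  /-- `global r := λx.M` -/
  | refLam : RName → VName → Term Op → Decl Op

/-- A library: abstract method declarations followed by a block of definitions. -/
structure Library (Op : Type u) : Type u where
  abstracts : List MName
  block : List (Decl Op)

namespace Decl

variable {Op : Type u}

/-- The method defined by a declaration, if any. -/
def meth? : Decl Op → Option MName
  | pub m _ _ => some m
  | priv m _ _ => some m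
  | refInt _ _ => none
  | refLam _ _ _ => none

/-- The reference defined by a declaration, if any. -/
def ref? : Decl Op → Option RName
  | pub _ _ _ => none
  | priv _ _ _ => none
  | refInt r _ => some r
  | refLam r _ _ => some r

end Decl

/-- The methods defined in a block. -/
def blockMeths {Op : Type u} (B : List (Decl Op)) : List MName := B.filterMap Decl.meth?

/-- The references defined in a block. -/
def blockRefs {Op : Type u} (B : List (Decl Op)) : List RName := B.filterMap Decl.ref?

namespace Library

variable {Op : Type u}

/-- `λx.M` is a source term of type `θ` that mentions only methods and references that are defined
or abstract in `L`. -/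
def GoodBody (L : Library Op) (x : VName) (M : Term Op) (θ : Ty) : Prop :=
  M.Source ∧ HasType (Term.lam x M) θ ∧
  (∀ m ∈ M.meths, m ∈ L.abstracts ∨ m ∈ blockMeths L.block) ∧
  (∀ r ∈ M.refs, r ∈ blockRefs L.block)

/-- Well-typedness of a declaration of `L`. -/
def GoodDecl (L : Library Op) : Decl Op → Prop
  | Decl.pub m x M => L.GoodBody x M m.ty
  | Decl.priv m x M => L.GoodBody x M m.ty
  | Decl.refInt r _ => r.ty = Ty.int
  | Decl.refLam r x M => L.GoodBody x M r.ty

/-- Well-typed libraries: each method and reference is declared once (so that public, private and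
abstract methods are disjoint), and all definitions are well typed. -/
def WellTyped (L : Library Op) : Prop :=
  (L.abstracts ++ blockMeths L.block).Nodup ∧
  (blockRefs L.block).Nodup ∧
  ∀ d ∈ L.block, L.GoodDecl d

end Library

/-- Method repositories: finite partial maps from method names to abstractions `λx.M`. -/
abbrev Repo (Op : Type u) := FMap MName (VName × Term Op)

/-- Stores. -/
abbrev Store (Op : Type u) := FMap RName (Term Op)

/-- Configurations of the library build. -/
structure BuildConf (Op : Type u) : Type u where
  lib : Library Op
  R : Repo Op
  S : Store Op
  pub : Finset MName
  abs : Finset MName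

/-- Library build. In the last rule `m` is a fresh name of the appropriate type: it is neither a
name introduced so far nor one that remains to be defined. -/
inductive Build {Op : Type u} : BuildConf Op → BuildConf Op → Prop where
  | abs {m : MName} {As : List MName} {B : List (Decl Op)} {R : Repo Op} {S : Store Op}
      {P A : Finset MName} :
      m ∉ A →
      Build ⟨⟨m :: As, B⟩, R, S, P, A⟩ ⟨⟨As, B⟩, R, S, P, insert m A⟩
  | pub {m : MName} {x : VName} {M : Term Op} {B : List (Decl Op)} {R : Repo Op} {S : Store Op}
      {P A : Finset MName} :
      m ∉ R → m ∉ P →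
      Build ⟨⟨[], Decl.pub m x M :: B⟩, R, S, P, A⟩
        ⟨⟨[], B⟩, R.insert m (x, M), S, insert m P, A⟩
  | priv {m : MName} {x : VName} {M : Term Op} {B : List (Decl Op)} {R : Repo Op} {S : Store Op}
      {P A : Finset MName} :
      m ∉ R →
      Build ⟨⟨[], Decl.priv m x M :: B⟩, R, S, P, A⟩ ⟨⟨[], B⟩, R.insert m (x, M), S, P, A⟩
  | refInt {r : RName} {i : ℤ} {B : List (Decl Op)} {R : Repo Op} {S : Store Op}
      {P A : Finset MName} :
      r ∉ S →
      Build ⟨⟨[], Decl.refInt r i :: B⟩, R, S, P, A⟩ ⟨⟨[], B⟩, R, S.insert r (Term.int i), P, A⟩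
  | refLam {r : RName} {x : VName} {M : Term Op} {m : MName} {B : List (Decl Op)} {R : Repo Op}
      {S : Store Op} {P A : Finset MName} :
      r ∉ S → m.ty = r.ty → m ∉ R → m ∉ A → m ∉ blockMeths B →
      Build ⟨⟨[], Decl.refLam r x M :: B⟩, R, S, P, A⟩
        ⟨⟨[], B⟩, R.insert m (x, M), S.insert r (Term.meth m), P, A⟩

/-- `L` builds to `(ε, R, S, pub, abs)`. -/
def Library.BuildsTo {Op : Type u} (L : Library Op) (R : Repo Op) (S : Store Op)
    (pub abs : Finset MName) : Prop :=
  Relation.ReflTransGen Build ⟨L, ∅, ∅, ∅, ∅⟩ ⟨⟨[], []⟩, R, S, pub, abs⟩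

/-! ## Operational semantics -/

/-- Configurations `(M, R, S, k)`. -/
structure TConf (Op : Type u) : Type u where
  M : Term Op
  R : Repo Op
  S : Store Op
  k : ℕ

/-- Term evaluation. `I` interprets the operations. `A` is a set of method names, not in the
repository, that have to be avoided when a fresh method name is picked; the name picked has the
type of the abstraction that it names. -/
inductive Step {Op : Type u} (I : Op → ℤ → ℤ → ℤ) (A : Finset MName) :
    TConf Op → TConf Op → Prop where
  | letin {E : ECtx Op} {x : VName} {v M : Term Op} {R : Repo Op} {S : Store Op} {k : ℕ} :
      E.Valid IsVal → IsVal v →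
      Step I A ⟨E.plug (Term.letin x v M), R, S, k⟩ ⟨E.plug (M.subst x v), R, S, k⟩
  | fst {E : ECtx Op} {v w : Term Op} {R : Repo Op} {S : Store Op} {k : ℕ} :
      E.Valid IsVal → IsVal v → IsVal w →
      Step I A ⟨E.plug (Term.fst (Term.pair v w)), R, S, k⟩ ⟨E.plug v, R, S, k⟩
  | snd {E : ECtx Op} {v w : Term Op} {R : Repo Op} {S : Store Op} {k : ℕ} :
      E.Valid IsVal → IsVal v → IsVal w →
      Step I A ⟨E.plug (Term.snd (Term.pair v w)), R, S, k⟩ ⟨E.plug w, R, S, k⟩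
  | assign {E : ECtx Op} {r : RName} {v : Term Op} {R : Repo Op} {S : Store Op} {k : ℕ} :
      E.Valid IsVal → IsVal v →
      Step I A ⟨E.plug (Term.assign r v), R, S, k⟩ ⟨E.plug Term.unit, R, S.insert r v, k⟩
  | deref {E : ECtx Op} {r : RName} {v : Term Op} {R : Repo Op} {S : Store Op} {k : ℕ} :
      E.Valid IsVal → S.lookup r = some v →
      Step I A ⟨E.plug (Term.deref r), R, S, k⟩ ⟨E.plug v, R, S, k⟩
  | iteTrue {E : ECtx Op} {i : ℤ} {M₁ M₀ : Term Op} {R : Repo Op} {S : Store Op} {k : ℕ} :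
      E.Valid IsVal → i ≠ 0 →
      Step I A ⟨E.plug (Term.ite (Term.int i) M₁ M₀), R, S, k⟩ ⟨E.plug M₁, R, S, k⟩
  | iteFalse {E : ECtx Op} {M₁ M₀ : Term Op} {R : Repo Op} {S : Store Op} {k : ℕ} :
      E.Valid IsVal →
      Step I A ⟨E.plug (Term.ite (Term.int 0) M₁ M₀), R, S, k⟩ ⟨E.plug M₀, R, S, k⟩
  | op {E : ECtx Op} {o : Op} {i j : ℤ} {R : Repo Op} {S : Store Op} {k : ℕ} :
      E.Valid IsVal →
      Step I A ⟨E.plug (Term.op o (Term.int i) (Term.int j)), R, S, k⟩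
        ⟨E.plug (Term.int (I o i j)), R, S, k⟩
  | lam {E : ECtx Op} {x : VName} {M : Term Op} {m : MName} {R : Repo Op} {S : Store Op} {k : ℕ} :
      E.Valid IsVal → HasType (Term.lam x M) m.ty → m ∉ R → m ∉ A →
      Step I A ⟨E.plug (Term.lam x M), R, S, k⟩ ⟨E.plug (Term.meth m), R.insert m (x, M), S, k⟩
  | assert {E : ECtx Op} {i : ℤ} {R : Repo Op} {S : Store Op} {k : ℕ} :
      E.Valid IsVal → i ≠ 0 →
      Step I A ⟨E.plug (Term.assert (Term.int i)), R, S, k⟩ ⟨E.plug Term.unit, R, S, k⟩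
  | app {E : ECtx Op} {m : MName} {v : Term Op} {x : VName} {M : Term Op} {R : Repo Op}
      {S : Store Op} {k : ℕ} :
      E.Valid IsVal → IsVal v → R.lookup m = some (x, M) →
      Step I A ⟨E.plug (Term.app (Term.meth m) v), R, S, k⟩
        ⟨E.plug (Term.box (M.subst x v)), R, S, k + 1⟩
  | box {E : ECtx Op} {v : Term Op} {R : Repo Op} {S : Store Op} {k : ℕ} :
      E.Valid IsVal → IsVal v →
      Step I A ⟨E.plug (Term.box v), R, S, k + 1⟩ ⟨E.plug v, R, S, k⟩
  | letrec {E : ECtx Op} {f x : VName} {M N : Term Op} {m : MName} {R : Repo Op} {S : Store Op}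
      {k : ℕ} :
      E.Valid IsVal → HasType (Term.lam x M) m.ty → m ∉ R → m ∉ A →
      Step I A ⟨E.plug (Term.letrec f x M N), R, S, k⟩
        ⟨E.plug (N.subst f (Term.meth m)), R.insert m (x, M.subst f (Term.meth m)), S, k⟩

/-! ## Trace semantics -/

/-- Moves. -/
inductive Move (Op : Type u) : Type u where
  | call : MName → Term Op → Move Op
  | ret : MName → Term Op → Move Op

/-- Entries `(m, E)` and `(m, l)` of evaluation stacks. -/
inductive Frame (Op : Type u) : Type u where
  | ctx : MName → ECtx Op → Frame Op
  | cnt : MName → ℕ → Frame Op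

/-- Game configurations `(𝓔, M, R, S, pub, abs, k)_p` and `(𝓔, l, R, S, pub, abs, k)_o`. -/
inductive Conf (Op : Type u) : Type u where
  | P (stk : List (Frame Op)) (M : Term Op) (R : Repo Op) (S : Store Op)
      (pub abs : Finset MName) (k : ℕ) : Conf Op
  | O (stk : List (Frame Op)) (l : ℕ) (R : Repo Op) (S : Store Op)
      (pub abs : Finset MName) (k : ℕ) : Conf Op

/-- The public names after the value `v` has been played by P. -/
def pubAfter {Op : Type u} (pub : Finset MName) (R : Repo Op) (v : Term Op) : Finset MName :=
  pub ∪ v.meths.filter (fun m => m ∈ R)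

/-- The abstract names after the value `v` has been played by O. -/
def absAfter {Op : Type u} (abs : Finset MName) (R : Repo Op) (v : Term Op) : Finset MName :=
  abs ∪ v.meths.filter (fun m => m ∉ R)

/-- `v` is a value of type `θ` that O can play: of the methods of P, O only knows the public ones. -/
def OPlayable {Op : Type u} (R : Repo Op) (pub : Finset MName) (θ : Ty) (v : Term Op) : Prop :=
  IsVal v ∧ HasType v θ ∧ ∀ m ∈ v.meths, m ∈ R → m ∈ pub

/-- Transitions between game configurations; `none` labels an internal transition. -/
inductive CTrans {Op : Type u} (I : Op → ℤ → ℤ → ℤ) :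
    Conf Op → Option (Move Op) → Conf Op → Prop where
  | int {stk : List (Frame Op)} {M M' : Term Op} {R R' : Repo Op} {S S' : Store Op}
      {pub abs : Finset MName} {k k' : ℕ} :
      Step I abs ⟨M, R, S, k⟩ ⟨M', R', S', k'⟩ →
      CTrans I (Conf.P stk M R S pub abs k) none (Conf.P stk M' R' S' pub abs k')
  | pq {stk : List (Frame Op)} {E : ECtx Op} {m : MName} {v : Term Op} {R : Repo Op} {S : Store Op}
      {pub abs : Finset MName} {k : ℕ} :
      E.Valid IsVal → IsVal v → m ∈ abs →
      CTrans I (Conf.P stk (E.plug (Term.app (Term.meth m) v)) R S pub abs k)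
        (some (Move.call m v))
        (Conf.O (Frame.ctx m E :: stk) 0 R S (pubAfter pub R v) abs k)
  | oq {stk : List (Frame Op)} {l : ℕ} {m : MName} {v : Term Op} {R : Repo Op} {S : Store Op}
      {pub abs : Finset MName} {k : ℕ} :
      m ∈ pub → m ∈ R → OPlayable R pub m.dom v →
      CTrans I (Conf.O stk l R S pub abs k)
        (some (Move.call m v))
        (Conf.P (Frame.cnt m (l + 1) :: stk) (Term.app (Term.meth m) v) R S pub
          (absAfter abs R v) k)
  | pa {stk : List (Frame Op)} {l : ℕ} {m : MName} {v : Term Op} {R : Repo Op} {S : Store Op}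
      {pub abs : Finset MName} {k : ℕ} :
      IsVal v →
      CTrans I (Conf.P (Frame.cnt m l :: stk) v R S pub abs k)
        (some (Move.ret m v))
        (Conf.O stk l R S (pubAfter pub R v) abs k)
  | oa {stk : List (Frame Op)} {E : ECtx Op} {l : ℕ} {m : MName} {v : Term Op} {R : Repo Op}
      {S : Store Op} {pub abs : Finset MName} {k : ℕ} :
      OPlayable R pub m.cod v →
      CTrans I (Conf.O (Frame.ctx m E :: stk) l R S pub abs k)
        (some (Move.ret m v))
        (Conf.P stk (E.plug v) R S pub (absAfter abs R v) k)

/-- Sequences of labelled transitions; the trace collects the moves. -/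
inductive Run {C Mv : Type u} (T : C → Option Mv → C → Prop) : C → List Mv → C → Prop where
  | refl (ρ : C) : Run T ρ [] ρ
  | step {ρ ρ' ρ'' : C} {χ : Option Mv} {τ : List Mv} :
      T ρ χ ρ' → Run T ρ' τ ρ'' → Run T ρ (χ.toList ++ τ) ρ''

/-- The trace semantics `⟦L⟧`. -/
def traceSem {Op : Type u} (I : Op → ℤ → ℤ → ℤ) (L : Library Op) :
    Set (List (Move Op) × Conf Op) :=
  {p | ∃ (R : Repo Op) (S : Store Op) (pub abs : Finset MName), L.BuildsTo R S pub abs ∧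
    Run (CTrans I) (Conf.O [] 0 R S pub abs 0) p.1 p.2}

/-- Failed configurations `(𝓔, E[assert(0)], …)_p`. -/
def Conf.Failed {Op : Type u} : Conf Op → Prop
  | Conf.P _ M _ _ _ _ _ => ∃ E : ECtx Op, E.Valid IsVal ∧ M = E.plug (Term.assert (Term.int 0))
  | Conf.O _ _ _ _ _ _ _ => False

/-- `⟦L⟧` fails. -/
def Fails {Op : Type u} (I : Op → ℤ → ℤ → ℤ) (L : Library Op) : Prop :=
  ∃ p ∈ traceSem I L, p.2.Failed

/-! ## Models and formulas -/

/-- Models: finite partial maps from symbolic integers to integers. -/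
abbrev Model := FMap SInt ℤ

/-- The value of an integer expression in a model (`none` if it is undefined). -/
def Term.eval {Op : Type u} (I : Op → ℤ → ℤ → ℤ) (μ : Model) : Term Op → Option ℤ
  | Term.int i => some i
  | Term.sint κ => μ.lookup κ
  | Term.op o s t =>
      (Term.eval I μ s).bind fun i => (Term.eval I μ t).map fun j => I o i j
  | _ => none

/-- Quantifier-free formulas over integer expressions. -/
inductive Formula (Op : Type u) : Type u where
  | top : Formula Op
  | bot : Formula Op
  | eq : Term Op → Term Op → Formula Op
  | not : Formula Op → Formula Op
  | and : Formula Op → Formula Op → Formula Op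
  | or : Formula Op → Formula Op → Formula Op

namespace Formula

variable {Op : Type u}

/-- The symbolic integers that occur in a formula. -/
def sints : Formula Op → Finset SInt
  | top => ∅
  | bot => ∅
  | eq s t => s.sints ∪ t.sints
  | not φ => φ.sints
  | and φ ψ => φ.sints ∪ ψ.sints
  | or φ ψ => φ.sints ∪ ψ.sints

/-- Truth of a formula. -/
def Holds (I : Op → ℤ → ℤ → ℤ) (μ : Model) : Formula Op → Prop
  | top => True
  | bot => False
  | eq s t => ∃ i : ℤ, s.eval I μ = some i ∧ t.eval I μ = some i
  | not φ => ¬ φ.Holds I μ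
  | and φ ψ => φ.Holds I μ ∧ ψ.Holds I μ
  | or φ ψ => φ.Holds I μ ∨ ψ.Holds I μ

end Formula

/-- `μ ⊨ φ`: all symbolic integers of `φ` are in the domain of `μ`, and `φ` is true. -/
def Model.Sat {Op : Type u} (I : Op → ℤ → ℤ → ℤ) (μ : Model) (φ : Formula Op) : Prop :=
  (∀ κ ∈ φ.sints, κ ∈ μ) ∧ φ.Holds I μ

/-- Symbolic environments: finite partial maps from references and symbolic integers to symbolic
values, given by their restrictions to the two sorts of names. -/
structure SEnv (Op : Type u) : Type u where
  refs : Store Op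
  ints : FMap SInt (Term Op)

/-- The formula `σ°`: the conjunction of the equations `κ = v` for `κ ↦ v` in `σ`. -/
def SEnv.formula {Op : Type u} (σ : SEnv Op) : Formula Op :=
  σ.ints.entries.foldr (fun e φ => Formula.and φ (Formula.eq (Term.sint e.1) e.2)) Formula.top

/-! ## Symbolic semantics -/

/-- Configurations `(M, R, σ, pc, k)`. -/
structure STConf (Op : Type u) : Type u where
  M : Term Op
  R : Repo Op
  σ : SEnv Op
  pc : Formula Op
  k : ℕ

/-- Symbolic term evaluation. `A` and `K` are the method names and the symbolic integers that have
to be avoided, besides those in the domains of `R` and `σ`, when fresh names are picked. -/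
inductive SStep {Op : Type u} (I : Op → ℤ → ℤ → ℤ) (A : Finset MName) (K : Finset SInt) :
    STConf Op → STConf Op → Prop where
  | letin {E : ECtx Op} {x : VName} {v M : Term Op} {R : Repo Op} {σ : SEnv Op} {pc : Formula Op}
      {k : ℕ} :
      E.Valid IsSVal → IsSVal v →
      SStep I A K ⟨E.plug (Term.letin x v M), R, σ, pc, k⟩ ⟨E.plug (M.subst x v), R, σ, pc, k⟩
  | fst {E : ECtx Op} {v w : Term Op} {R : Repo Op} {σ : SEnv Op} {pc : Formula Op} {k : ℕ} :
      E.Valid IsSVal → IsSVal v → IsSVal w →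
      SStep I A K ⟨E.plug (Term.fst (Term.pair v w)), R, σ, pc, k⟩ ⟨E.plug v, R, σ, pc, k⟩
  | snd {E : ECtx Op} {v w : Term Op} {R : Repo Op} {σ : SEnv Op} {pc : Formula Op} {k : ℕ} :
      E.Valid IsSVal → IsSVal v → IsSVal w →
      SStep I A K ⟨E.plug (Term.snd (Term.pair v w)), R, σ, pc, k⟩ ⟨E.plug w, R, σ, pc, k⟩
  | assign {E : ECtx Op} {r : RName} {v : Term Op} {R : Repo Op} {σ : SEnv Op} {pc : Formula Op}
      {k : ℕ} :
      E.Valid IsSVal → IsSVal v →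
      SStep I A K ⟨E.plug (Term.assign r v), R, σ, pc, k⟩
        ⟨E.plug Term.unit, R, ⟨σ.refs.insert r v, σ.ints⟩, pc, k⟩
  | deref {E : ECtx Op} {r : RName} {v : Term Op} {R : Repo Op} {σ : SEnv Op} {pc : Formula Op}
      {k : ℕ} :
      E.Valid IsSVal → σ.refs.lookup r = some v →
      SStep I A K ⟨E.plug (Term.deref r), R, σ, pc, k⟩ ⟨E.plug v, R, σ, pc, k⟩
  | iteTrue {E : ECtx Op} {i : ℤ} {M₁ M₀ : Term Op} {R : Repo Op} {σ : SEnv Op} {pc : Formula Op}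
      {k : ℕ} :
      E.Valid IsSVal → i ≠ 0 →
      SStep I A K ⟨E.plug (Term.ite (Term.int i) M₁ M₀), R, σ, pc, k⟩ ⟨E.plug M₁, R, σ, pc, k⟩
  | iteFalse {E : ECtx Op} {M₁ M₀ : Term Op} {R : Repo Op} {σ : SEnv Op} {pc : Formula Op}
      {k : ℕ} :
      E.Valid IsSVal →
      SStep I A K ⟨E.plug (Term.ite (Term.int 0) M₁ M₀), R, σ, pc, k⟩ ⟨E.plug M₀, R, σ, pc, k⟩
  | op {E : ECtx Op} {o : Op} {i j : ℤ} {R : Repo Op} {σ : SEnv Op} {pc : Formula Op} {k : ℕ} :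
      E.Valid IsSVal →
      SStep I A K ⟨E.plug (Term.op o (Term.int i) (Term.int j)), R, σ, pc, k⟩
        ⟨E.plug (Term.int (I o i j)), R, σ, pc, k⟩
  | lam {E : ECtx Op} {x : VName} {M : Term Op} {m : MName} {R : Repo Op} {σ : SEnv Op}
      {pc : Formula Op} {k : ℕ} :
      E.Valid IsSVal → HasType (Term.lam x M) m.ty → m ∉ R → m ∉ A →
      SStep I A K ⟨E.plug (Term.lam x M), R, σ, pc, k⟩
        ⟨E.plug (Term.meth m), R.insert m (x, M), σ, pc, k⟩
  | assert {E : ECtx Op} {i : ℤ} {R : Repo Op} {σ : SEnv Op} {pc : Formula Op} {k : ℕ} :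
      E.Valid IsSVal → i ≠ 0 →
      SStep I A K ⟨E.plug (Term.assert (Term.int i)), R, σ, pc, k⟩
        ⟨E.plug Term.unit, R, σ, pc, k⟩
  | app {E : ECtx Op} {m : MName} {v : Term Op} {x : VName} {M : Term Op} {R : Repo Op}
      {σ : SEnv Op} {pc : Formula Op} {k : ℕ} :
      E.Valid IsSVal → IsSVal v → R.lookup m = some (x, M) →
      SStep I A K ⟨E.plug (Term.app (Term.meth m) v), R, σ, pc, k⟩
        ⟨E.plug (Term.box (M.subst x v)), R, σ, pc, k + 1⟩
  | box {E : ECtx Op} {v : Term Op} {R : Repo Op} {σ : SEnv Op} {pc : Formula Op} {k : ℕ} :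
      E.Valid IsSVal → IsSVal v →
      SStep I A K ⟨E.plug (Term.box v), R, σ, pc, k + 1⟩ ⟨E.plug v, R, σ, pc, k⟩
  | letrec {E : ECtx Op} {f x : VName} {M N : Term Op} {m : MName} {R : Repo Op} {σ : SEnv Op}
      {pc : Formula Op} {k : ℕ} :
      E.Valid IsSVal → HasType (Term.lam x M) m.ty → m ∉ R → m ∉ A →
      SStep I A K ⟨E.plug (Term.letrec f x M N), R, σ, pc, k⟩
        ⟨E.plug (N.subst f (Term.meth m)), R.insert m (x, M.subst f (Term.meth m)), σ, pc, k⟩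
  | assertSymFail {E : ECtx Op} {κ : SInt} {R : Repo Op} {σ : SEnv Op} {pc : Formula Op} {k : ℕ} :
      E.Valid IsSVal →
      SStep I A K ⟨E.plug (Term.assert (Term.sint κ)), R, σ, pc, k⟩
        ⟨E.plug (Term.assert (Term.int 0)), R, σ,
          Formula.and pc (Formula.eq (Term.sint κ) (Term.int 0)), k⟩
  | assertSymPass {E : ECtx Op} {κ : SInt} {R : Repo Op} {σ : SEnv Op} {pc : Formula Op} {k : ℕ} :
      E.Valid IsSVal →
      SStep I A K ⟨E.plug (Term.assert (Term.sint κ)), R, σ, pc, k⟩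
        ⟨E.plug Term.unit, R, σ,
          Formula.and pc (Formula.not (Formula.eq (Term.sint κ) (Term.int 0))), k⟩
  | opSym {E : ECtx Op} {o : Op} {v w : Term Op} {κ : SInt} {R : Repo Op} {σ : SEnv Op}
      {pc : Formula Op} {k : ℕ} :
      E.Valid IsSVal → IsSVal (Term.op o v w) → κ ∉ σ.ints → κ ∉ K →
      SStep I A K ⟨E.plug (Term.op o v w), R, σ, pc, k⟩
        ⟨E.plug (Term.sint κ), R, ⟨σ.refs, σ.ints.insert κ (Term.op o v w)⟩, pc, k⟩
  | iteSymFalse {E : ECtx Op} {κ : SInt} {M₁ M₀ : Term Op} {R : Repo Op} {σ : SEnv Op}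
      {pc : Formula Op} {k : ℕ} :
      E.Valid IsSVal →
      SStep I A K ⟨E.plug (Term.ite (Term.sint κ) M₁ M₀), R, σ, pc, k⟩
        ⟨E.plug M₀, R, σ, Formula.and pc (Formula.eq (Term.sint κ) (Term.int 0)), k⟩
  | iteSymTrue {E : ECtx Op} {κ : SInt} {M₁ M₀ : Term Op} {R : Repo Op} {σ : SEnv Op}
      {pc : Formula Op} {k : ℕ} :
      E.Valid IsSVal →
      SStep I A K ⟨E.plug (Term.ite (Term.sint κ) M₁ M₀), R, σ, pc, k⟩
        ⟨E.plug M₁, R, σ, Formula.and pc (Formula.not (Formula.eq (Term.sint κ) (Term.int 0))), k⟩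

/-- Abstract names of symbolic configurations: a finite set of method names and symbolic integers,
given by its two parts. -/
structure SAbs : Type where
  meths : Finset MName
  sints : Finset SInt

/-- Symbolic game configurations. -/
inductive SConf (Op : Type u) : Type u where
  | P (stk : List (Frame Op)) (M : Term Op) (R : Repo Op) (pub : Finset MName) (abs : SAbs)
      (σ : SEnv Op) (pc : Formula Op) (k : ℕ) : SConf Op
  | O (stk : List (Frame Op)) (l : ℕ) (R : Repo Op) (pub : Finset MName) (abs : SAbs)
      (σ : SEnv Op) (pc : Formula Op) (k : ℕ) : SConf Op

/-- `SymVal R σ θ abs v abs'` says that `(v, abs') ∈ symval(θ, abs)`: `v` is built from pairwise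
distinct fresh symbolic integers and fresh method names, and `abs'` adds them to `abs`. -/
inductive SymVal {Op : Type u} (R : Repo Op) (σ : SEnv Op) : Ty → SAbs → Term Op → SAbs → Prop where
  | unit (abs : SAbs) : SymVal R σ Ty.unit abs Term.unit abs
  | int (abs : SAbs) (κ : SInt) :
      κ ∉ σ.ints → κ ∉ abs.sints →
      SymVal R σ Ty.int abs (Term.sint κ) ⟨abs.meths, insert κ abs.sints⟩
  | arrow (abs : SAbs) (m : MName) :
      m ∉ R → m ∉ abs.meths →
      SymVal R σ m.ty abs (Term.meth m) ⟨insert m abs.meths, abs.sints⟩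
  | prod {θ₁ θ₂ : Ty} {abs abs₁ abs₂ : SAbs} {v₁ v₂ : Term Op} :
      SymVal R σ θ₁ abs v₁ abs₁ → SymVal R σ θ₂ abs₁ v₂ abs₂ →
      SymVal R σ (Ty.prod θ₁ θ₂) abs (Term.pair v₁ v₂) abs₂

/-- Transitions between symbolic game configurations. -/
inductive STrans {Op : Type u} (I : Op → ℤ → ℤ → ℤ) :
    SConf Op → Option (Move Op) → SConf Op → Prop where
  | int {stk : List (Frame Op)} {M M' : Term Op} {R R' : Repo Op} {pub : Finset MName} {abs : SAbs}
      {σ σ' : SEnv Op} {pc pc' : Formula Op} {k k' : ℕ} :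
      SStep I abs.meths abs.sints ⟨M, R, σ, pc, k⟩ ⟨M', R', σ', pc', k'⟩ →
      STrans I (SConf.P stk M R pub abs σ pc k) none (SConf.P stk M' R' pub abs σ' pc' k')
  | pq {stk : List (Frame Op)} {E : ECtx Op} {m : MName} {v : Term Op} {R : Repo Op}
      {pub : Finset MName} {abs : SAbs} {σ : SEnv Op} {pc : Formula Op} {k : ℕ} :
      E.Valid IsSVal → IsSVal v → m ∈ abs.meths →
      STrans I (SConf.P stk (E.plug (Term.app (Term.meth m) v)) R pub abs σ pc k)
        (some (Move.call m v))
        (SConf.O (Frame.ctx m E :: stk) 0 R (pubAfter pub R v) abs σ pc k)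
  | oq {stk : List (Frame Op)} {l : ℕ} {m : MName} {v : Term Op} {R : Repo Op}
      {pub : Finset MName} {abs abs' : SAbs} {σ : SEnv Op} {pc : Formula Op} {k : ℕ} :
      m ∈ pub → SymVal R σ m.dom abs v abs' →
      STrans I (SConf.O stk l R pub abs σ pc k)
        (some (Move.call m v))
        (SConf.P (Frame.cnt m (l + 1) :: stk) (Term.app (Term.meth m) v) R pub abs' σ pc k)
  | pa {stk : List (Frame Op)} {l : ℕ} {m : MName} {v : Term Op} {R : Repo Op}
      {pub : Finset MName} {abs : SAbs} {σ : SEnv Op} {pc : Formula Op} {k : ℕ} :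
      IsSVal v →
      STrans I (SConf.P (Frame.cnt m l :: stk) v R pub abs σ pc k)
        (some (Move.ret m v))
        (SConf.O stk l R (pubAfter pub R v) abs σ pc k)
  | oa {stk : List (Frame Op)} {E : ECtx Op} {l : ℕ} {m : MName} {v : Term Op} {R : Repo Op}
      {pub : Finset MName} {abs abs' : SAbs} {σ : SEnv Op} {pc : Formula Op} {k : ℕ} :
      SymVal R σ m.cod abs v abs' →
      STrans I (SConf.O (Frame.ctx m E :: stk) l R pub abs σ pc k)
        (some (Move.ret m v))
        (SConf.P stk (E.plug v) R pub abs' σ pc k)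

namespace SConf

variable {Op : Type u}

/-- The symbolic environment of a configuration. -/
def env : SConf Op → SEnv Op
  | P _ _ _ _ _ σ _ _ => σ
  | O _ _ _ _ _ σ _ _ => σ

/-- The path condition of a configuration. -/
def pathCond : SConf Op → Formula Op
  | P _ _ _ _ _ _ pc _ => pc
  | O _ _ _ _ _ _ pc _ => pc

/-- Failed symbolic configurations. -/
def Failed : SConf Op → Prop
  | P _ M _ _ _ _ _ _ => ∃ E : ECtx Op, E.Valid IsSVal ∧ M = E.plug (Term.assert (Term.int 0))
  | O _ _ _ _ _ _ _ _ => False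

end SConf

/-- The symbolic semantics `⟦L⟧ₛ`. -/
def symSem {Op : Type u} (I : Op → ℤ → ℤ → ℤ) (L : Library Op) :
    Set (List (Move Op) × SConf Op) :=
  {p | ∃ (R : Repo Op) (S : Store Op) (pub abs : Finset MName), L.BuildsTo R S pub abs ∧
    Run (STrans I) (SConf.O [] 0 R pub ⟨abs, ∅⟩ ⟨S, ∅⟩ Formula.top 0) p.1 p.2 ∧
    ∃ μ : Model, μ.Sat I (Formula.and p.2.env.formula p.2.pathCond)}

/-- `⟦L⟧ₛ` fails. -/
def SymFails {Op : Type u} (I : Op → ℤ → ℤ → ℤ) (L : Library Op) : Prop :=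
  ∃ p ∈ symSem I L, p.2.Failed

end HOLi

namespace HOLi

universe u

variable {Op : Type u}

/-! ## Typing -/

/-! Both implications are simulations. Failing only asks that some failed configuration be
reachable, so the traces of the two runs need not correspond, and `Reach` forgets them.

From symbolic to concrete: a model of the final environment and path condition is extended to a
total valuation `ν`. Equations and path conditions only accumulate along a run, so `ν` satisfies
those of every earlier configuration (`Run.good`) and decides every branch as the symbolic run did.
In the concrete run O plays the same method names, and `ν κ` for each `κ`. Steps do not match one to
one: `κ ⊕ 1` is a symbolic value, but its concrete counterpart is a redex. Symbolic evaluation may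
therefore postpone an operation, or later perform one that the concrete run has already carried out.
The relation `Inst` allows for both, since an integer expression is matched either by its value or
by an expression of the same shape. The core is `Inst.pull`: once pending operations have been
performed, the concrete term exposes the same redex, unless that redex lies inside an integer
expression already evaluated. `SStep.simulate` and `STrans.simulate` rest on it.

From concrete to symbolic there are two obstacles. First, a valuation must fit symbolic integers
that are introduced only as the run proceeds. A valuation that takes every integer value infinitely
often is fixed in advance (`exists_valuation`); whenever a fresh symbolic integer is needed, one
with the right value is available, so the environment and the path condition hold throughout. A
finite model is cut out at the end.

Second, concrete O may play public methods of P, whereas symbolic O plays only fresh names. A fresh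
abstract name then stands in for the known method. When P calls that method internally, symbolic P
calls the abstract name, and O at once calls a public method with related code on a fresh copy of
the argument; the result is relayed back in the same manner. The relay is possible because the names
that P hands over become public (`Names.exists_pubAfter`). One concrete evaluation context is thus
spread over several symbolic stack frames (`StkSim.unfold`), and several symbolic names may stand
for one concrete name, subject to the invariant `Names`. Calls of this kind are treated in
`ConfSim.step`, their returns in `ConfSim.normalise`. -/

theorem HasType.unique {M : Term Op} {θ θ' : Ty} (h : HasType M θ) (h' : HasType M θ') :
    θ = θ' := by
  induction h generalizing θ' with
  | ite _ _ _ _ ih _ => cases h' with | ite _ h₁ _ => exact ih h₁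
  | pair _ _ ih₁ ih₂ => cases h' with | pair h₁ h₂ => rw [ih₁ h₁, ih₂ h₂]
  | fst _ ih => cases h' with | fst h₁ => have := ih h₁; simp_all
  | snd _ ih => cases h' with | snd h₁ => have := ih h₁; simp_all
  | app _ _ ih _ => cases h' with | app h₁ _ => have := ih h₁; simp_all
  | lam x _ ih => cases h' with | lam _ h₁ => rw [ih h₁]
  | letin x _ _ _ ih => cases h' with | letin _ _ h₁ => exact ih h₁
  | letrec f x _ _ _ ih => cases h' with | letrec _ _ _ h₁ => exact ih h₁
  | box _ ih => cases h' with | box h₁ => exact ih h₁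
  | _ => cases h'; rfl

theorem HasType.subst {M : Term Op} {θ : Ty} {x : VName} {v : Term Op} (h : HasType M θ)
    (hv : HasType v x.ty) : HasType (M.subst x v) θ := by
  induction h with
  | unit => exact .unit
  | int i => exact .int i
  | meth m => exact .meth m
  | deref r => exact .deref r
  | sint κ => exact .sint κ
  | var y =>
    unfold Term.subst
    split_ifs with h
    · subst h; exact hv
    · exact .var y
  | op o _ _ ih₁ ih₂ => exact .op o ih₁ ih₂
  | ite _ _ _ ih₁ ih₂ ih₃ => exact .ite ih₁ ih₂ ih₃
  | pair _ _ ih₁ ih₂ => exact .pair ih₁ ih₂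
  | fst _ ih => exact .fst ih
  | snd _ ih => exact .snd ih
  | assign r _ ih => exact .assign r ih
  | app _ _ ih₁ ih₂ => exact .app ih₁ ih₂
  | lam y h ih =>
    unfold Term.subst
    split_ifs
    · exact .lam y h
    · exact .lam y ih
  | letin y h₁ h₂ ih₁ ih₂ =>
    unfold Term.subst
    split_ifs
    · exact .letin y ih₁ h₂
    · exact .letin y ih₁ ih₂
  | letrec f y h₁ h₂ ih₁ ih₂ =>
    unfold Term.subst at ih₁ ⊢
    refine .letrec f y ?_ ?_
    · by_cases hy : y = x
      · simpa [hy] using h₁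
      · by_cases hf : f = x
        · simpa [hf] using h₁
        · simpa [hy, hf] using ih₁
    · split_ifs
      · exact h₂
      · exact ih₂
  | assert _ ih => exact .assert ih
  | box _ ih => exact .box ih

/-- The context constrains its content only through a type, so a redex may be replaced by any term
of its type. This is the form in which subject reduction uses typing. -/
theorem HasType.of_plug {E : ECtx Op} {M : Term Op} {θ : Ty} (h : HasType (E.plug M) θ) :
    ∃ θ', HasType M θ' ∧ ∀ N, HasType N θ' → HasType (E.plug N) θ := by
  induction E generalizing θ with
  | hole => exact ⟨θ, h, fun _ => id⟩
  | assert E ih =>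
    cases h with | assert h => obtain ⟨θ', h₁, h₂⟩ := ih h; exact ⟨θ', h₁, fun N hN => .assert (h₂ N hN)⟩
  | assign r E ih =>
    cases h with
    | assign _ h => obtain ⟨θ', h₁, h₂⟩ := ih h; exact ⟨θ', h₁, fun N hN => .assign r (h₂ N hN)⟩
  | opL o E P ih =>
    cases h with
    | op _ h h' => obtain ⟨θ', h₁, h₂⟩ := ih h; exact ⟨θ', h₁, fun N hN => .op o (h₂ N hN) h'⟩
  | opR o v E ih =>
    cases h with
    | op _ h' h => obtain ⟨θ', h₁, h₂⟩ := ih h; exact ⟨θ', h₁, fun N hN => .op o h' (h₂ N hN)⟩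
  | pairL E P ih =>
    cases h with
    | pair h h' => obtain ⟨θ', h₁, h₂⟩ := ih h; exact ⟨θ', h₁, fun N hN => .pair (h₂ N hN) h'⟩
  | pairR v E ih =>
    cases h with
    | pair h' h => obtain ⟨θ', h₁, h₂⟩ := ih h; exact ⟨θ', h₁, fun N hN => .pair h' (h₂ N hN)⟩
  | fst E ih =>
    cases h with | fst h => obtain ⟨θ', h₁, h₂⟩ := ih h; exact ⟨θ', h₁, fun N hN => .fst (h₂ N hN)⟩
  | snd E ih =>
    cases h with | snd h => obtain ⟨θ', h₁, h₂⟩ := ih h; exact ⟨θ', h₁, fun N hN => .snd (h₂ N hN)⟩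
  | appL E P ih =>
    cases h with
    | app h h' => obtain ⟨θ', h₁, h₂⟩ := ih h; exact ⟨θ', h₁, fun N hN => .app (h₂ N hN) h'⟩
  | appR m E ih =>
    cases h with
    | app h' h => obtain ⟨θ', h₁, h₂⟩ := ih h; exact ⟨θ', h₁, fun N hN => .app h' (h₂ N hN)⟩
  | letin x E P ih =>
    cases h with
    | letin _ h h' => obtain ⟨θ', h₁, h₂⟩ := ih h; exact ⟨θ', h₁, fun N hN => .letin x (h₂ N hN) h'⟩
  | ite E P Q ih =>
    cases h with
    | ite h h' h'' => obtain ⟨θ', h₁, h₂⟩ := ih h; exact ⟨θ', h₁, fun N hN => .ite (h₂ N hN) h' h''⟩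
  | box E ih =>
    cases h with | box h => obtain ⟨θ', h₁, h₂⟩ := ih h; exact ⟨θ', h₁, fun N hN => .box (h₂ N hN)⟩

theorem HasType.app_meth {m : MName} {v : Term Op} {θ : Ty}
    (h : HasType (Term.app (Term.meth m) v) θ) : HasType v m.dom ∧ θ = m.cod := by
  cases h with
  | app h h' =>
    have := (HasType.meth m).unique h
    simp only [MName.ty, Ty.arrow.injEq] at this
    obtain ⟨rfl, rfl⟩ := this
    exact ⟨h', rfl⟩

theorem HasType.of_lam {x : VName} {M : Term Op} {m : MName} (h : HasType (Term.lam x M) m.ty) :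
    x.ty = m.dom ∧ HasType M m.cod := by
  generalize hθ : m.ty = θ at h
  cases h with
  | lam _ h =>
    simp only [MName.ty, Ty.arrow.injEq] at hθ
    obtain ⟨h₁, rfl⟩ := hθ
    exact ⟨h₁.symm, h⟩

/-- Repositories and stores with well-typed entries. -/
structure WTEnv (R : Repo Op) (S : Store Op) : Prop where
  repo : ∀ m x M, R.lookup m = some (x, M) → HasType (Term.lam x M) m.ty
  store : ∀ r v, S.lookup r = some v → HasType v r.ty

theorem WTEnv.insertRepo {R : Repo Op} {S : Store Op} (h : WTEnv R S) {m : MName} {x : VName}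
    {M : Term Op} (hM : HasType (Term.lam x M) m.ty) : WTEnv (R.insert m (x, M)) S := by
  refine ⟨fun m' y N hm => ?_, h.store⟩
  by_cases hmm : m' = m
  · subst hmm
    rw [AList.lookup_insert] at hm
    cases hm
    exact hM
  · rw [AList.lookup_insert_ne hmm] at hm
    exact h.repo _ _ _ hm

theorem WTEnv.insertStore {R : Repo Op} {S : Store Op} (h : WTEnv R S) {r : RName} {v : Term Op}
    (hv : HasType v r.ty) : WTEnv R (S.insert r v) := by
  refine ⟨h.repo, fun r' w hr => ?_⟩
  by_cases hrr : r' = r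
  · subst hrr
    rw [AList.lookup_insert] at hr
    cases hr
    exact hv
  · rw [AList.lookup_insert_ne hrr] at hr
    exact h.store _ _ hr

/-- Typing of evaluation stacks; the index is the type of the term that is being evaluated on top
of the stack (`none` if it is O's turn). -/
inductive StkT : Option Ty → List (Frame Op) → Prop where
  | nil : StkT none []
  | ctx {m : MName} {E : ECtx Op} {θ : Ty} {s : List (Frame Op)} :
      StkT (some θ) s → (∀ M, HasType M m.cod → HasType (E.plug M) θ) →
      StkT none (Frame.ctx m E :: s)
  | cnt {m : MName} {l : ℕ} {s : List (Frame Op)} :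
      StkT none s → StkT (some m.cod) (Frame.cnt m l :: s)

/-- Well-typed symbolic configurations, all of whose public names are defined. -/
def SConf.WT : SConf Op → Prop
  | P stk M R pub _ σ _ _ =>
      WTEnv R σ.refs ∧ (∀ m ∈ pub, m ∈ R) ∧ ∃ θ, HasType M θ ∧ StkT (some θ) stk
  | O stk _ R pub _ σ _ _ => WTEnv R σ.refs ∧ (∀ m ∈ pub, m ∈ R) ∧ StkT none stk

theorem SStep.preserves {I : Op → ℤ → ℤ → ℤ} {A : Finset MName} {K : Finset SInt}
    {c c' : STConf Op} (h : SStep I A K c c') {θ : Ty} (hE : WTEnv c.R c.σ.refs)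
    (hM : HasType c.M θ) :
    WTEnv c'.R c'.σ.refs ∧ HasType c'.M θ ∧ ∀ m ∈ c.R, m ∈ c'.R := by
  cases h with
  | letin _ _ =>
    obtain ⟨_, h₁, h₂⟩ := hM.of_plug
    cases h₁ with | letin _ h₃ h₄ => exact ⟨hE, h₂ _ (h₄.subst h₃), fun _ => id⟩
  | fst _ _ _ =>
    obtain ⟨_, h₁, h₂⟩ := hM.of_plug
    cases h₁ with | fst h₃ => cases h₃ with | pair h₄ h₅ => exact ⟨hE, h₂ _ h₄, fun _ => id⟩
  | snd _ _ _ =>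
    obtain ⟨_, h₁, h₂⟩ := hM.of_plug
    cases h₁ with | snd h₃ => cases h₃ with | pair h₄ h₅ => exact ⟨hE, h₂ _ h₅, fun _ => id⟩
  | assign _ _ =>
    obtain ⟨_, h₁, h₂⟩ := hM.of_plug
    cases h₁ with | assign _ h₃ => exact ⟨hE.insertStore h₃, h₂ _ .unit, fun _ => id⟩
  | deref _ hl =>
    obtain ⟨_, h₁, h₂⟩ := hM.of_plug
    cases h₁ with | deref _ => exact ⟨hE, h₂ _ (hE.store _ _ hl), fun _ => id⟩
  | iteTrue _ _ =>
    obtain ⟨_, h₁, h₂⟩ := hM.of_plug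
    cases h₁ with | ite _ h₃ h₄ => exact ⟨hE, h₂ _ h₃, fun _ => id⟩
  | iteFalse _ =>
    obtain ⟨_, h₁, h₂⟩ := hM.of_plug
    cases h₁ with | ite _ h₃ h₄ => exact ⟨hE, h₂ _ h₄, fun _ => id⟩
  | iteSymTrue _ =>
    obtain ⟨_, h₁, h₂⟩ := hM.of_plug
    cases h₁ with | ite _ h₃ h₄ => exact ⟨hE, h₂ _ h₃, fun _ => id⟩
  | iteSymFalse _ =>
    obtain ⟨_, h₁, h₂⟩ := hM.of_plug
    cases h₁ with | ite _ h₃ h₄ => exact ⟨hE, h₂ _ h₄, fun _ => id⟩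
  | op _ =>
    obtain ⟨_, h₁, h₂⟩ := hM.of_plug
    cases h₁ with | op _ _ _ => exact ⟨hE, h₂ _ (.int _), fun _ => id⟩
  | opSym _ _ _ _ =>
    obtain ⟨_, h₁, h₂⟩ := hM.of_plug
    cases h₁ with | op _ _ _ => exact ⟨hE, h₂ _ (.sint _), fun _ => id⟩
  | assert _ _ =>
    obtain ⟨_, h₁, h₂⟩ := hM.of_plug
    cases h₁ with | assert _ => exact ⟨hE, h₂ _ .unit, fun _ => id⟩
  | assertSymPass _ =>
    obtain ⟨_, h₁, h₂⟩ := hM.of_plug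
    cases h₁ with | assert _ => exact ⟨hE, h₂ _ .unit, fun _ => id⟩
  | assertSymFail _ =>
    obtain ⟨_, h₁, h₂⟩ := hM.of_plug
    cases h₁ with | assert _ => exact ⟨hE, h₂ _ (.assert (.int 0)), fun _ => id⟩
  | box _ _ =>
    obtain ⟨_, h₁, h₂⟩ := hM.of_plug
    cases h₁ with | box h₃ => exact ⟨hE, h₂ _ h₃, fun _ => id⟩
  | app _ _ hl =>
    obtain ⟨_, h₁, h₂⟩ := hM.of_plug
    obtain ⟨h₃, rfl⟩ := h₁.app_meth
    obtain ⟨h₄, h₅⟩ := (hE.repo _ _ _ hl).of_lam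
    exact ⟨hE, h₂ _ (.box (h₅.subst (h₄ ▸ h₃))), fun _ => id⟩
  | lam _ hm _ _ =>
    obtain ⟨_, h₁, h₂⟩ := hM.of_plug
    refine ⟨hE.insertRepo hm, h₂ _ ?_, fun _ h => (AList.mem_insert _).2 (Or.inr h)⟩
    -- The fresh name carries the type of the abstraction it names, so it fits the hole.
    rw [h₁.unique hm]
    exact .meth _
  | @letrec E f x M N m _ _ _ _ _ hm _ _ =>
    obtain ⟨_, h₁, h₂⟩ := hM.of_plug
    cases h₁ with
    | letrec _ _ h₃ h₄ =>
      have hf : HasType (Term.meth m : Term Op) f.ty := by rw [h₃.unique hm]; exact .meth m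
      obtain ⟨h₅, h₆⟩ := hm.of_lam
      refine ⟨hE.insertRepo ?_, h₂ _ (h₄.subst hf), fun _ h => (AList.mem_insert _).2 (Or.inr h)⟩
      rw [MName.ty, ← h₅]
      exact .lam _ (h₆.subst hf)

theorem SymVal.hasType {R : Repo Op} {σ : SEnv Op} {θ : Ty} {abs abs' : SAbs} {v : Term Op}
    (h : SymVal R σ θ abs v abs') : HasType v θ := by
  induction h with
  | unit => exact .unit
  | int => exact .sint _
  | arrow => exact .meth _
  | prod _ _ ih₁ ih₂ => exact .pair ih₁ ih₂

theorem mem_of_mem_pubAfter {pub : Finset MName} {R : Repo Op} {v : Term Op}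
    (h : ∀ m ∈ pub, m ∈ R) : ∀ m ∈ pubAfter pub R v, m ∈ R := by
  intro m hm
  simp only [pubAfter, Finset.mem_union, Finset.mem_filter] at hm
  rcases hm with hm | hm
  · exact h m hm
  · exact hm.2

theorem STrans.preserves {I : Op → ℤ → ℤ → ℤ} {ρ ρ' : SConf Op} {χ : Option (Move Op)}
    (h : STrans I ρ χ ρ') (hρ : ρ.WT) : ρ'.WT := by
  cases h with
  | int h =>
    obtain ⟨hE, hp, θ, hM, hs⟩ := hρ
    obtain ⟨h₁, h₂, h₃⟩ := h.preserves hE hM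
    exact ⟨h₁, fun m hm => h₃ m (hp m hm), θ, h₂, hs⟩
  | pq _ _ _ =>
    obtain ⟨hE, hp, θ, hM, hs⟩ := hρ
    obtain ⟨_, h₁, h₂⟩ := hM.of_plug
    obtain ⟨-, rfl⟩ := h₁.app_meth
    exact ⟨hE, mem_of_mem_pubAfter hp, .ctx hs h₂⟩
  | oq _ hv =>
    obtain ⟨hE, hp, hs⟩ := hρ
    exact ⟨hE, hp, _, .app (.meth _) hv.hasType, .cnt hs⟩
  | pa _ =>
    obtain ⟨hE, hp, θ, hM, hs⟩ := hρ
    cases hs with | cnt hs => exact ⟨hE, mem_of_mem_pubAfter hp, hs⟩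
  | oa hv =>
    obtain ⟨hE, hp, hs⟩ := hρ
    cases hs with | ctx hs hE' => exact ⟨hE, hp, _, hE' _ hv.hasType, hs⟩

/-! ### Runs of a labelled transition system -/

theorem Run.trans {C Mv : Type u} {T : C → Option Mv → C → Prop} {a b c : C} {τ τ' : List Mv}
    (h : Run T a τ b) (h' : Run T b τ' c) : Run T a (τ ++ τ') c := by
  induction h with
  | refl => exact h'
  | step ht _ ih => rw [List.append_assoc]; exact .step ht (ih h')

theorem Run.single {C Mv : Type u} {T : C → Option Mv → C → Prop} {a b : C} {χ : Option Mv}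
    (h : T a χ b) : Run T a χ.toList b := by
  simpa using Run.step h (Run.refl b)

theorem Run.invariant {C Mv : Type u} {T : C → Option Mv → C → Prop} {p : C → Prop}
    (hT : ∀ a χ b, T a χ b → p a → p b) {a b : C} {τ : List Mv} (h : Run T a τ b) (ha : p a) :
    p b := by
  induction h with
  | refl => exact ha
  | step ht _ ih => exact ih (hT _ _ _ ht ha)

/-! ## Library builds -/

/-- What holds of the result of a library build. -/
structure Built (R : Repo Op) (S : Store Op) (pub abs : Finset MName) : Prop where
  typed : WTEnv R S
  source : ∀ m x M, R.lookup m = some (x, M) → M.Source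
  closed : ∀ m x M, R.lookup m = some (x, M) → ∀ m' ∈ M.meths, m' ∈ R ∨ m' ∈ abs
  store : ∀ r v, S.lookup r = some v → (∃ i, v = Term.int i) ∨ ∃ m ∈ R, v = Term.meth m
  pub : ∀ m ∈ pub, m ∈ R
  disjoint : ∀ m ∈ R, m ∉ abs

/-- Invariant of the build of `L`. -/
structure BuildInv (L : Library Op) (c : BuildConf Op) : Prop where
  typed : WTEnv c.R c.S
  source : ∀ m x M, c.R.lookup m = some (x, M) → M.Source
  closed : ∀ m x M, c.R.lookup m = some (x, M) →
    ∀ m' ∈ M.meths, m' ∈ L.abstracts ∨ m' ∈ blockMeths L.block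
  store : ∀ r v, c.S.lookup r = some v → (∃ i, v = Term.int i) ∨ ∃ m ∈ c.R, v = Term.meth m
  pub : ∀ m ∈ c.pub, m ∈ c.R
  disjoint : ∀ m, m ∈ c.R ∨ m ∈ blockMeths c.lib.block → m ∉ c.abs ∧ m ∉ c.lib.abstracts
  names : ∀ m, m ∈ L.abstracts ∨ m ∈ blockMeths L.block →
    m ∈ c.R ∨ m ∈ c.abs ∨ m ∈ c.lib.abstracts ∨ m ∈ blockMeths c.lib.block
  good : ∀ d ∈ c.lib.block, L.GoodDecl d

theorem lookup_insert_cases {α β : Type*} [DecidableEq α] {R : FMap α β} {m m' : α} {a b : β}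
    (h : (R.insert m a).lookup m' = some b) : m' = m ∧ b = a ∨ R.lookup m' = some b := by
  by_cases hm : m' = m
  · subst hm
    rw [AList.lookup_insert] at h
    exact Or.inl ⟨rfl, (Option.some.inj h).symm⟩
  · rw [AList.lookup_insert_ne hm] at h
    exact Or.inr h

/-- Common to the three kinds of declaration that define a method. For public and private methods
`m` moves from the remaining block to the repository. For a reference to an abstraction `m` is new
and the block loses no method. The hypotheses `hd` and `hd'` cover both situations. -/
theorem BuildInv.insert {L : Library Op} {Bl : List (Decl Op)} {R : Repo Op} {S : Store Op}
    {pub pub' abs : Finset MName} {d : Decl Op} {m : MName} {x : VName} {M : Term Op} {θ : Ty}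
    (h : BuildInv L ⟨⟨[], d :: Bl⟩, R, S, pub, abs⟩) (hg : L.GoodBody x M θ) (hθ : m.ty = θ)
    (hpub : ∀ m' ∈ pub', m' = m ∨ m' ∈ pub)
    (hd : ∀ m', m' ∈ blockMeths (d :: Bl) → m' = m ∨ m' ∈ blockMeths Bl)
    (hd' : ∀ m', m' ∈ blockMeths Bl → m' ∈ blockMeths (d :: Bl))
    (hm : m ∉ abs) :
    BuildInv L ⟨⟨[], Bl⟩, R.insert m (x, M), S, pub', abs⟩ := by
  subst hθ
  constructor
  · exact h.typed.insertRepo hg.2.1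
  · intro m' y N hl
    rcases lookup_insert_cases hl with ⟨_, h'⟩ | h'
    · cases h'; exact hg.1
    · exact h.source _ _ _ h'
  · intro m' y N hl
    rcases lookup_insert_cases hl with ⟨_, h'⟩ | h'
    · cases h'; exact hg.2.2.1
    · exact h.closed _ _ _ h'
  · intro r v hr
    rcases h.store r v hr with h' | ⟨m', h₁, h₂⟩
    · exact Or.inl h'
    · exact Or.inr ⟨m', (AList.mem_insert _).2 (Or.inr h₁), h₂⟩
  · intro m' hm'
    rcases hpub m' hm' with h' | h'
    · exact (AList.mem_insert _).2 (Or.inl h')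
    · exact (AList.mem_insert _).2 (Or.inr (h.pub _ h'))
  · rintro m' (h' | h')
    · rcases (AList.mem_insert _).1 h' with rfl | h'
      · exact ⟨hm, List.not_mem_nil⟩
      · exact h.disjoint m' (Or.inl h')
    · exact h.disjoint m' (Or.inr (hd' _ h'))
  · intro m' hm'
    have := h.names m' hm'
    have := hd m'
    simp only [AList.mem_insert] at *
    tauto
  · exact fun d' hd' => h.good d' (List.mem_cons_of_mem _ hd')

theorem Build.preserves {L : Library Op} {c c' : BuildConf Op} (h : Build c c')
    (hc : BuildInv L c) : BuildInv L c' := by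
  cases h with
  | abs h =>
    refine ⟨hc.typed, hc.source, hc.closed, hc.store, hc.pub, ?_, ?_, hc.good⟩
    · intro m hm
      have := hc.disjoint m hm
      simp only [List.mem_cons, Finset.mem_insert] at *
      tauto
    · intro m hm
      have := hc.names m hm
      simp only [List.mem_cons, Finset.mem_insert] at *
      tauto
  | pub h₁ h₂ =>
    refine hc.insert (hc.good _ List.mem_cons_self) rfl ?_ ?_ ?_
      (hc.disjoint _ (Or.inr (by simp [blockMeths, Decl.meth?]))).1
    · simp
    · simp [blockMeths, Decl.meth?]
    · simp only [blockMeths, Decl.meth?, List.filterMap_cons]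
      simp +contextual
  | priv h₁ =>
    refine hc.insert (hc.good _ List.mem_cons_self) rfl ?_ ?_ ?_
      (hc.disjoint _ (Or.inr (by simp [blockMeths, Decl.meth?]))).1
    · simp +contextual
    · simp [blockMeths, Decl.meth?]
    · simp only [blockMeths, Decl.meth?, List.filterMap_cons]
      simp +contextual
  | @refInt r i Bl R S P A h₁ =>
    have hg : r.ty = Ty.int := hc.good _ List.mem_cons_self
    refine ⟨hc.typed.insertStore (hg ▸ .int i), hc.source, hc.closed, ?_, hc.pub, hc.disjoint, hc.names,
      fun d' hd' => hc.good d' (List.mem_cons_of_mem _ hd')⟩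
    intro r' v hr
    rcases lookup_insert_cases hr with ⟨_, h'⟩ | h'
    · exact Or.inl ⟨i, h'⟩
    · exact hc.store _ _ h'
  | @refLam r x M m Bl R S P A h₁ h₂ h₃ h₄ h₅ =>
    have hg : L.GoodBody x M r.ty := hc.good _ List.mem_cons_self
    have := hc.insert (m := m) (pub' := P) hg h₂ (fun _ => Or.inr) (fun _ => Or.inr) (fun _ => id) h₄
    refine ⟨this.typed.insertStore (h₂ ▸ .meth m), this.source, this.closed, ?_, this.pub,
      this.disjoint, this.names, this.good⟩
    intro r' v hr
    rcases lookup_insert_cases hr with ⟨_, h'⟩ | h'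
    · exact Or.inr ⟨m, (AList.mem_insert _).2 (Or.inl rfl), h'⟩
    · exact this.store _ _ h'

theorem Library.WellTyped.built {L : Library Op} (hL : L.WellTyped) {R : Repo Op} {S : Store Op}
    {pub abs : Finset MName} (h : L.BuildsTo R S pub abs) : Built R S pub abs := by
  have h₀ : BuildInv L ⟨L, ∅, ∅, ∅, ∅⟩ := by
    refine ⟨⟨?_, ?_⟩, ?_, ?_, ?_, ?_, ?_, fun m hm => Or.inr (Or.inr hm), hL.2.2⟩
    · intro m x M h; simp at h
    · intro m x h; simp at h
    · intro m x M h; simp at h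
    · intro m x M h; simp at h
    · intro m x h; simp at h
    · simp
    · rintro m (h | h)
      · simp at h
      · exact ⟨by simp, fun h' => (List.nodup_append.1 hL.1).2.2 m h' m h rfl⟩
  have h₁ : BuildInv L ⟨⟨[], []⟩, R, S, pub, abs⟩ := by
    unfold Library.BuildsTo at h
    generalize (⟨⟨[], []⟩, R, S, pub, abs⟩ : BuildConf Op) = c at h ⊢
    induction h with
    | refl => exact h₀
    | tail _ hb ih => exact hb.preserves ih
  refine ⟨h₁.typed, h₁.source, fun m x M hl m' hm' => ?_, h₁.store, h₁.pub,
    fun m hm => (h₁.disjoint m (Or.inl hm)).1⟩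
  -- During the build a body may mention methods that are defined later, so closedness is kept
  -- relative to all names of `L`. With nothing left to process, each of these is defined or
  -- abstract.
  have := h₁.names m' (h₁.closed m x M hl m' hm')
  simpa [blockMeths] using this

/-! ## Valuations -/

/-- The value of an integer expression under a total valuation. -/
def Term.evalT (I : Op → ℤ → ℤ → ℤ) (ν : SInt → ℤ) : Term Op → Option ℤ
  | Term.int i => some i
  | Term.sint κ => some (ν κ)
  | Term.op o s t => (s.evalT I ν).bind fun i => (t.evalT I ν).map fun j => I o i j
  | _ => none

/-- Truth of a formula under a total valuation. -/
def Formula.HoldsT (I : Op → ℤ → ℤ → ℤ) (ν : SInt → ℤ) : Formula Op → Prop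
  | top => True
  | bot => False
  | eq s t => ∃ i : ℤ, s.evalT I ν = some i ∧ t.evalT I ν = some i
  | not φ => ¬ φ.HoldsT I ν
  | and φ ψ => φ.HoldsT I ν ∧ ψ.HoldsT I ν
  | or φ ψ => φ.HoldsT I ν ∨ ψ.HoldsT I ν

theorem Term.eval_eq_evalT {I : Op → ℤ → ℤ → ℤ} {μ : Model} {ν : SInt → ℤ} {t : Term Op}
    (h : ∀ κ ∈ t.sints, μ.lookup κ = some (ν κ)) : t.eval I μ = t.evalT I ν := by
  induction t with
  | op o s t ih₁ ih₂ =>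
    simp only [Term.sints, Finset.mem_union] at h
    simp only [Term.eval, Term.evalT, ih₁ fun κ hκ => h κ (Or.inl hκ),
      ih₂ fun κ hκ => h κ (Or.inr hκ)]
  | sint κ => simpa [Term.eval, Term.evalT, Term.sints] using h
  | _ => simp [Term.eval, Term.evalT]

theorem Formula.holds_iff_holdsT {I : Op → ℤ → ℤ → ℤ} {μ : Model} {ν : SInt → ℤ} {φ : Formula Op}
    (h : ∀ κ ∈ φ.sints, μ.lookup κ = some (ν κ)) : φ.Holds I μ ↔ φ.HoldsT I ν := by
  induction φ with
  | top => simp [Holds, HoldsT]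
  | bot => simp [Holds, HoldsT]
  | eq s t =>
    simp only [sints, Finset.mem_union] at h
    simp only [Holds, HoldsT, Term.eval_eq_evalT fun κ hκ => h κ (Or.inl hκ),
      Term.eval_eq_evalT fun κ hκ => h κ (Or.inr hκ)]
  | not φ ih => simp only [Holds, HoldsT, ih h]
  | and φ ψ ih₁ ih₂ =>
    simp only [sints, Finset.mem_union] at h
    simp only [Holds, HoldsT, ih₁ fun κ hκ => h κ (Or.inl hκ), ih₂ fun κ hκ => h κ (Or.inr hκ)]
  | or φ ψ ih₁ ih₂ =>
    simp only [sints, Finset.mem_union] at h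
    simp only [Holds, HoldsT, ih₁ fun κ hκ => h κ (Or.inl hκ), ih₂ fun κ hκ => h κ (Or.inr hκ)]

/-- The valuation `ν` satisfies the equations of `σ` and the path condition. -/
structure Good (I : Op → ℤ → ℤ → ℤ) (ν : SInt → ℤ) (σ : SEnv Op) (pc : Formula Op) : Prop where
  env : ∀ κ t, σ.ints.lookup κ = some t → t.evalT I ν = some (ν κ)
  pathCond : pc.HoldsT I ν

/-- Keys of an association list are distinct, so its entries are exactly the results of lookup. -/
theorem SEnv.formula_holdsT {I : Op → ℤ → ℤ → ℤ} {ν : SInt → ℤ} {σ : SEnv Op} :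
    σ.formula.HoldsT I ν ↔ ∀ κ t, σ.ints.lookup κ = some t → t.evalT I ν = some (ν κ) := by
  have key : ∀ l : List (Sigma fun _ : SInt => Term Op),
      (l.foldr (fun e φ => Formula.and φ (Formula.eq (Term.sint e.1) e.2)) Formula.top).HoldsT I ν ↔
        ∀ e ∈ l, e.2.evalT I ν = some (ν e.1) := by
    intro l
    induction l with
    | nil => simp [Formula.HoldsT]
    | cons e l ih => simp [Formula.HoldsT, Term.evalT, ih, and_comm]
  unfold SEnv.formula
  rw [key]
  constructor
  · intro h κ t hκ
    exact h _ (AList.mem_lookup_iff.1 hκ)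
  · rintro h ⟨κ, t⟩ he
    exact h κ t (AList.mem_lookup_iff.2 he)

/-- Symbolic integers outside the model receive the default 0. They do not occur in the satisfied
formula, so this is harmless; O simply plays 0 for them. -/
theorem Good.of_sat {I : Op → ℤ → ℤ → ℤ} {μ : Model} {σ : SEnv Op} {pc : Formula Op}
    (h : μ.Sat I (Formula.and σ.formula pc)) :
    Good I (fun κ => (μ.lookup κ).getD 0) σ pc := by
  have := (Formula.holds_iff_holdsT (I := I) (ν := fun κ => (μ.lookup κ).getD 0) fun κ hκ => by
    obtain ⟨i, hi⟩ := Option.isSome_iff_exists.1 (AList.lookup_isSome.2 (h.1 κ hκ))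
    simp [hi]).1 h.2
  exact ⟨SEnv.formula_holdsT.1 this.1, this.2⟩

/-- Only finitely many symbolic integers occur in the formula; the model records `ν` on those. -/
theorem Good.exists_sat {I : Op → ℤ → ℤ → ℤ} {ν : SInt → ℤ} {σ : SEnv Op} {pc : Formula Op}
    (h : Good I ν σ pc) : ∃ μ : Model, μ.Sat I (Formula.and σ.formula pc) := by
  have key : ∀ F : Finset SInt, ∃ μ : Model, ∀ κ ∈ F, μ.lookup κ = some (ν κ) := by
    intro F
    induction F using Finset.induction_on with
    | empty => exact ⟨∅, by simp⟩
    | insert κ F _ ih =>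
      obtain ⟨μ, hμ⟩ := ih
      refine ⟨μ.insert κ (ν κ), fun κ' hκ' => ?_⟩
      by_cases h : κ' = κ
      · subst h; simp
      · rw [AList.lookup_insert_ne h]
        exact hμ κ' (Finset.mem_of_mem_insert_of_ne hκ' h)
  obtain ⟨μ, hμ⟩ := key (Formula.and σ.formula pc).sints
  refine ⟨μ, fun κ hκ => ?_, (Formula.holds_iff_holdsT hμ).2 ⟨SEnv.formula_holdsT.2 h.env, h.pathCond⟩⟩
  exact AList.lookup_isSome.1 (by rw [hμ κ hκ]; rfl)

/-! ## Relating symbolic and concrete terms -/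

/-- Terms built from integer constants, symbolic integers and operations. -/
def Term.Arith : Term Op → Prop
  | Term.int _ => True
  | Term.sint _ => True
  | Term.op _ s t => s.Arith ∧ t.Arith
  | _ => False

theorem Term.Arith.of_evalT {I : Op → ℤ → ℤ → ℤ} {ν : SInt → ℤ} {s : Term Op} {i : ℤ}
    (h : s.evalT I ν = some i) : s.Arith := by
  induction s generalizing i with
  | op o s t ih₁ ih₂ =>
    simp only [evalT, Option.bind_eq_some_iff, Option.map_eq_some_iff] at h
    obtain ⟨j, h₁, k, h₂, -⟩ := h
    exact ⟨ih₁ h₁, ih₂ h₂⟩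
  | _ => simp_all [evalT, Arith]

theorem Term.Arith.subst {s : Term Op} (h : s.Arith) (x : VName) (v : Term Op) :
    s.subst x v = s := by
  induction s with
  | op o s t ih₁ ih₂ => simp only [Term.subst, ih₁ h.1, ih₂ h.2]
  | _ => simp_all [Arith, Term.subst]

theorem Term.Arith.hasType {s : Term Op} (h : s.Arith) : HasType s Ty.int := by
  induction s with
  | op o s t ih₁ ih₂ => exact .op o (ih₁ h.1) (ih₂ h.2)
  | int i => exact .int i
  | sint κ => exact .sint κ
  | _ => simp [Arith] at h

theorem Term.Arith.meths {s : Term Op} (h : s.Arith) : s.meths = ∅ := by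
  induction s with
  | op o s t ih₁ ih₂ => simp [Term.meths, ih₁ h.1, ih₂ h.2]
  | _ => simp_all [Arith, Term.meths]

/-- `Rel Q B s c` relates the symbolic term `s` to the concrete term `c`: they agree up to the
relation `Q` on method names, and up to replacing integer expressions by their values, as given
by `B`. -/
inductive Rel (Q : MName → MName → Prop) (B : Term Op → ℤ → Prop) : Term Op → Term Op → Prop where
  | coll {s : Term Op} {i : ℤ} : B s i → Rel Q B s (Term.int i)
  | meth {m m' : MName} : Q m m' → Rel Q B (Term.meth m) (Term.meth m')
  | int (i : ℤ) : Rel Q B (Term.int i) (Term.int i)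
  | unit : Rel Q B Term.unit Term.unit
  | var (x : VName) : Rel Q B (Term.var x) (Term.var x)
  | lam (x : VName) {M M' : Term Op} : Rel Q B M M' → Rel Q B (Term.lam x M) (Term.lam x M')
  | assign (r : RName) {M M' : Term Op} :
      Rel Q B M M' → Rel Q B (Term.assign r M) (Term.assign r M')
  | deref (r : RName) : Rel Q B (Term.deref r) (Term.deref r)
  | op (o : Op) {M M' N N' : Term Op} :
      Rel Q B M M' → Rel Q B N N' → Rel Q B (Term.op o M N) (Term.op o M' N')
  | pair {M M' N N' : Term Op} :
      Rel Q B M M' → Rel Q B N N' → Rel Q B (Term.pair M N) (Term.pair M' N')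
  | fst {M M' : Term Op} : Rel Q B M M' → Rel Q B (Term.fst M) (Term.fst M')
  | snd {M M' : Term Op} : Rel Q B M M' → Rel Q B (Term.snd M) (Term.snd M')
  | app {M M' N N' : Term Op} :
      Rel Q B M M' → Rel Q B N N' → Rel Q B (Term.app M N) (Term.app M' N')
  | ite {M M' N N' P P' : Term Op} :
      Rel Q B M M' → Rel Q B N N' → Rel Q B P P' → Rel Q B (Term.ite M N P) (Term.ite M' N' P')
  | letrec (f x : VName) {M M' N N' : Term Op} :
      Rel Q B M M' → Rel Q B N N' → Rel Q B (Term.letrec f x M N) (Term.letrec f x M' N')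
  | letin (x : VName) {M M' N N' : Term Op} :
      Rel Q B M M' → Rel Q B N N' → Rel Q B (Term.letin x M N) (Term.letin x M' N')
  | assert {M M' : Term Op} : Rel Q B M M' → Rel Q B (Term.assert M) (Term.assert M')
  | box {M M' : Term Op} : Rel Q B M M' → Rel Q B (Term.box M) (Term.box M')

section Rel

variable {Q Q' : MName → MName → Prop} {B : Term Op → ℤ → Prop}

theorem Rel.mono {s c : Term Op} (h : Rel Q B s c) (hQ : ∀ m m', Q m m' → Q' m m') :
    Rel Q' B s c := by
  induction h with
  | coll h => exact .coll h
  | meth h => exact .meth (hQ _ _ h)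
  | int i => exact .int i
  | unit => exact .unit
  | var x => exact .var x
  | deref r => exact .deref r
  | lam x _ ih => exact .lam x ih
  | assign r _ ih => exact .assign r ih
  | op o _ _ ih₁ ih₂ => exact .op o ih₁ ih₂
  | pair _ _ ih₁ ih₂ => exact .pair ih₁ ih₂
  | fst _ ih => exact .fst ih
  | snd _ ih => exact .snd ih
  | app _ _ ih₁ ih₂ => exact .app ih₁ ih₂
  | ite _ _ _ ih₁ ih₂ ih₃ => exact .ite ih₁ ih₂ ih₃
  | letrec f x _ _ ih₁ ih₂ => exact .letrec f x ih₁ ih₂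
  | letin x _ _ ih₁ ih₂ => exact .letin x ih₁ ih₂
  | assert _ ih => exact .assert ih
  | box _ ih => exact .box ih

/-- Source terms contain no symbolic integer, so the relation `B` is not called upon. This starts
both simulations, with library code related to itself. -/
theorem Rel.refl {s : Term Op} (h : s.Source) (hQ : ∀ m ∈ s.meths, Q m m) : Rel Q B s s := by
  induction s with
  | meth m => exact .meth (hQ m (by simp [Term.meths]))
  | int i => exact .int i
  | unit => exact .unit
  | var x => exact .var x
  | deref r => exact .deref r
  | lam x M ih => exact .lam x (ih h hQ)
  | assign r M ih => exact .assign r (ih h hQ)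
  | fst M ih => exact .fst (ih h hQ)
  | snd M ih => exact .snd (ih h hQ)
  | assert M ih => exact .assert (ih h hQ)
  | box M ih => exact h.elim
  | sint κ => exact h.elim
  | op o M N ih₁ ih₂ =>
    simp only [Term.meths, Finset.mem_union] at hQ
    exact .op o (ih₁ h.1 fun m hm => hQ m (Or.inl hm)) (ih₂ h.2 fun m hm => hQ m (Or.inr hm))
  | pair M N ih₁ ih₂ =>
    simp only [Term.meths, Finset.mem_union] at hQ
    exact .pair (ih₁ h.1 fun m hm => hQ m (Or.inl hm)) (ih₂ h.2 fun m hm => hQ m (Or.inr hm))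
  | app M N ih₁ ih₂ =>
    simp only [Term.meths, Finset.mem_union] at hQ
    exact .app (ih₁ h.1 fun m hm => hQ m (Or.inl hm)) (ih₂ h.2 fun m hm => hQ m (Or.inr hm))
  | letrec f x M N ih₁ ih₂ =>
    simp only [Term.meths, Finset.mem_union] at hQ
    exact .letrec f x (ih₁ h.1 fun m hm => hQ m (Or.inl hm)) (ih₂ h.2 fun m hm => hQ m (Or.inr hm))
  | letin x M N ih₁ ih₂ =>
    simp only [Term.meths, Finset.mem_union] at hQ
    exact .letin x (ih₁ h.1 fun m hm => hQ m (Or.inl hm)) (ih₂ h.2 fun m hm => hQ m (Or.inr hm))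
  | ite M N P ih₁ ih₂ ih₃ =>
    simp only [Term.meths, Finset.mem_union] at hQ
    exact .ite (ih₁ h.1 fun m hm => hQ m (Or.inl (Or.inl hm)))
      (ih₂ h.2.1 fun m hm => hQ m (Or.inl (Or.inr hm))) (ih₃ h.2.2 fun m hm => hQ m (Or.inr hm))

/-- Integer expressions matched by constants through `B` have no variables, so substitution leaves
them alone. -/
theorem Rel.subst (hB : ∀ s i, B s i → s.Arith) {s c v w : Term Op} (h : Rel Q B s c)
    (hv : Rel Q B v w) (x : VName) : Rel Q B (s.subst x v) (c.subst x w) := by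
  induction h with
  | coll h => rw [(hB _ _ h).subst]; exact .coll h
  | meth h => exact .meth h
  | int i => exact .int i
  | unit => exact .unit
  | var y =>
    unfold Term.subst
    split_ifs
    · exact hv
    · exact .var y
  | deref r => exact .deref r
  | lam y h ih =>
    unfold Term.subst
    split_ifs
    · exact .lam y h
    · exact .lam y ih
  | assign r _ ih => exact .assign r ih
  | op o _ _ ih₁ ih₂ => exact .op o ih₁ ih₂
  | pair _ _ ih₁ ih₂ => exact .pair ih₁ ih₂
  | fst _ ih => exact .fst ih
  | snd _ ih => exact .snd ih
  | app _ _ ih₁ ih₂ => exact .app ih₁ ih₂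
  | ite _ _ _ ih₁ ih₂ ih₃ => exact .ite ih₁ ih₂ ih₃
  | letrec f y h₁ h₂ ih₁ ih₂ =>
    unfold Term.subst
    refine .letrec f y ?_ ?_
    · split_ifs
      · exact h₁
      · exact ih₁
    · split_ifs
      · exact h₂
      · exact ih₂
  | letin y h₁ h₂ ih₁ ih₂ =>
    unfold Term.subst
    refine .letin y ih₁ ?_
    split_ifs
    · exact h₂
    · exact ih₂
  | assert _ ih => exact .assert ih
  | box _ ih => exact .box ih

theorem Rel.hasType (hB : ∀ s i, B s i → s.Arith) (hQ : ∀ m m', Q m m' → m.ty = m'.ty)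
    {s c : Term Op} (h : Rel Q B s c) {θ : Ty} (hs : HasType s θ) : HasType c θ := by
  induction h generalizing θ with
  | coll h => rw [hs.unique (hB _ _ h).hasType]; exact .int _
  | meth h => rw [hs.unique (.meth _), hQ _ _ h]; exact .meth _
  | int i => exact hs
  | unit => exact hs
  | var x => exact hs
  | deref r => exact hs
  | lam x _ ih => cases hs with | lam _ h₁ => exact .lam x (ih h₁)
  | assign r _ ih => cases hs with | assign _ h₁ => exact .assign r (ih h₁)
  | op o _ _ ih₁ ih₂ => cases hs with | op _ h₁ h₂ => exact .op o (ih₁ h₁) (ih₂ h₂)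
  | pair _ _ ih₁ ih₂ => cases hs with | pair h₁ h₂ => exact .pair (ih₁ h₁) (ih₂ h₂)
  | fst _ ih => cases hs with | fst h₁ => exact .fst (ih h₁)
  | snd _ ih => cases hs with | snd h₁ => exact .snd (ih h₁)
  | app _ _ ih₁ ih₂ => cases hs with | app h₁ h₂ => exact .app (ih₁ h₁) (ih₂ h₂)
  | ite _ _ _ ih₁ ih₂ ih₃ => cases hs with | ite h₁ h₂ h₃ => exact .ite (ih₁ h₁) (ih₂ h₂) (ih₃ h₃)
  | letrec f x _ _ ih₁ ih₂ =>
    cases hs with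
    | letrec _ _ h₁ h₂ =>
      generalize hf : f.ty = θ at h₁
      cases h₁ with | lam _ h₁ => exact .letrec f x (hf ▸ .lam x (ih₁ h₁)) (ih₂ h₂)
  | letin x _ _ ih₁ ih₂ => cases hs with | letin _ h₁ h₂ => exact .letin x (ih₁ h₁) (ih₂ h₂)
  | assert _ ih => cases hs with | assert h₁ => exact .assert (ih h₁)
  | box _ ih => cases hs with | box h₁ => exact .box (ih h₁)

end Rel

/-! ## Composition of evaluation contexts -/

namespace ECtx

/-- `E.comp F` is `E[F]`. -/
def comp : ECtx Op → ECtx Op → ECtx Op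
  | hole, F => F
  | assert E, F => assert (E.comp F)
  | assign r E, F => assign r (E.comp F)
  | opL o E N, F => opL o (E.comp F) N
  | opR o v E, F => opR o v (E.comp F)
  | pairL E N, F => pairL (E.comp F) N
  | pairR v E, F => pairR v (E.comp F)
  | fst E, F => fst (E.comp F)
  | snd E, F => snd (E.comp F)
  | appL E N, F => appL (E.comp F) N
  | appR m E, F => appR m (E.comp F)
  | letin x E N, F => letin x (E.comp F) N
  | ite E M₁ M₀, F => ite (E.comp F) M₁ M₀
  | box E, F => box (E.comp F)

theorem plug_comp (E F : ECtx Op) (M : Term Op) : (E.comp F).plug M = E.plug (F.plug M) := by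
  induction E <;> simp_all [comp, plug]

theorem Valid.comp {V : Term Op → Prop} {E F : ECtx Op} (hE : E.Valid V) (hF : F.Valid V) :
    (E.comp F).Valid V := by
  induction E <;> simp_all [ECtx.comp, Valid]

end ECtx

/-! ## Concrete evaluation of pending operations -/

/-- Evaluation steps that only perform integer operations. -/
def OpStep (I : Op → ℤ → ℤ → ℤ) (a b : Term Op) : Prop :=
  ∃ (E : ECtx Op) (o : Op) (i j : ℤ), E.Valid IsVal ∧
    a = E.plug (Term.op o (Term.int i) (Term.int j)) ∧ b = E.plug (Term.int (I o i j))

/-- Sequences of operation steps. -/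
abbrev OpSteps (I : Op → ℤ → ℤ → ℤ) : Term Op → Term Op → Prop :=
  Relation.ReflTransGen (OpStep I)

theorem OpSteps.plug {I : Op → ℤ → ℤ → ℤ} {a b : Term Op} (h : OpSteps I a b) {E : ECtx Op}
    (hE : E.Valid IsVal) : OpSteps I (E.plug a) (E.plug b) := by
  refine Relation.ReflTransGen.lift E.plug (fun _ _ => ?_) _ _ h
  rintro ⟨F, o, i, j, hF, rfl, rfl⟩
  exact ⟨E.comp F, o, i, j, hE.comp hF, (ECtx.plug_comp _ _ _).symm, (ECtx.plug_comp _ _ _).symm⟩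

theorem OpSteps.trans_plug {I : Op → ℤ → ℤ → ℤ} {a b c : Term Op} {E F : ECtx Op}
    (h : OpSteps I c (E.plug (F.plug a))) (h' : OpSteps I a b) (hE : E.Valid IsVal)
    (hF : F.Valid IsVal) : OpSteps I c (E.plug (F.plug b)) :=
  h.trans ((h'.plug hF).plug hE)

theorem OpSteps.steps {I : Op → ℤ → ℤ → ℤ} {a b : Term Op} (h : OpSteps I a b) (A : Finset MName)
    (R : Repo Op) (S : Store Op) (k : ℕ) :
    Relation.ReflTransGen (Step I A) ⟨a, R, S, k⟩ ⟨b, R, S, k⟩ := by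
  refine Relation.ReflTransGen.lift (fun t => (⟨t, R, S, k⟩ : TConf Op)) (fun _ _ => ?_) _ _ h
  rintro ⟨F, o, i, j, hF, rfl, rfl⟩
  exact .op hF

/-! ### Reachability, with the trace forgotten -/

/-- There is a sequence of transitions from `a` to `b`. -/
def Reach {C Mv : Type u} (T : C → Option Mv → C → Prop) (a b : C) : Prop :=
  ∃ τ, Run T a τ b

theorem Reach.refl {C Mv : Type u} {T : C → Option Mv → C → Prop} (a : C) : Reach T a a :=
  ⟨_, .refl a⟩

theorem Reach.trans {C Mv : Type u} {T : C → Option Mv → C → Prop} {a b c : C}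
    (h : Reach T a b) (h' : Reach T b c) : Reach T a c :=
  ⟨_, h.choose_spec.trans h'.choose_spec⟩

theorem Reach.single {C Mv : Type u} {T : C → Option Mv → C → Prop} {a b : C} {χ : Option Mv}
    (h : T a χ b) : Reach T a b :=
  ⟨_, .single h⟩

theorem Reach.of_steps {I : Op → ℤ → ℤ → ℤ} {abs : Finset MName} {c c' : TConf Op}
    (h : Relation.ReflTransGen (Step I abs) c c') (stk : List (Frame Op)) (pub : Finset MName) :
    Reach (CTrans I) (Conf.P stk c.M c.R c.S pub abs c.k)
      (Conf.P stk c'.M c'.R c'.S pub abs c'.k) := by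
  induction h with
  | refl => exact .refl _
  | tail _ h ih => exact ih.trans (.single (.int h))

/-! ## Concrete instances of symbolic configurations -/

/-- The concrete term is obtained from the symbolic one by replacing symbolic integers by their
values under `ν` and evaluating some integer expressions. -/
abbrev Inst (I : Op → ℤ → ℤ → ℤ) (ν : SInt → ℤ) : Term Op → Term Op → Prop :=
  Rel (fun m m' => m = m') fun s i => s.evalT I ν = some i

section Inst

variable {I : Op → ℤ → ℤ → ℤ} {ν : SInt → ℤ}

/-- Typing excludes symbolic values such as `() ⊕ κ`, on which an operation has no value. -/
theorem IsSVal.exists_evalT {v : Term Op} (hv : IsSVal v) (h : HasType v Ty.int) :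
    ∃ i, v.evalT I ν = some i := by
  induction hv with
  | meth m => cases h
  | int i => exact ⟨i, rfl⟩
  | unit => cases h
  | sint κ => exact ⟨_, rfl⟩
  | op o _ _ _ ih₁ ih₂ =>
    cases h with
    | op _ h₁ h₂ =>
      obtain ⟨i, hi⟩ := ih₁ h₁
      obtain ⟨j, hj⟩ := ih₂ h₂
      exact ⟨I o i j, by simp [Term.evalT, hi, hj]⟩
  | pair => cases h

theorem evalT_op {o : Op} {s t : Term Op} {n : ℤ} (h : (Term.op o s t).evalT I ν = some n) :
    ∃ i j, s.evalT I ν = some i ∧ t.evalT I ν = some j ∧ I o i j = n := by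
  simp only [Term.evalT, Option.bind_eq_some_iff, Option.map_eq_some_iff] at h
  obtain ⟨i, h₁, j, h₂, h₃⟩ := h
  exact ⟨i, j, h₁, h₂, h₃⟩

/-- Only contexts made of operations yield an integer expression, and there the value depends on the
content of the hole only through its value. -/
theorem evalT_plug {E : ECtx Op} {r : Term Op} {n : ℤ} (h : (E.plug r).evalT I ν = some n) :
    ∃ i, r.evalT I ν = some i ∧ ∀ N : Term Op, N.evalT I ν = some i →
      (E.plug N).evalT I ν = some n := by
  induction E generalizing n with
  | hole => exact ⟨n, h, fun _ => id⟩
  | opL o E P ih =>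
    obtain ⟨i, j, h₁, h₂, h₃⟩ := evalT_op h
    obtain ⟨a, h₄, h₅⟩ := ih h₁
    exact ⟨a, h₄, fun N hN => by simp [ECtx.plug, Term.evalT, h₅ N hN, h₂, h₃]⟩
  | opR o v E ih =>
    obtain ⟨i, j, h₁, h₂, h₃⟩ := evalT_op h
    obtain ⟨a, h₄, h₅⟩ := ih h₂
    exact ⟨a, h₄, fun N hN => by simp [ECtx.plug, Term.evalT, h₅ N hN, h₁, h₃]⟩
  | _ => simp [ECtx.plug, Term.evalT] at h

/-- The concrete term is a partially evaluated form of `s`. What remains is performed left operand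
first, since the context for the right one needs a constant on its left. -/
theorem Inst.opSteps {s c : Term Op} {i : ℤ} (h : Inst I ν s c) (hs : s.evalT I ν = some i) :
    OpSteps I c (Term.int i) := by
  induction s generalizing c i with
  | int j =>
    simp only [Term.evalT, Option.some.injEq] at hs
    subst hs
    cases h with
    | coll h => simp only [Term.evalT, Option.some.injEq] at h; subst h; exact .refl
    | int => exact .refl
  | sint κ =>
    cases h with
    | coll h => rw [hs] at h; cases h; exact .refl
  | op o s t ih₁ ih₂ =>
    cases h with
    | coll h => rw [hs] at h; cases h; exact .refl
    | @op _ _ _ _ c₂ h₁ h₂ =>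
      obtain ⟨a, b, h₃, h₄, rfl⟩ := evalT_op hs
      have h₅ := (ih₁ h₁ h₃).plug (E := .opL o .hole c₂) trivial
      have h₆ := (ih₂ h₂ h₄).plug (E := .opR o (.int a) .hole) ⟨.int a, trivial⟩
      exact (h₅.trans h₆).tail ⟨.hole, o, a, b, trivial, rfl, rfl⟩
  | _ => simp [Term.evalT] at hs

/-- A symbolic value may contain operations, so its instance becomes a value only after these have
been performed; typing ensures that they do not get stuck. -/
theorem Inst.exists_val {v c : Term Op} {θ : Ty} (hv : IsSVal v) (ht : HasType v θ)
    (h : Inst I ν v c) : ∃ c', OpSteps I c c' ∧ IsVal c' ∧ Inst I ν v c' := by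
  induction hv generalizing c θ with
  | meth m =>
    cases h with
    | coll h => simp [Term.evalT] at h
    | meth h => exact ⟨_, .refl, .meth _, .meth h⟩
  | int i => exact ⟨_, h.opSteps rfl, .int i, .int i⟩
  | unit =>
    cases h with
    | coll h => simp [Term.evalT] at h
    | unit => exact ⟨_, .refl, .unit, .unit⟩
  | sint κ => exact ⟨_, h.opSteps rfl, .int _, .coll rfl⟩
  | @op o v w h₁ h₂ h₃ =>
    have : HasType (Term.op o v w) Ty.int := by cases ht; exact .op o ‹_› ‹_›
    obtain ⟨i, hi⟩ := (IsSVal.op o h₁ h₂ h₃).exists_evalT (I := I) (ν := ν) this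
    exact ⟨_, h.opSteps hi, .int i, .coll hi⟩
  | pair _ _ ih₁ ih₂ =>
    cases ht with
    | pair ht₁ ht₂ =>
      cases h with
      | coll h => simp [Term.evalT] at h
      | pair h₁ h₂ =>
        obtain ⟨c₁, h₃, h₄, h₅⟩ := ih₁ ht₁ h₁
        obtain ⟨c₂, h₆, h₇, h₈⟩ := ih₂ ht₂ h₂
        exact ⟨.pair c₁ c₂, (h₃.plug (E := .pairL .hole _) trivial).trans
          (h₆.plug (E := .pairR c₁ .hole) ⟨h₄, trivial⟩), h₄.pair h₇, .pair h₅ h₈⟩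

/-- Either the concrete term evaluates to one that has an instance of the redex `r` in evaluation
position, or it has already evaluated an integer expression that contains `r`. -/
def Pull (I : Op → ℤ → ℤ → ℤ) (ν : SInt → ℤ) (E : ECtx Op) (r c : Term Op) : Prop :=
  (∃ (E' : ECtx Op) (r' : Term Op), E'.Valid IsVal ∧ OpSteps I c (E'.plug r') ∧ Inst I ν r r' ∧
    ∀ N N', Inst I ν N N' → Inst I ν (E.plug N) (E'.plug N')) ∨
  ∃ (i : ℤ) (c' : Term Op), r.evalT I ν = some i ∧ OpSteps I c c' ∧
    ∀ N : Term Op, N.evalT I ν = some i → Inst I ν (E.plug N) c'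

/-- Passes a decomposition through an outer layer. The symbolic layer `F` and the concrete layer
`F'` may differ, because operations to the left of the hole may have to be performed first (`hc`).
-/
theorem Pull.wrap {E F F' : ECtx Op} {r c c₁ : Term Op} (h : Pull I ν E r c₁)
    (hF' : F'.Valid IsVal) (hF : ∀ N N', Inst I ν N N' → Inst I ν (F.plug N) (F'.plug N'))
    (hc : OpSteps I c (F'.plug c₁)) : Pull I ν (F.comp E) r c := by
  rcases h with ⟨E', r', h₁, h₂, h₃, h₄⟩ | ⟨i, c', h₁, h₂, h₃⟩
  · refine Or.inl ⟨F'.comp E', r', hF'.comp h₁, ?_, h₃, fun N N' hN => ?_⟩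
    · rw [ECtx.plug_comp]
      exact hc.trans (h₂.plug hF')
    · rw [ECtx.plug_comp, ECtx.plug_comp]
      exact hF _ _ (h₄ _ _ hN)
  · refine Or.inr ⟨i, F'.plug c', h₁, hc.trans (h₂.plug hF'), fun N hN => ?_⟩
    rw [ECtx.plug_comp]
    exact hF _ _ (h₃ N hN)

/-- By induction on the context: at each layer either the shapes agree and the argument moves
inwards, or the whole layer has collapsed to a constant, which gives the second alternative of
`Pull`. -/
theorem Inst.pull {E : ECtx Op} {r c : Term Op} {θ : Ty} (hE : E.Valid IsSVal)
    (ht : HasType (E.plug r) θ) (h : Inst I ν (E.plug r) c) : Pull I ν E r c := by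
  -- The collapsed case: `r` is part of an expression that is already a constant, and replacing `r`
  -- by anything of the same value leaves that constant correct.
  have hcoll : ∀ {E : ECtx Op} {i : ℤ}, (E.plug r).evalT I ν = some i →
      Pull I ν E r (Term.int i) := by
    intro E i hi
    obtain ⟨j, h₁, h₂⟩ := evalT_plug hi
    exact Or.inr ⟨j, _, h₁, .refl, fun N hN => .coll (h₂ N hN)⟩
  induction E generalizing c θ with
  | hole => exact Or.inl ⟨.hole, c, trivial, .refl, h, fun _ _ => id⟩
  | assert E ih =>
    cases ht with
    | assert ht =>
      cases h with
      | coll h => exact hcoll h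
      | assert h =>
        exact (ih hE ht h).wrap (F := .assert .hole) (F' := .assert .hole) trivial
          (fun _ _ => .assert) .refl
  | assign s E ih =>
    cases ht with
    | assign _ ht =>
      cases h with
      | coll h => exact hcoll h
      | assign _ h =>
        exact (ih hE ht h).wrap (F := .assign s .hole) (F' := .assign s .hole) trivial
          (fun _ _ => .assign s) .refl
  | opL o E P ih =>
    cases ht with
    | op _ ht ht' =>
      cases h with
      | coll h => exact hcoll h
      | op _ h h' =>
        exact (ih hE ht h).wrap (F := .opL o .hole P) (F' := .opL o .hole _) trivial
          (fun _ _ hN => .op o hN h') .refl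
  | opR o v E ih =>
    cases ht with
    | op _ ht' ht =>
      cases h with
      | coll h => exact hcoll h
      | op _ h' h =>
        -- The left operand is a symbolic value, but its instance may still have operations to
        -- perform before the hole is in evaluation position.
        obtain ⟨c', h₁, h₂, h₃⟩ := Inst.exists_val hE.1 ht' h'
        exact (ih hE.2 ht h).wrap (F := .opR o v .hole) (F' := .opR o c' .hole) ⟨h₂, trivial⟩
          (fun _ _ hN => .op o h₃ hN) (h₁.plug (E := .opL o .hole _) trivial)
  | pairL E P ih =>
    cases ht with
    | pair ht ht' =>
      cases h with
      | coll h => exact hcoll h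
      | pair h h' =>
        exact (ih hE ht h).wrap (F := .pairL .hole P) (F' := .pairL .hole _) trivial
          (fun _ _ hN => .pair hN h') .refl
  | pairR v E ih =>
    cases ht with
    | pair ht' ht =>
      cases h with
      | coll h => exact hcoll h
      | pair h' h =>
        obtain ⟨c', h₁, h₂, h₃⟩ := Inst.exists_val hE.1 ht' h'
        exact (ih hE.2 ht h).wrap (F := .pairR v .hole) (F' := .pairR c' .hole) ⟨h₂, trivial⟩
          (fun _ _ hN => .pair h₃ hN) (h₁.plug (E := .pairL .hole _) trivial)
  | fst E ih =>
    cases ht with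
    | fst ht =>
      cases h with
      | coll h => exact hcoll h
      | fst h =>
        exact (ih hE ht h).wrap (F := .fst .hole) (F' := .fst .hole) trivial
          (fun _ _ => .fst) .refl
  | snd E ih =>
    cases ht with
    | snd ht =>
      cases h with
      | coll h => exact hcoll h
      | snd h =>
        exact (ih hE ht h).wrap (F := .snd .hole) (F' := .snd .hole) trivial
          (fun _ _ => .snd) .refl
  | appL E P ih =>
    cases ht with
    | app ht ht' =>
      cases h with
      | coll h => exact hcoll h
      | app h h' =>
        exact (ih hE ht h).wrap (F := .appL .hole P) (F' := .appL .hole _) trivial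
          (fun _ _ hN => .app hN h') .refl
  | appR m E ih =>
    cases ht with
    | app ht' ht =>
      cases h with
      | coll h => exact hcoll h
      | app h' h =>
        cases h' with
        | coll h' => simp [Term.evalT] at h'
        | meth h' =>
          subst h'
          exact (ih hE ht h).wrap (F := .appR m .hole) (F' := .appR m .hole) trivial
            (fun _ _ hN => .app (.meth rfl) hN) .refl
  | letin x E P ih =>
    cases ht with
    | letin _ ht ht' =>
      cases h with
      | coll h => exact hcoll h
      | letin _ h h' =>
        exact (ih hE ht h).wrap (F := .letin x .hole P) (F' := .letin x .hole _)
          trivial (fun _ _ hN => .letin x hN h') .refl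
  | ite E P Q ih =>
    cases ht with
    | ite ht ht' ht'' =>
      cases h with
      | coll h => exact hcoll h
      | ite h h' h'' =>
        exact (ih hE ht h).wrap (F := .ite .hole P Q) (F' := .ite .hole _ _)
          trivial (fun _ _ hN => .ite hN h' h'') .refl
  | box E ih =>
    cases ht with
    | box ht =>
      cases h with
      | coll h => exact hcoll h
      | box h =>
        exact (ih hE ht h).wrap (F := .box .hole) (F' := .box .hole) trivial
          (fun _ _ => .box) .refl

/-- Redexes other than operations have no integer value, so they cannot have collapsed. -/
theorem Inst.pull' {E : ECtx Op} {r c : Term Op} {θ : Ty} (hE : E.Valid IsSVal)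
    (ht : HasType (E.plug r) θ) (h : Inst I ν (E.plug r) c) (hr : r.evalT I ν = none) :
    ∃ (E' : ECtx Op) (r' : Term Op), E'.Valid IsVal ∧ OpSteps I c (E'.plug r') ∧ Inst I ν r r' ∧
      ∀ N N', Inst I ν N N' → Inst I ν (E.plug N) (E'.plug N') := by
  rcases h.pull hE ht with h | ⟨i, _, h, -⟩
  · exact h
  · simp [hr] at h

/-! ### Instances of repositories and stores -/

/-- Concrete repositories that are instances of symbolic ones. -/
def RepoInst (I : Op → ℤ → ℤ → ℤ) (ν : SInt → ℤ) (R R' : Repo Op) : Prop :=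
  (∀ m, m ∈ R ↔ m ∈ R') ∧ ∀ m x M, R.lookup m = some (x, M) →
    ∃ M', R'.lookup m = some (x, M') ∧ Inst I ν M M'

/-- Concrete stores that are instances of symbolic ones. -/
def StoreInst (I : Op → ℤ → ℤ → ℤ) (ν : SInt → ℤ) (S S' : Store Op) : Prop :=
  ∀ r v, S.lookup r = some v → ∃ w, S'.lookup r = some w ∧ Inst I ν v w

theorem RepoInst.insert {R R' : Repo Op} (h : RepoInst I ν R R') {M M' : Term Op}
    (hM : Inst I ν M M') (m : MName) (x : VName) :
    RepoInst I ν (R.insert m (x, M)) (R'.insert m (x, M')) := by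
  refine ⟨fun m' => by simp [h.1], fun m' y N hN => ?_⟩
  by_cases hm : m' = m
  · subst hm
    rw [AList.lookup_insert] at hN ⊢
    cases hN
    exact ⟨_, rfl, hM⟩
  · rw [AList.lookup_insert_ne hm] at hN ⊢
    exact h.2 _ _ _ hN

theorem StoreInst.insert {S S' : Store Op} (h : StoreInst I ν S S') {v w : Term Op}
    (hv : Inst I ν v w) (r : RName) : StoreInst I ν (S.insert r v) (S'.insert r w) := by
  intro r' u hu
  by_cases hr : r' = r
  · subst hr
    rw [AList.lookup_insert] at hu ⊢
    cases hu
    exact ⟨_, rfl, hv⟩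
  · rw [AList.lookup_insert_ne hr] at hu ⊢
    exact h _ _ hu

theorem Inst.meths_eq {s c : Term Op} (h : Inst I ν s c) : s.meths = c.meths := by
  induction h with
  | coll h => rw [(Term.Arith.of_evalT h).meths]; rfl
  | meth h => rw [h]
  | _ => simp_all [Term.meths]

theorem Inst.hasType {s c : Term Op} (h : Inst I ν s c) {θ : Ty} (hs : HasType s θ) :
    HasType c θ :=
  Rel.hasType (fun _ _ => Term.Arith.of_evalT) (fun _ _ h => by rw [h]) h hs

theorem Inst.subst {s c v w : Term Op} (h : Inst I ν s c) (hv : Inst I ν v w) (x : VName) :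
    Inst I ν (s.subst x v) (c.subst x w) :=
  Rel.subst (fun _ _ => Term.Arith.of_evalT) h hv x

end Inst

/-! ## From symbolic to concrete failures -/

section

variable {I : Op → ℤ → ℤ → ℤ} {ν : SInt → ℤ}

/-- Steps only add equations and conjuncts, so satisfaction propagates backwards. -/
theorem SStep.good {A : Finset MName} {K : Finset SInt} {c c' : STConf Op}
    (h : SStep I A K c c') (hg : Good I ν c'.σ c'.pc) : Good I ν c.σ c.pc := by
  cases h with
  | assertSymFail => exact ⟨hg.1, hg.2.1⟩
  | assertSymPass => exact ⟨hg.1, hg.2.1⟩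
  | iteSymFalse => exact ⟨hg.1, hg.2.1⟩
  | iteSymTrue => exact ⟨hg.1, hg.2.1⟩
  | opSym _ _ h₁ _ =>
    -- The new key is fresh, so no older equation is overwritten.
    refine ⟨fun κ t hκ => hg.1 κ t ?_, hg.2⟩
    rw [AList.lookup_insert_ne, hκ]
    rintro rfl
    exact h₁ (AList.lookup_isSome.1 (by rw [hκ]; rfl))
  | _ => exact ⟨hg.1, hg.2⟩

theorem STrans.good {ρ ρ' : SConf Op} {χ : Option (Move Op)} (h : STrans I ρ χ ρ')
    (hg : Good I ν ρ'.env ρ'.pathCond) : Good I ν ρ.env ρ.pathCond := by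
  cases h with
  | int h => exact h.good hg
  | _ => exact hg

theorem Run.good {ρ ρ' : SConf Op} {τ : List (Move Op)} (h : Run (STrans I) ρ τ ρ')
    (hg : Good I ν ρ'.env ρ'.pathCond) : Good I ν ρ.env ρ.pathCond := by
  induction h with
  | refl => exact hg
  | step ht _ ih => exact ht.good (ih hg)

theorem Inst.of_int {c : Term Op} {i : ℤ} (h : Inst I ν (Term.int i) c) : c = Term.int i := by
  cases h with
  | coll h => simp only [Term.evalT, Option.some.injEq] at h; rw [h]
  | int => rfl

theorem Inst.of_sint {c : Term Op} {κ : SInt} (h : Inst I ν (Term.sint κ) c) :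
    c = Term.int (ν κ) := by
  cases h with
  | coll h => simp only [Term.evalT, Option.some.injEq] at h; rw [h]

theorem Inst.of_meth {c : Term Op} {m : MName} (h : Inst I ν (Term.meth m) c) :
    c = Term.meth m := by
  cases h with
  | coll h => simp [Term.evalT] at h
  | meth h => rw [h]

/-- Pending operations are performed until the redex is exposed, and then the same rule applies,
with `ν` deciding symbolic tests. The exceptions are the operation rules and the failing assertion
on a symbolic integer, which need at most operation steps. -/
theorem SStep.simulate {A : Finset MName} {K : Finset SInt} {c c' : STConf Op}
    (h : SStep I A K c c') (hg : Good I ν c'.σ c'.pc) {θ : Ty} (ht : HasType c.M θ)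
    {M : Term Op} {R : Repo Op} {S : Store Op} (hM : Inst I ν c.M M) (hR : RepoInst I ν c.R R)
    (hS : StoreInst I ν c.σ.refs S) :
    ∃ (M' : Term Op) (R' : Repo Op) (S' : Store Op),
      Relation.ReflTransGen (Step I A) ⟨M, R, S, c.k⟩ ⟨M', R', S', c'.k⟩ ∧ Inst I ν c'.M M' ∧
      RepoInst I ν c'.R R' ∧ StoreInst I ν c'.σ.refs S' := by
  cases h with
  | @letin E x v N _ _ _ _ hE hv =>
    obtain ⟨E', r', h₁, h₂, h₃, h₄⟩ := hM.pull' hE ht rfl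
    obtain ⟨_, ht₁, -⟩ := ht.of_plug
    cases ht₁ with
    | letin _ ht₁ _ =>
      cases h₃ with
      | coll h => simp [Term.evalT] at h
      | @letin _ _ w _ N' h₅ h₆ =>
        obtain ⟨w', h₇, h₈, h₉⟩ := Inst.exists_val hv ht₁ h₅
        have h₁₀ := OpSteps.trans_plug h₂ h₇ (F := (.letin x .hole N')) h₁ trivial
        exact ⟨_, R, S, (OpSteps.steps h₁₀ A R S _).tail (.letin h₁ h₈), h₄ _ _ (Inst.subst h₆ h₉ x), hR, hS⟩
  | @fst E v w _ _ _ _ hE hv hw =>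
    obtain ⟨E', r', h₁, h₂, h₃, h₄⟩ := hM.pull' hE ht rfl
    obtain ⟨_, ht₁, -⟩ := ht.of_plug
    cases ht₁ with
    | fst ht₁ =>
      cases h₃ with
      | coll h => simp [Term.evalT] at h
      | fst h₅ =>
        obtain ⟨w', h₇, h₈, h₉⟩ := Inst.exists_val (hv.pair hw) ht₁ h₅
        have h₁₀ := OpSteps.trans_plug h₂ h₇ (F := (.fst .hole)) h₁ trivial
        cases h₉ with
        | coll h => simp [Term.evalT] at h
        | pair h₁₁ h₁₂ =>
          cases h₈ with
          | pair h₁₃ h₁₄ =>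
            exact ⟨_, R, S, (OpSteps.steps h₁₀ A R S _).tail (.fst h₁ h₁₃ h₁₄), h₄ _ _ h₁₁, hR, hS⟩
  | @snd E v w _ _ _ _ hE hv hw =>
    obtain ⟨E', r', h₁, h₂, h₃, h₄⟩ := hM.pull' hE ht rfl
    obtain ⟨_, ht₁, -⟩ := ht.of_plug
    cases ht₁ with
    | snd ht₁ =>
      cases h₃ with
      | coll h => simp [Term.evalT] at h
      | snd h₅ =>
        obtain ⟨w', h₇, h₈, h₉⟩ := Inst.exists_val (hv.pair hw) ht₁ h₅
        have h₁₀ := OpSteps.trans_plug h₂ h₇ (F := (.snd .hole)) h₁ trivial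
        cases h₉ with
        | coll h => simp [Term.evalT] at h
        | pair h₁₁ h₁₂ =>
          cases h₈ with
          | pair h₁₃ h₁₄ =>
            exact ⟨_, R, S, (OpSteps.steps h₁₀ A R S _).tail (.snd h₁ h₁₃ h₁₄), h₄ _ _ h₁₂, hR, hS⟩
  | @assign E r v _ _ _ _ hE hv =>
    obtain ⟨E', r', h₁, h₂, h₃, h₄⟩ := hM.pull' hE ht rfl
    obtain ⟨_, ht₁, -⟩ := ht.of_plug
    cases ht₁ with
    | assign _ ht₁ =>
      cases h₃ with
      | coll h => simp [Term.evalT] at h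
      | assign _ h₅ =>
        obtain ⟨w', h₇, h₈, h₉⟩ := Inst.exists_val hv ht₁ h₅
        have h₁₀ := OpSteps.trans_plug h₂ h₇ (F := (.assign r .hole)) h₁ trivial
        exact ⟨_, R, _, (OpSteps.steps h₁₀ A R S _).tail (.assign h₁ h₈), h₄ _ _ .unit, hR, hS.insert h₉ r⟩
  | deref hE hl =>
    obtain ⟨E', r', h₁, h₂, h₃, h₄⟩ := hM.pull' hE ht rfl
    cases h₃ with
    | coll h => simp [Term.evalT] at h
    | deref =>
      obtain ⟨w, hw, hw'⟩ := hS _ _ hl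
      exact ⟨_, R, S, (h₂.steps A R S _).tail (.deref h₁ hw), h₄ _ _ hw', hR, hS⟩
  | iteTrue hE hi =>
    obtain ⟨E', r', h₁, h₂, h₃, h₄⟩ := hM.pull' hE ht rfl
    cases h₃ with
    | coll h => simp [Term.evalT] at h
    | ite h₅ h₆ h₇ =>
      obtain rfl := Inst.of_int h₅
      exact ⟨_, R, S, (h₂.steps A R S _).tail (.iteTrue h₁ hi), h₄ _ _ h₆, hR, hS⟩
  | iteFalse hE =>
    obtain ⟨E', r', h₁, h₂, h₃, h₄⟩ := hM.pull' hE ht rfl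
    cases h₃ with
    | coll h => simp [Term.evalT] at h
    | ite h₅ h₆ h₇ =>
      obtain rfl := Inst.of_int h₅
      exact ⟨_, R, S, (h₂.steps A R S _).tail (.iteFalse h₁), h₄ _ _ h₇, hR, hS⟩
  | iteSymTrue hE =>
    obtain ⟨E', r', h₁, h₂, h₃, h₄⟩ := hM.pull' hE ht rfl
    cases h₃ with
    | coll h => simp [Term.evalT] at h
    | ite h₅ h₆ h₇ =>
      obtain rfl := Inst.of_sint h₅
      have hi := hg.2.2
      simp only [Formula.HoldsT, Term.evalT, Option.some.injEq, exists_eq_left'] at hi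
      exact ⟨_, R, S, (h₂.steps A R S _).tail (.iteTrue h₁ (Ne.symm hi)), h₄ _ _ h₆, hR, hS⟩
  | iteSymFalse hE =>
    obtain ⟨E', r', h₁, h₂, h₃, h₄⟩ := hM.pull' hE ht rfl
    cases h₃ with
    | coll h => simp [Term.evalT] at h
    | ite h₅ h₆ h₇ =>
      obtain rfl := Inst.of_sint h₅
      have hi := hg.2.2
      simp only [Formula.HoldsT, Term.evalT, Option.some.injEq, exists_eq_left'] at hi
      rw [← hi] at h₂
      exact ⟨_, R, S, (h₂.steps A R S _).tail (.iteFalse h₁), h₄ _ _ h₇, hR, hS⟩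
  | @op E o i j _ _ _ _ hE =>
    -- Either the operation is still pending and is performed now, or the concrete run performed it
    -- earlier and nothing remains to be done.
    rcases hM.pull hE ht with ⟨E', r', h₁, h₂, h₃, h₄⟩ | ⟨n, c', h₁, h₂, h₃⟩
    · have h₅ := (h₃.opSteps (i := I o i j) rfl).plug h₁
      exact ⟨_, R, S, OpSteps.steps (h₂.trans h₅) A R S _, h₄ _ _ (.int _), hR, hS⟩
    · exact ⟨_, R, S, h₂.steps A R S _, h₃ _ h₁, hR, hS⟩
  | @opSym E o v w κ _ _ _ _ hE hv _ _ =>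
    -- The equation just added to the environment says that the fresh `κ` has the value of the
    -- operation it names.
    have hκ := hg.env κ (Term.op o v w) (AList.lookup_insert _)
    rcases hM.pull hE ht with ⟨E', r', h₁, h₂, h₃, h₄⟩ | ⟨n, c', h₁, h₂, h₃⟩
    · have h₅ := (h₃.opSteps hκ).plug h₁
      exact ⟨_, R, S, OpSteps.steps (h₂.trans h₅) A R S _, h₄ _ _ (.coll rfl), hR, hS⟩
    · exact ⟨_, R, S, h₂.steps A R S _, h₃ _ (by rw [← h₁, hκ]; rfl), hR, hS⟩
  | @lam E x N m _ _ _ _ hE hm h₅ h₆ =>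
    obtain ⟨E', r', h₁, h₂, h₃, h₄⟩ := hM.pull' hE ht rfl
    have hm' := h₃.hasType hm
    cases h₃ with
    | coll h => simp [Term.evalT] at h
    | lam _ h₇ =>
      exact ⟨_, _, S, (h₂.steps A R S _).tail (.lam h₁ hm' (fun h => h₅ ((hR.1 m).2 h)) h₆),
        h₄ _ _ (.meth rfl), hR.insert h₇ m x, hS⟩
  | @letrec E f x N P m _ _ _ _ hE hm h₅ h₆ =>
    obtain ⟨E', r', h₁, h₂, h₃, h₄⟩ := hM.pull' hE ht rfl
    cases h₃ with
    | coll h => simp [Term.evalT] at h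
    | letrec _ _ h₇ h₈ =>
      have hm' := Inst.hasType (.lam x h₇) hm
      exact ⟨_, _, S, (h₂.steps A R S _).tail (.letrec h₁ hm' (fun h => h₅ ((hR.1 m).2 h)) h₆),
        h₄ _ _ (Inst.subst h₈ (.meth rfl) f), hR.insert (Inst.subst h₇ (.meth rfl) f) m x, hS⟩
  | assert hE hi =>
    obtain ⟨E', r', h₁, h₂, h₃, h₄⟩ := hM.pull' hE ht rfl
    cases h₃ with
    | coll h => simp [Term.evalT] at h
    | assert h₅ =>
      obtain rfl := Inst.of_int h₅
      exact ⟨_, R, S, (h₂.steps A R S _).tail (.assert h₁ hi), h₄ _ _ .unit, hR, hS⟩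
  | assertSymPass hE =>
    obtain ⟨E', r', h₁, h₂, h₃, h₄⟩ := hM.pull' hE ht rfl
    cases h₃ with
    | coll h => simp [Term.evalT] at h
    | assert h₅ =>
      obtain rfl := Inst.of_sint h₅
      have hi := hg.2.2
      simp only [Formula.HoldsT, Term.evalT, Option.some.injEq, exists_eq_left'] at hi
      exact ⟨_, R, S, (h₂.steps A R S _).tail (.assert h₁ (Ne.symm hi)), h₄ _ _ .unit, hR, hS⟩
  | assertSymFail hE =>
    obtain ⟨E', r', h₁, h₂, h₃, h₄⟩ := hM.pull' hE ht rfl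
    cases h₃ with
    | coll h => simp [Term.evalT] at h
    | assert h₅ =>
      obtain rfl := Inst.of_sint h₅
      have hi := hg.2.2
      simp only [Formula.HoldsT, Term.evalT, Option.some.injEq, exists_eq_left'] at hi
      -- The path condition gives `ν κ = 0`, so the concrete term already reads `assert(0)` and
      -- takes no assertion step.
      rw [← hi] at h₂
      exact ⟨_, R, S, h₂.steps A R S _, h₄ _ _ (.assert (.int 0)), hR, hS⟩
  | @app E m v x N _ _ _ _ hE hv hl =>
    obtain ⟨E', r', h₁, h₂, h₃, h₄⟩ := hM.pull' hE ht rfl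
    obtain ⟨_, ht₁, -⟩ := ht.of_plug
    cases h₃ with
    | coll h => simp [Term.evalT] at h
    | app h₅ h₆ =>
      obtain rfl := Inst.of_meth h₅
      obtain ⟨w', h₇, h₈, h₉⟩ := Inst.exists_val hv ht₁.app_meth.1 h₆
      have h₁₀ := OpSteps.trans_plug h₂ h₇ (F := (.appR m .hole)) h₁ trivial
      obtain ⟨N', h₁₁, h₁₂⟩ := hR.2 _ _ _ hl
      exact ⟨_, R, S, (OpSteps.steps h₁₀ A R S _).tail (.app h₁ h₈ h₁₁), h₄ _ _ (.box (Inst.subst h₁₂ h₉ x)),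
        hR, hS⟩
  | @box E v _ _ _ _ hE hv =>
    obtain ⟨E', r', h₁, h₂, h₃, h₄⟩ := hM.pull' hE ht rfl
    obtain ⟨_, ht₁, -⟩ := ht.of_plug
    cases ht₁ with
    | box ht₁ =>
      cases h₃ with
      | coll h => simp [Term.evalT] at h
      | box h₅ =>
        obtain ⟨w', h₇, h₈, h₉⟩ := Inst.exists_val hv ht₁ h₅
        have h₁₀ := OpSteps.trans_plug h₂ h₇ (F := (.box .hole)) h₁ trivial
        exact ⟨_, R, S, (OpSteps.steps h₁₀ A R S _).tail (.box h₁ h₈), h₄ _ _ h₉, hR, hS⟩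

/-! ### Simulation of symbolic game transitions -/

/-- Concrete stack frames that are instances of symbolic ones. -/
inductive FrameInst (I : Op → ℤ → ℤ → ℤ) (ν : SInt → ℤ) : Frame Op → Frame Op → Prop where
  | ctx (m : MName) {E E' : ECtx Op} :
      (∀ N N', Inst I ν N N' → Inst I ν (E.plug N) (E'.plug N')) →
      FrameInst I ν (Frame.ctx m E) (Frame.ctx m E')
  | cnt (m : MName) (l : ℕ) : FrameInst I ν (Frame.cnt m l) (Frame.cnt m l)

/-- Concrete configurations that are instances of symbolic ones. -/
inductive ConfInst (I : Op → ℤ → ℤ → ℤ) (ν : SInt → ℤ) : SConf Op → Conf Op → Prop where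
  | P {stk stk' : List (Frame Op)} {M M' : Term Op} {R R' : Repo Op} {pub : Finset MName}
      {abs : SAbs} {σ : SEnv Op} {S : Store Op} {pc : Formula Op} {k : ℕ} :
      List.Forall₂ (FrameInst I ν) stk stk' → Inst I ν M M' → RepoInst I ν R R' →
      StoreInst I ν σ.refs S →
      ConfInst I ν (SConf.P stk M R pub abs σ pc k) (Conf.P stk' M' R' S pub abs.meths k)
  | O {stk stk' : List (Frame Op)} {l : ℕ} {R R' : Repo Op} {pub : Finset MName}
      {abs : SAbs} {σ : SEnv Op} {S : Store Op} {pc : Formula Op} {k : ℕ} :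
      List.Forall₂ (FrameInst I ν) stk stk' → RepoInst I ν R R' →
      StoreInst I ν σ.refs S →
      ConfInst I ν (SConf.O stk l R pub abs σ pc k) (Conf.O stk' l R' S pub abs.meths k)

theorem pubAfter_inst {pub : Finset MName} {R R' : Repo Op} {v v' : Term Op}
    (hR : RepoInst I ν R R') (hv : Inst I ν v v') : pubAfter pub R v = pubAfter pub R' v' := by
  simp only [pubAfter, hv.meths_eq, hR.1]

/-- Concrete O plays the same method names and the value of each symbolic integer. The names are
fresh for the repository, so playing them requires no knowledge of P's methods. -/
theorem SymVal.exists_inst {R R' : Repo Op} {σ : SEnv Op} {θ : Ty} {abs abs' : SAbs} {v : Term Op}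
    (hR : RepoInst I ν R R') (h : SymVal R σ θ abs v abs') :
    ∃ v', Inst I ν v v' ∧ IsVal v' ∧ (∀ m ∈ v'.meths, m ∉ R') ∧
      abs'.meths = abs.meths ∪ v'.meths := by
  induction h with
  | unit abs => exact ⟨_, .unit, .unit, by simp [Term.meths], by simp [Term.meths]⟩
  | int abs κ _ _ => exact ⟨_, .coll rfl, .int (ν κ), by simp [Term.meths], by simp [Term.meths]⟩
  | arrow abs m h₁ _ =>
    refine ⟨_, .meth rfl, .meth m, ?_, ?_⟩
    · simp only [Term.meths, Finset.mem_singleton, forall_eq]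
      exact fun h => h₁ ((hR.1 m).2 h)
    · simp only [Term.meths]
      rw [Finset.union_comm]; rfl
  | prod _ _ ih₁ ih₂ =>
    obtain ⟨v₁, h₁, h₂, h₃, h₄⟩ := ih₁
    obtain ⟨v₂, h₅, h₆, h₇, h₈⟩ := ih₂
    refine ⟨_, .pair h₁ h₅, .pair h₂ h₆, ?_, ?_⟩
    · simp only [Term.meths, Finset.mem_union]
      rintro m (h | h)
      · exact h₃ m h
      · exact h₇ m h
    · rw [h₈, h₄, Term.meths, Finset.union_assoc]

theorem SymVal.exists_playable {R R' : Repo Op} {σ : SEnv Op} {θ : Ty} {abs abs' : SAbs}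
    {v : Term Op} (hR : RepoInst I ν R R') (h : SymVal R σ θ abs v abs') (pub : Finset MName) :
    ∃ v', Inst I ν v v' ∧ OPlayable R' pub θ v' ∧ absAfter abs.meths R' v' = abs'.meths := by
  obtain ⟨v', h₁, h₂, h₃, h₄⟩ := h.exists_inst (I := I) (ν := ν) hR
  refine ⟨v', h₁, ⟨h₂, h₁.hasType h.hasType, fun m hm hm' => absurd hm' (h₃ m hm)⟩, ?_⟩
  rw [h₄, absAfter, Finset.filter_true_of_mem h₃]

theorem STrans.simulate {ρ ρ' : SConf Op} {χ : Option (Move Op)} (h : STrans I ρ χ ρ')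
    (hg : Good I ν ρ'.env ρ'.pathCond) (hw : ρ.WT) {c : Conf Op} (hc : ConfInst I ν ρ c) :
    ∃ c', Reach (CTrans I) c c' ∧ ConfInst I ν ρ' c' := by
  cases h with
  | int h =>
    cases hc with
    | P hs hM hR hS =>
      obtain ⟨-, -, θ, ht, -⟩ := hw
      obtain ⟨M', R', S', h₁, h₂, h₃, h₄⟩ := h.simulate hg ht hM hR hS
      exact ⟨_, .of_steps h₁ _ _, .P hs h₂ h₃ h₄⟩
  | @pq _ E m v _ _ _ _ _ _ hE hv hm =>
    cases hc with
    | P hs hM hR hS =>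
      obtain ⟨-, -, θ, ht, -⟩ := hw
      obtain ⟨E', r', h₁, h₂, h₃, h₄⟩ := hM.pull' hE ht rfl
      obtain ⟨_, ht₁, -⟩ := ht.of_plug
      cases h₃ with
      | coll h => simp [Term.evalT] at h
      | app h₅ h₆ =>
        obtain rfl := Inst.of_meth h₅
        obtain ⟨w', h₇, h₈, h₉⟩ := Inst.exists_val hv ht₁.app_meth.1 h₆
        have h₁₀ := OpSteps.trans_plug h₂ h₇ (F := (.appR m .hole)) h₁ trivial
        refine ⟨_, (Reach.of_steps (OpSteps.steps h₁₀ _ _ _ _) _ _).trans (.single (.pq h₁ h₈ hm)), ?_⟩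
        rw [pubAfter_inst hR h₉]
        exact .O (.cons (.ctx m h₄) hs) hR hS
  | @oq _ _ _ _ _ pub _ _ _ _ _ hm hv =>
    cases hc with
    | O hs hR hS =>
      obtain ⟨v', h₁, h₂, h₃⟩ := hv.exists_playable hR pub
      -- The symbolic rule does not ask that the called method be defined; this comes from the
      -- invariant that public names are defined.
      refine ⟨_, .single (.oq hm ((hR.1 _).1 (hw.2.1 _ hm)) h₂), ?_⟩
      rw [h₃]
      exact .P (.cons (.cnt _ _) hs) (.app (.meth rfl) h₁) hR hS
  | pa hv =>
    cases hc with
    | P hs hM hR hS =>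
      obtain ⟨-, -, θ, ht, -⟩ := hw
      obtain ⟨w, h₁, h₂, h₃⟩ := hM.exists_val hv ht
      cases hs with
      | cons hf hs =>
        cases hf
        refine ⟨_, (Reach.of_steps (h₁.steps _ _ _ _) _ _).trans (.single (.pa h₂)), ?_⟩
        rw [pubAfter_inst hR h₃]
        exact .O hs hR hS
  | @oa _ _ _ _ _ _ pub _ _ _ _ _ hv =>
    cases hc with
    | O hs hR hS =>
      obtain ⟨v', h₁, h₂, h₃⟩ := hv.exists_playable hR pub
      cases hs with
      | cons hf hs =>
        cases hf with
        | ctx _ hE =>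
          refine ⟨_, .single (.oa h₂), ?_⟩
          rw [h₃]
          exact .P hs (hE _ _ h₁) hR hS

theorem Run.simulate {ρ ρ' : SConf Op} {τ : List (Move Op)} (h : Run (STrans I) ρ τ ρ')
    (hg : Good I ν ρ'.env ρ'.pathCond) (hw : ρ.WT) {c : Conf Op} (hc : ConfInst I ν ρ c) :
    ∃ c', Reach (CTrans I) c c' ∧ ConfInst I ν ρ' c' := by
  induction h generalizing c with
  | refl => exact ⟨c, .refl c, hc⟩
  | step ht hr ih =>
    obtain ⟨c₁, h₁, h₂⟩ := ht.simulate (hr.good hg) hw hc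
    obtain ⟨c₂, h₃, h₄⟩ := ih hg (ht.preserves hw) h₂
    exact ⟨c₂, h₁.trans h₃, h₄⟩

theorem ConfInst.failed {ρ : SConf Op} {c : Conf Op} (hc : ConfInst I ν ρ c) (hw : ρ.WT)
    (hf : ρ.Failed) : ∃ c', Reach (CTrans I) c c' ∧ c'.Failed := by
  cases hc with
  | O => exact hf.elim
  | P hs hM hR hS =>
    obtain ⟨-, -, θ, ht, -⟩ := hw
    obtain ⟨E, hE, rfl⟩ := hf
    obtain ⟨E', r', h₁, h₂, h₃, -⟩ := hM.pull' hE ht rfl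
    cases h₃ with
    | coll h => simp [Term.evalT] at h
    | assert h₅ =>
      obtain rfl := Inst.of_int h₅
      exact ⟨_, .of_steps (h₂.steps _ _ _ _) _ _, E', h₁, rfl⟩

end

/-! ### The implication from symbolic to concrete failure -/

theorem Built.wt {R : Repo Op} {S : Store Op} {pub abs : Finset MName}
    (h : Built R S pub abs) : (SConf.O [] 0 R pub ⟨abs, ∅⟩ ⟨S, ∅⟩ Formula.top 0).WT :=
  ⟨h.typed, h.pub, .nil⟩

theorem Fails.of_symFails {I : Op → ℤ → ℤ → ℤ} {L : Library Op} (hL : L.WellTyped)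
    (h : SymFails I L) : Fails I L := by
  obtain ⟨⟨τ, ρ⟩, ⟨R, S, pub, abs, hb, hr, μ, hμ⟩, hf⟩ := h
  have hB := hL.built hb
  have hg := Good.of_sat hμ
  -- A built library contains no symbolic integer, so the initial concrete configuration is an
  -- instance of the symbolic one under any valuation.
  obtain ⟨c, h₁, h₂⟩ := hr.simulate hg hB.wt (c := Conf.O [] 0 R S pub abs 0) <| by
    refine .O .nil ⟨fun _ => Iff.rfl, fun m x M hl => ⟨M, hl, ?_⟩⟩ fun r v hl => ⟨v, hl, ?_⟩
    · exact .refl (hB.source _ _ _ hl) fun _ _ => rfl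
    · rcases hB.store _ _ hl with ⟨i, rfl⟩ | ⟨m, -, rfl⟩
      · exact .int i
      · exact .meth rfl
  obtain ⟨c', h₃, h₄⟩ := h₂.failed (hr.invariant (fun _ _ _ h => h.preserves) hB.wt) hf
  obtain ⟨τ', h₅⟩ := h₁.trans h₃
  exact ⟨(τ', c'), ⟨R, S, pub, abs, hb, h₅⟩, h₄⟩

/-! ## Redexes -/

theorem IsVal.of_plug {E : ECtx Op} {M : Term Op} (h : IsVal (E.plug M)) : IsVal M := by
  induction E with
  | hole => exact h
  | pairL E N ih => cases h with | pair h _ => exact ih h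
  | pairR v E ih => cases h with | pair _ h => exact ih h
  | _ => cases h

/-- Terms that are not values, but have only values in evaluation position. -/
def IsRedex (r : Term Op) : Prop :=
  ¬ IsVal r ∧ ∀ (E : ECtx Op) (M : Term Op), r = E.plug M → E = ECtx.hole ∨ IsVal M

namespace IsRedex

theorem letin (x : VName) {v : Term Op} (hv : IsVal v) (M : Term Op) :
    IsRedex (Term.letin x v M) := by
  refine ⟨nofun, fun E N h => ?_⟩
  cases E <;> simp only [ECtx.plug, reduceCtorEq, Term.letin.injEq, true_or] at h ⊢
  exact Or.inr (IsVal.of_plug (h.2.1 ▸ hv))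

theorem fst {v : Term Op} (hv : IsVal v) : IsRedex (Term.fst v) := by
  refine ⟨nofun, fun E N h => ?_⟩
  cases E <;> simp only [ECtx.plug, reduceCtorEq, Term.fst.injEq, true_or] at h ⊢
  exact Or.inr (IsVal.of_plug (h ▸ hv))

theorem snd {v : Term Op} (hv : IsVal v) : IsRedex (Term.snd v) := by
  refine ⟨nofun, fun E N h => ?_⟩
  cases E <;> simp only [ECtx.plug, reduceCtorEq, Term.snd.injEq, true_or] at h ⊢
  exact Or.inr (IsVal.of_plug (h ▸ hv))

theorem assign (r : RName) {v : Term Op} (hv : IsVal v) : IsRedex (Term.assign r v) := by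
  refine ⟨nofun, fun E N h => ?_⟩
  cases E <;> simp only [ECtx.plug, reduceCtorEq, Term.assign.injEq, true_or] at h ⊢
  exact Or.inr (IsVal.of_plug (h.2 ▸ hv))

theorem deref (r : RName) : IsRedex (Term.deref r : Term Op) := by
  refine ⟨nofun, fun E N h => ?_⟩
  cases E <;> simp only [ECtx.plug, reduceCtorEq, true_or] at h ⊢

theorem ite {v : Term Op} (hv : IsVal v) (M N : Term Op) : IsRedex (Term.ite v M N) := by
  refine ⟨nofun, fun E N h => ?_⟩
  cases E <;> simp only [ECtx.plug, reduceCtorEq, Term.ite.injEq, true_or] at h ⊢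
  exact Or.inr (IsVal.of_plug (h.1 ▸ hv))

theorem op (o : Op) {v w : Term Op} (hv : IsVal v) (hw : IsVal w) : IsRedex (Term.op o v w) := by
  refine ⟨nofun, fun E N h => ?_⟩
  cases E <;> simp only [ECtx.plug, reduceCtorEq, Term.op.injEq, true_or] at h ⊢
  · exact Or.inr (IsVal.of_plug (h.2.1 ▸ hv))
  · exact Or.inr (IsVal.of_plug (h.2.2 ▸ hw))

theorem lam (x : VName) (M : Term Op) : IsRedex (Term.lam x M) := by
  refine ⟨nofun, fun E N h => ?_⟩
  cases E <;> simp only [ECtx.plug, reduceCtorEq, true_or] at h ⊢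

theorem letrec (f x : VName) (M N : Term Op) : IsRedex (Term.letrec f x M N) := by
  refine ⟨nofun, fun E N h => ?_⟩
  cases E <;> simp only [ECtx.plug, reduceCtorEq, true_or] at h ⊢

theorem assert {v : Term Op} (hv : IsVal v) : IsRedex (Term.assert v) := by
  refine ⟨nofun, fun E N h => ?_⟩
  cases E <;> simp only [ECtx.plug, reduceCtorEq, Term.assert.injEq, true_or] at h ⊢
  exact Or.inr (IsVal.of_plug (h ▸ hv))

theorem box {v : Term Op} (hv : IsVal v) : IsRedex (Term.box v) := by
  refine ⟨nofun, fun E N h => ?_⟩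
  cases E <;> simp only [ECtx.plug, reduceCtorEq, Term.box.injEq, true_or] at h ⊢
  exact Or.inr (IsVal.of_plug (h ▸ hv))

theorem app (m : MName) {v : Term Op} (hv : IsVal v) : IsRedex (Term.app (Term.meth m) v) := by
  refine ⟨nofun, fun E N h => ?_⟩
  cases E <;> simp only [ECtx.plug, reduceCtorEq, Term.app.injEq, true_or] at h ⊢
  · exact Or.inr (IsVal.of_plug (h.1 ▸ IsVal.meth m))
  · exact Or.inr (IsVal.of_plug (h.2 ▸ hv))

end IsRedex

/-- Unique decomposition. The path to the redex must follow `F` all the way: stopping earlier would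
put the non-value `M` in evaluation position inside a redex, and branching off would put `M` or `r`
inside a value. -/
theorem IsRedex.decompose {F E : ECtx Op} {M r : Term Op} (hr : IsRedex r) (hM : ¬ IsVal M)
    (hF : F.Valid IsVal) (hE : E.Valid IsVal) (h : F.plug M = E.plug r) :
    ∃ E' : ECtx Op, E'.Valid IsVal ∧ E = F.comp E' ∧ M = E'.plug r := by
  induction F generalizing E with
  | hole => exact ⟨E, hE, rfl, h⟩
  | opL o F N ih =>
    cases E <;> simp only [ECtx.plug, reduceCtorEq, Term.op.injEq] at h
    · exact ((hr.2 (.opL o F N) M h.symm).resolve_left nofun |> hM).elim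
    · obtain ⟨rfl, h, rfl⟩ := h
      obtain ⟨E', h₁, rfl, h₂⟩ := ih hF (by exact hE) h
      exact ⟨E', h₁, rfl, h₂⟩
    · exact (hM (IsVal.of_plug (h.2.1 ▸ hE.1))).elim
  | opR o v F ih =>
    cases E <;> simp only [ECtx.plug, reduceCtorEq, Term.op.injEq] at h
    · exact ((hr.2 (.opR o v F) M h.symm).resolve_left nofun |> hM).elim
    · exact (hr.1 (IsVal.of_plug (h.2.1 ▸ hF.1))).elim
    · obtain ⟨rfl, rfl, h⟩ := h
      obtain ⟨E', h₁, rfl, h₂⟩ := ih hF.2 (by exact hE.2) h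
      exact ⟨E', h₁, rfl, h₂⟩
  | pairL F N ih =>
    cases E <;> simp only [ECtx.plug, reduceCtorEq, Term.pair.injEq] at h
    · exact ((hr.2 (.pairL F N) M h.symm).resolve_left nofun |> hM).elim
    · obtain ⟨h, rfl⟩ := h
      obtain ⟨E', h₁, rfl, h₂⟩ := ih hF (by exact hE) h
      exact ⟨E', h₁, rfl, h₂⟩
    · exact (hM (IsVal.of_plug (h.1 ▸ hE.1))).elim
  | pairR v F ih =>
    cases E <;> simp only [ECtx.plug, reduceCtorEq, Term.pair.injEq] at h
    · exact ((hr.2 (.pairR v F) M h.symm).resolve_left nofun |> hM).elim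
    · exact (hr.1 (IsVal.of_plug (h.1 ▸ hF.1))).elim
    · obtain ⟨rfl, h⟩ := h
      obtain ⟨E', h₁, rfl, h₂⟩ := ih hF.2 (by exact hE.2) h
      exact ⟨E', h₁, rfl, h₂⟩
  | appL F N ih =>
    cases E <;> simp only [ECtx.plug, reduceCtorEq, Term.app.injEq] at h
    · exact ((hr.2 (.appL F N) M h.symm).resolve_left nofun |> hM).elim
    · obtain ⟨h, rfl⟩ := h
      obtain ⟨E', h₁, rfl, h₂⟩ := ih hF (by exact hE) h
      exact ⟨E', h₁, rfl, h₂⟩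
    · exact (hM (IsVal.of_plug (h.1 ▸ IsVal.meth _))).elim
  | appR m F ih =>
    cases E <;> simp only [ECtx.plug, reduceCtorEq, Term.app.injEq] at h
    · exact ((hr.2 (.appR m F) M h.symm).resolve_left nofun |> hM).elim
    · exact (hr.1 (IsVal.of_plug (h.1 ▸ IsVal.meth _))).elim
    · obtain ⟨h', h⟩ := h
      cases h'
      obtain ⟨E', h₁, rfl, h₂⟩ := ih hF (by exact hE) h
      exact ⟨E', h₁, rfl, h₂⟩
  | assert F ih =>
    cases E <;> simp only [ECtx.plug, reduceCtorEq, Term.assert.injEq] at h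
    · exact ((hr.2 (.assert F) M h.symm).resolve_left nofun |> hM).elim
    · obtain ⟨E', h₁, rfl, h₂⟩ := ih hF (by exact hE) h
      exact ⟨E', h₁, rfl, h₂⟩
  | assign r F ih =>
    cases E <;> simp only [ECtx.plug, reduceCtorEq, Term.assign.injEq] at h
    · exact ((hr.2 (.assign r F) M h.symm).resolve_left nofun |> hM).elim
    · obtain ⟨rfl, h⟩ := h
      obtain ⟨E', h₁, rfl, h₂⟩ := ih hF (by exact hE) h
      exact ⟨E', h₁, rfl, h₂⟩
  | fst F ih =>
    cases E <;> simp only [ECtx.plug, reduceCtorEq, Term.fst.injEq] at h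
    · exact ((hr.2 (.fst F) M h.symm).resolve_left nofun |> hM).elim
    · obtain ⟨E', h₁, rfl, h₂⟩ := ih hF (by exact hE) h
      exact ⟨E', h₁, rfl, h₂⟩
  | snd F ih =>
    cases E <;> simp only [ECtx.plug, reduceCtorEq, Term.snd.injEq] at h
    · exact ((hr.2 (.snd F) M h.symm).resolve_left nofun |> hM).elim
    · obtain ⟨E', h₁, rfl, h₂⟩ := ih hF (by exact hE) h
      exact ⟨E', h₁, rfl, h₂⟩
  | letin x F N ih =>
    cases E <;> simp only [ECtx.plug, reduceCtorEq, Term.letin.injEq] at h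
    · exact ((hr.2 (.letin x F N) M h.symm).resolve_left nofun |> hM).elim
    · obtain ⟨rfl, h, rfl⟩ := h
      obtain ⟨E', h₁, rfl, h₂⟩ := ih hF (by exact hE) h
      exact ⟨E', h₁, rfl, h₂⟩
  | ite F N P ih =>
    cases E <;> simp only [ECtx.plug, reduceCtorEq, Term.ite.injEq] at h
    · exact ((hr.2 (.ite F N P) M h.symm).resolve_left nofun |> hM).elim
    · obtain ⟨h, rfl, rfl⟩ := h
      obtain ⟨E', h₁, rfl, h₂⟩ := ih hF (by exact hE) h
      exact ⟨E', h₁, rfl, h₂⟩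
  | box F ih =>
    cases E <;> simp only [ECtx.plug, reduceCtorEq, Term.box.injEq] at h
    · exact ((hr.2 (.box F) M h.symm).resolve_left nofun |> hM).elim
    · obtain ⟨E', h₁, rfl, h₂⟩ := ih hF (by exact hE) h
      exact ⟨E', h₁, rfl, h₂⟩

/-! ## Relating concrete names to symbolic ones -/

/-- The index of a symbolic integer is read as a pair, the first component coding its value; the
second gives infinitely many symbolic integers for each value. -/
theorem exists_valuation :
    ∃ ν : SInt → ℤ, ∀ (i : ℤ) (F : Finset SInt), ∃ κ ∉ F, ν κ = i := by
  refine ⟨fun κ => Equiv.intEquivNat.symm κ.idx.unpair.1, fun i F => ?_⟩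
  let f : ℕ → SInt := fun n => ⟨Nat.pair (Equiv.intEquivNat i) n⟩
  have hf : Function.Injective f := fun a b h => by
    have := congrArg SInt.idx h
    exact (Nat.pair_eq_pair.1 this).2
  obtain ⟨_, ⟨n, rfl⟩, hn⟩ := (Set.infinite_range_of_injective hf).exists_notMem_finset F
  exact ⟨_, hn, by simp [f]⟩

theorem exists_fresh_meth (θ θ' : Ty) (F : Finset MName) :
    ∃ m ∉ F, m.dom = θ ∧ m.cod = θ' := by
  have hf : Function.Injective fun n : ℕ => (⟨θ, θ', n⟩ : MName) := fun a b h =>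
    congrArg MName.idx h
  obtain ⟨_, ⟨n, rfl⟩, hn⟩ := (Set.infinite_range_of_injective hf).exists_notMem_finset F
  exact ⟨_, hn, rfl, rfl⟩

/-- The symbolic term agrees with the concrete one up to a relation on method names and the
choice of symbolic integers for integer constants. -/
abbrev Sim (ν : SInt → ℤ) (Q : MName → MName → Prop) : Term Op → Term Op → Prop :=
  Rel Q fun s i => ∃ κ, s = Term.sint κ ∧ ν κ = i

section Sim

variable {I : Op → ℤ → ℤ → ℤ} {ν : SInt → ℤ} {Q Q' : MName → MName → Prop}

theorem Sim.subst {s c v w : Term Op} (h : Sim ν Q s c) (hv : Sim ν Q v w) (x : VName) :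
    Sim ν Q (s.subst x v) (c.subst x w) :=
  Rel.subst (by rintro _ _ ⟨κ, rfl, -⟩; trivial) h hv x

theorem Sim.of_int {s : Term Op} {i : ℤ} (h : Sim ν Q s (Term.int i)) :
    s = Term.int i ∨ ∃ κ, s = Term.sint κ ∧ ν κ = i := by
  cases h with
  | coll h => exact Or.inr h
  | int => exact Or.inl rfl

theorem Sim.evalT {s : Term Op} {i : ℤ} (h : Sim ν Q s (Term.int i)) :
    s.evalT I ν = some i := by
  rcases Sim.of_int h with rfl | ⟨κ, rfl, rfl⟩ <;> rfl

theorem Sim.isSVal {s v : Term Op} (hv : IsVal v) (h : Sim ν Q s v) : IsSVal s := by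
  induction hv generalizing s with
  | meth m => cases h with | meth => exact .meth _
  | int i =>
    rcases Sim.of_int h with rfl | ⟨κ, rfl, -⟩
    · exact .int i
    · exact .sint κ
  | unit => cases h; exact .unit
  | pair _ _ ih₁ ih₂ => cases h with | pair h₁ h₂ => exact .pair (ih₁ h₁) (ih₂ h₂)

theorem Sim.exists_meth {s c : Term Op} (h : Sim ν Q s c) {m' : MName} (hm : m' ∈ c.meths) :
    ∃ m ∈ s.meths, Q m m' := by
  induction h with
  | coll h => simp [Term.meths] at hm
  | meth h => simp only [Term.meths, Finset.mem_singleton] at hm ⊢; subst hm; exact ⟨_, rfl, h⟩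
  | int => simp [Term.meths] at hm
  | unit => simp [Term.meths] at hm
  | var => simp [Term.meths] at hm
  | deref => simp [Term.meths] at hm
  | lam _ _ ih => exact ih hm
  | assign _ _ ih => exact ih hm
  | fst _ ih => exact ih hm
  | snd _ ih => exact ih hm
  | assert _ ih => exact ih hm
  | box _ ih => exact ih hm
  | ite _ _ _ ih₁ ih₂ ih₃ =>
    simp only [Term.meths, Finset.mem_union] at hm ⊢
    rcases hm with (hm | hm) | hm
    · obtain ⟨m, h₁, h₂⟩ := ih₁ hm; exact ⟨m, Or.inl (Or.inl h₁), h₂⟩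
    · obtain ⟨m, h₁, h₂⟩ := ih₂ hm; exact ⟨m, Or.inl (Or.inr h₁), h₂⟩
    · obtain ⟨m, h₁, h₂⟩ := ih₃ hm; exact ⟨m, Or.inr h₁, h₂⟩
  | op _ _ _ ih₁ ih₂ | pair _ _ ih₁ ih₂ | app _ _ ih₁ ih₂ | letrec _ _ _ _ ih₁ ih₂
  | letin _ _ _ ih₁ ih₂ =>
    simp only [Term.meths, Finset.mem_union] at hm ⊢
    rcases hm with hm | hm
    · obtain ⟨m, h₁, h₂⟩ := ih₁ hm; exact ⟨m, Or.inl h₁, h₂⟩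
    · obtain ⟨m, h₁, h₂⟩ := ih₂ hm; exact ⟨m, Or.inr h₁, h₂⟩

/-- Plugging related terms into the two contexts yields related terms, also when the relation on
method names has been extended. -/
def CtxSim (ν : SInt → ℤ) (Q : MName → MName → Prop) (E E' : ECtx Op) : Prop :=
  ∀ Q' : MName → MName → Prop, (∀ m m', Q m m' → Q' m m') →
    ∀ N N', Sim ν Q' N N' → Sim ν Q' (E.plug N) (E'.plug N')

theorem CtxSim.mono {E E' : ECtx Op} (h : CtxSim ν Q E E') (hQ : ∀ m m', Q m m' → Q' m m') :
    CtxSim ν Q' E E' :=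
  fun Q'' hQ' => h Q'' fun m m' hm => hQ' m m' (hQ m m' hm)

/-- In contrast to `Inst`, integer constants are matched only by themselves or by a single symbolic
integer. Symbolic and concrete terms then have the same shape, so contexts transfer with no
intermediate steps. -/
theorem Sim.plug_inv {E' : ECtx Op} {s r' : Term Op} (hE : E'.Valid IsVal)
    (h : Sim ν Q s (E'.plug r')) :
    ∃ (E : ECtx Op) (r : Term Op), s = E.plug r ∧ E.Valid IsSVal ∧ Sim ν Q r r' ∧
      CtxSim ν Q E E' := by
  induction E' generalizing s with
  | hole => exact ⟨.hole, s, rfl, trivial, h, fun _ _ _ _ => id⟩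
  | assert E' ih =>
    cases h with
    | assert h =>
      obtain ⟨E, r, rfl, h₁, h₂, h₃⟩ := ih hE h
      exact ⟨.assert E, r, rfl, h₁, h₂, fun Q' hQ _ _ hN => .assert (h₃ Q' hQ _ _ hN)⟩
  | assign x E' ih =>
    cases h with
    | assign _ h =>
      obtain ⟨E, r, rfl, h₁, h₂, h₃⟩ := ih hE h
      exact ⟨.assign x E, r, rfl, h₁, h₂, fun Q' hQ _ _ hN => .assign x (h₃ Q' hQ _ _ hN)⟩
  | fst E' ih =>
    cases h with
    | fst h =>
      obtain ⟨E, r, rfl, h₁, h₂, h₃⟩ := ih hE h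
      exact ⟨.fst E, r, rfl, h₁, h₂, fun Q' hQ _ _ hN => .fst (h₃ Q' hQ _ _ hN)⟩
  | snd E' ih =>
    cases h with
    | snd h =>
      obtain ⟨E, r, rfl, h₁, h₂, h₃⟩ := ih hE h
      exact ⟨.snd E, r, rfl, h₁, h₂, fun Q' hQ _ _ hN => .snd (h₃ Q' hQ _ _ hN)⟩
  | box E' ih =>
    cases h with
    | box h =>
      obtain ⟨E, r, rfl, h₁, h₂, h₃⟩ := ih hE h
      exact ⟨.box E, r, rfl, h₁, h₂, fun Q' hQ _ _ hN => .box (h₃ Q' hQ _ _ hN)⟩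
  | opL o E' N' ih =>
    cases h with
    | op _ h h' =>
      obtain ⟨E, r, rfl, h₁, h₂, h₃⟩ := ih hE h
      exact ⟨.opL o E _, r, rfl, h₁, h₂, fun Q' hQ _ _ hN => .op o (h₃ Q' hQ _ _ hN) (h'.mono hQ)⟩
  | opR o v E' ih =>
    cases h with
    | op _ h' h =>
      obtain ⟨E, r, rfl, h₁, h₂, h₃⟩ := ih hE.2 h
      exact ⟨.opR o _ E, r, rfl, ⟨Sim.isSVal hE.1 h', h₁⟩, h₂,
        fun Q' hQ _ _ hN => .op o (h'.mono hQ) (h₃ Q' hQ _ _ hN)⟩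
  | pairL E' N' ih =>
    cases h with
    | pair h h' =>
      obtain ⟨E, r, rfl, h₁, h₂, h₃⟩ := ih hE h
      exact ⟨.pairL E _, r, rfl, h₁, h₂, fun Q' hQ _ _ hN => .pair (h₃ Q' hQ _ _ hN) (h'.mono hQ)⟩
  | pairR v E' ih =>
    cases h with
    | pair h' h =>
      obtain ⟨E, r, rfl, h₁, h₂, h₃⟩ := ih hE.2 h
      exact ⟨.pairR _ E, r, rfl, ⟨Sim.isSVal hE.1 h', h₁⟩, h₂,
        fun Q' hQ _ _ hN => .pair (h'.mono hQ) (h₃ Q' hQ _ _ hN)⟩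
  | appL E' N' ih =>
    cases h with
    | app h h' =>
      obtain ⟨E, r, rfl, h₁, h₂, h₃⟩ := ih hE h
      exact ⟨.appL E _, r, rfl, h₁, h₂, fun Q' hQ _ _ hN => .app (h₃ Q' hQ _ _ hN) (h'.mono hQ)⟩
  | appR m E' ih =>
    cases h with
    | app h' h =>
      cases h' with
      | meth h' =>
        obtain ⟨E, r, rfl, h₁, h₂, h₃⟩ := ih hE h
        exact ⟨.appR _ E, r, rfl, h₁, h₂,
          fun Q' hQ _ _ hN => .app (.meth (hQ _ _ h')) (h₃ Q' hQ _ _ hN)⟩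
  | letin x E' N' ih =>
    cases h with
    | letin _ h h' =>
      obtain ⟨E, r, rfl, h₁, h₂, h₃⟩ := ih hE h
      exact ⟨.letin x E _, r, rfl, h₁, h₂,
        fun Q' hQ _ _ hN => .letin x (h₃ Q' hQ _ _ hN) (h'.mono hQ)⟩
  | ite E' N' P' ih =>
    cases h with
    | ite h h' h'' =>
      obtain ⟨E, r, rfl, h₁, h₂, h₃⟩ := ih hE h
      exact ⟨.ite E _ _, r, rfl, h₁, h₂,
        fun Q' hQ _ _ hN => .ite (h₃ Q' hQ _ _ hN) (h'.mono hQ) (h''.mono hQ)⟩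

/-! ### Related method definitions and the invariant on names -/

/-- The symbolic method `m` and the concrete method `m'` have related definitions. -/
def Impl (ν : SInt → ℤ) (Q : MName → MName → Prop) (R R' : Repo Op) (m m' : MName) : Prop :=
  Q m m' ∧ ∃ x M M', R.lookup m = some (x, M) ∧ R'.lookup m' = some (x, M') ∧ Sim ν Q M M'

theorem Impl.mono {R R' : Repo Op} {m m' : MName} (h : Impl ν Q R R' m m')
    (hQ : ∀ m m', Q m m' → Q' m m') : Impl ν Q' R R' m m' := by
  obtain ⟨h₁, x, M, M', h₂, h₃, h₄⟩ := h
  exact ⟨hQ _ _ h₁, x, M, M', h₂, h₃, h₄.mono hQ⟩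

theorem Impl.mem_left {R R' : Repo Op} {m m' : MName} (h : Impl ν Q R R' m m') : m ∈ R := by
  obtain ⟨-, x, M, M', h₂, -⟩ := h
  exact AList.lookup_isSome.1 (by rw [h₂]; rfl)

theorem Impl.mem_right {R R' : Repo Op} {m m' : MName} (h : Impl ν Q R R' m m') : m' ∈ R' := by
  obtain ⟨-, x, M, M', -, h₂, -⟩ := h
  exact AList.lookup_isSome.1 (by rw [h₂]; rfl)

theorem Impl.insert {R R' : Repo Op} {m m' n n' : MName} (h : Impl ν Q R R' m m') (hn : n ∉ R)
    (hn' : n' ∉ R') (b b' : VName × Term Op) :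
    Impl ν Q (R.insert n b) (R'.insert n' b') m m' := by
  have h₅ : m ≠ n := fun h' => hn (h' ▸ h.mem_left)
  have h₆ : m' ≠ n' := fun h' => hn' (h' ▸ h.mem_right)
  obtain ⟨h₁, x, M, M', h₂, h₃, h₄⟩ := h
  exact ⟨h₁, x, M, M', by rw [AList.lookup_insert_ne h₅, h₂],
    by rw [AList.lookup_insert_ne h₆, h₃], h₄⟩

/-- The relation `Q` between symbolic and concrete method names. A symbolic abstract name may
stand for a concrete abstract name, or for a method that O knows and hence can call itself. -/
structure Names (ν : SInt → ℤ) (Q : MName → MName → Prop) (R : Repo Op) (pub abs : Finset MName)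
    (R' : Repo Op) (pub' abs' : Finset MName) : Prop where
  ty : ∀ m m', Q m m' → m.dom = m'.dom ∧ m.cod = m'.cod
  known : ∀ m m', Q m m' → Impl ν Q R R' m m' ∨ (m ∈ abs ∧ m' ∈ abs') ∨
    (m ∈ abs ∧ ∃ n ∈ pub, Impl ν Q R R' n m')
  disjoint : ∀ m ∈ R', m ∉ abs'
  pub : ∀ m' ∈ pub', ∃ n ∈ pub, Impl ν Q R R' n m'

/-- `Q` with the pair `(m, m')` added. -/
def addPair (Q : MName → MName → Prop) (m m' : MName) : MName → MName → Prop :=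
  fun n n' => Q n n' ∨ (n = m ∧ n' = m')

theorem le_addPair {m m' : MName} : ∀ n n', Q n n' → addPair Q m m' n n' :=
  fun _ _ => Or.inl

variable {R R' : Repo Op} {pub abs pub' abs' : Finset MName}

theorem Names.mono_pub (h : Names ν Q R pub abs R' pub' abs') {pub₁ : Finset MName}
    (hp : pub ⊆ pub₁) : Names ν Q R pub₁ abs R' pub' abs' := by
  refine ⟨h.ty, fun m m' hm => ?_, h.disjoint, fun m' hm' => ?_⟩
  · rcases h.known m m' hm with h₁ | h₁ | ⟨h₁, n, h₂, h₃⟩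
    · exact Or.inl h₁
    · exact Or.inr (Or.inl h₁)
    · exact Or.inr (Or.inr ⟨h₁, n, hp h₂, h₃⟩)
  · obtain ⟨n, h₂, h₃⟩ := h.pub m' hm'
    exact ⟨n, hp h₂, h₃⟩

/-- The symbolic counterpart of a defined name is either defined itself, and becomes public as P
plays it, or stands in for a method with a public representative. It cannot match an abstract
concrete name, as defined and abstract names are disjoint. -/
theorem Names.exists_pubAfter (h : Names ν Q R pub abs R' pub' abs') {v v' : Term Op}
    (hv : Sim ν Q v v') {m' : MName} (hm : m' ∈ v'.meths) (hm' : m' ∈ R') :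
    ∃ n ∈ pubAfter pub R v, Impl ν Q R R' n m' := by
  obtain ⟨m, h₁, h₂⟩ := Sim.exists_meth hv hm
  rcases h.known m m' h₂ with h₃ | h₃ | ⟨-, n, h₄, h₅⟩
  · exact ⟨m, Finset.mem_union_right _ (Finset.mem_filter.2 ⟨h₁, h₃.mem_left⟩), h₃⟩
  · exact absurd h₃.2 (h.disjoint _ hm')
  · exact ⟨n, Finset.mem_union_left _ h₄, h₅⟩

theorem Names.pubAfter (h : Names ν Q R pub abs R' pub' abs') {v v' : Term Op}
    (hv : Sim ν Q v v') :
    Names ν Q R (pubAfter pub R v) abs R' (pubAfter pub' R' v') abs' := by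
  have h' := h.mono_pub (pub₁ := HOLi.pubAfter pub R v) Finset.subset_union_left
  refine ⟨h'.ty, h'.known, h'.disjoint, fun m' hm' => ?_⟩
  rcases Finset.mem_union.1 hm' with hm' | hm'
  · exact h'.pub m' hm'
  · rw [Finset.mem_filter] at hm'
    exact h.exists_pubAfter hv hm'.1 hm'.2

/-- Names matched by the invariant are already defined or abstract on the concrete side. A relayed
value therefore leaves the concrete abstract names unchanged, as it must, since the concrete run
makes no move there. -/
theorem Names.absAfter_eq (h : Names ν Q R pub abs R' pub' abs') {v v' : Term Op}
    (hv : Sim ν Q v v') : absAfter abs' R' v' = abs' := by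
  refine Finset.union_eq_left.2 fun m' hm' => ?_
  rw [Finset.mem_filter] at hm'
  obtain ⟨m, -, h₂⟩ := Sim.exists_meth hv hm'.1
  rcases h.known m m' h₂ with h₃ | h₃ | ⟨-, n, -, h₅⟩
  · exact absurd h₃.mem_right hm'.2
  · exact h₃.2
  · exact absurd h₅.mem_right hm'.2

/-- A name played by O is either undefined for P, hence abstract on both sides, or a method O knows,
for which `m` becomes a stand-in. The set added to `abs'` is the one that `absAfter` adds for the
value `m'`. -/
theorem Names.addAbs (h : Names ν Q R pub abs R' pub' abs') {m m' : MName}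
    (hty : m.dom = m'.dom ∧ m.cod = m'.cod)
    (hm : m' ∈ R' → ∃ n ∈ pub, Impl ν Q R R' n m') :
    Names ν (addPair Q m m') R pub (insert m abs) R' pub'
      (abs' ∪ ({m'} : Finset MName).filter fun m => m ∉ R') := by
  constructor
  · rintro n n' (hn | ⟨rfl, rfl⟩)
    · exact h.ty n n' hn
    · exact hty
  · rintro n n' (hn | ⟨rfl, rfl⟩)
    · rcases h.known n n' hn with h₁ | h₁ | ⟨h₁, n, h₂, h₃⟩
      · exact Or.inl (h₁.mono le_addPair)
      · exact Or.inr (Or.inl ⟨Finset.mem_insert_of_mem h₁.1, Finset.mem_union_left _ h₁.2⟩)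
      · exact Or.inr (Or.inr ⟨Finset.mem_insert_of_mem h₁, n, h₂, h₃.mono le_addPair⟩)
    · by_cases hn : n' ∈ R'
      · obtain ⟨n₁, h₂, h₃⟩ := hm hn
        exact Or.inr (Or.inr ⟨Finset.mem_insert_self _ _, n₁, h₂, h₃.mono le_addPair⟩)
      · exact Or.inr (Or.inl ⟨Finset.mem_insert_self _ _, Finset.mem_union_right _ (by simp [hn])⟩)
  · intro n hn hn'
    rcases Finset.mem_union.1 hn' with hn' | hn'
    · exact h.disjoint n hn hn'
    · exact (Finset.mem_filter.1 hn').2 hn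
  · intro n' hn'
    obtain ⟨n, h₂, h₃⟩ := h.pub n' hn'
    exact ⟨n, h₂, h₃.mono le_addPair⟩

/-- The bodies are related by means of the new pair itself, as recursive definitions require. -/
theorem Names.addImpl (h : Names ν Q R pub abs R' pub' abs') {m m' : MName} {x : VName}
    {M M' : Term Op} (hty : m.dom = m'.dom ∧ m.cod = m'.cod) (hm : m ∉ R) (hm' : m' ∉ R')
    (hm₁ : m' ∉ abs') (hM : Sim ν (addPair Q m m') M M') :
    Names ν (addPair Q m m') (R.insert m (x, M)) pub abs (R'.insert m' (x, M')) pub' abs' := by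
  constructor
  · rintro n n' (hn | ⟨rfl, rfl⟩)
    · exact h.ty n n' hn
    · exact hty
  · rintro n n' (hn | ⟨rfl, rfl⟩)
    · rcases h.known n n' hn with h₁ | h₁ | ⟨h₁, n, h₂, h₃⟩
      · exact Or.inl ((h₁.mono le_addPair).insert hm hm' _ _)
      · exact Or.inr (Or.inl h₁)
      · exact Or.inr (Or.inr ⟨h₁, n, h₂, (h₃.mono le_addPair).insert hm hm' _ _⟩)
    · exact Or.inl ⟨Or.inr ⟨rfl, rfl⟩, x, M, M', AList.lookup_insert _, AList.lookup_insert _, hM⟩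
  · intro n hn
    rcases (AList.mem_insert _).1 hn with rfl | hn
    · exact hm₁
    · exact h.disjoint n hn
  · intro n' hn'
    obtain ⟨n, h₂, h₃⟩ := h.pub n' hn'
    exact ⟨n, h₂, (h₃.mono le_addPair).insert hm hm' _ _⟩

theorem absAfter_pair (abs : Finset MName) (R : Repo Op) (v w : Term Op) :
    absAfter abs R (Term.pair v w) = absAfter (absAfter abs R v) R w := by
  simp only [absAfter, Term.meths, Finset.filter_union, Finset.union_assoc]

/-- Produces the fresh symbolic copy of a concrete value, both for genuine moves of O and for values
that O merely relays. Integers are copied by symbolic integers of the right value, and each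
occurrence of a method name gets its own fresh name. Hypothesis `hk` provides the public
representatives for names that become stand-ins. -/
theorem Names.exists_symVal (hν : ∀ (i : ℤ) (F : Finset SInt), ∃ κ ∉ F, ν κ = i) {abs : SAbs}
    (h : Names ν Q R pub abs.meths R' pub' abs') {v' : Term Op} (hv : IsVal v') {θ : Ty}
    (ht : HasType v' θ) (hk : ∀ m' ∈ v'.meths, m' ∈ R' → ∃ n ∈ pub, Impl ν Q R R' n m')
    (σ : SEnv Op) :
    ∃ (v : Term Op) (abs₁ : SAbs) (Q' : MName → MName → Prop), (∀ m m', Q m m' → Q' m m') ∧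
      SymVal R σ θ abs v abs₁ ∧ Sim ν Q' v v' ∧
      Names ν Q' R pub abs₁.meths R' pub' (absAfter abs' R' v') := by
  induction hv generalizing θ abs abs' Q with
  | unit =>
    cases ht
    exact ⟨_, _, Q, fun _ _ => id, .unit abs, .unit, by simpa [absAfter, Term.meths] using h⟩
  | int i =>
    cases ht
    obtain ⟨κ, h₁, h₂⟩ := hν i (σ.ints.keys.toFinset ∪ abs.sints)
    simp only [Finset.mem_union, List.mem_toFinset, not_or] at h₁
    exact ⟨_, _, Q, fun _ _ => id, .int abs κ h₁.1 h₁.2, .coll ⟨κ, rfl, h₂⟩,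
      by simpa [absAfter, Term.meths] using h⟩
  | meth m' =>
    cases ht
    -- The name `m'` itself might already be in use on the symbolic side, so a new one of the same
    -- type is taken.
    obtain ⟨m, h₁, h₂⟩ := exists_fresh_meth m'.dom m'.cod (R.keys.toFinset ∪ abs.meths)
    simp only [Finset.mem_union, List.mem_toFinset, not_or] at h₁
    have hty : m'.ty = m.ty := by rw [MName.ty, MName.ty, h₂.1, h₂.2]
    refine ⟨_, ⟨insert m abs.meths, abs.sints⟩, addPair Q m m', le_addPair, ?_,
      .meth (Or.inr ⟨rfl, rfl⟩), h.addAbs h₂ (hk m' (Finset.mem_singleton_self _))⟩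
    rw [hty]
    exact .arrow abs m h₁.1 h₁.2
  | pair _ _ ih₁ ih₂ =>
    cases ht with
    | pair ht₁ ht₂ =>
      simp only [Term.meths, Finset.mem_union] at hk
      obtain ⟨v₁, abs₁, Q₁, h₁, h₂, h₃, h₄⟩ := ih₁ h ht₁ fun m' hm' => hk m' (Or.inl hm')
      obtain ⟨v₂, abs₂, Q₂, h₅, h₆, h₇, h₈⟩ := ih₂ h₄ ht₂ fun m' hm' hm₁ => by
        obtain ⟨n, h₉, h₁₀⟩ := hk m' (Or.inr hm') hm₁
        exact ⟨n, h₉, h₁₀.mono h₁⟩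
      refine ⟨_, _, Q₂, fun m m' hm => h₅ _ _ (h₁ _ _ hm), .prod h₂ h₆, .pair (h₃.mono h₅) h₇, ?_⟩
      rw [absAfter_pair]
      exact h₈

theorem Sim.hasType (hQ : ∀ m m', Q m m' → m.dom = m'.dom ∧ m.cod = m'.cod) {s c : Term Op}
    (h : Sim ν Q s c) {θ : Ty} (hs : HasType s θ) : HasType c θ := by
  refine Rel.hasType ?_ ?_ h hs
  · rintro _ _ ⟨κ, rfl, -⟩
    trivial
  · intro m m' hm
    rw [MName.ty, MName.ty, (hQ m m' hm).1, (hQ m m' hm).2]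

end Sim

/-! ## From concrete to symbolic failures -/

/-- Related stacks. If it is P's turn, then the last index is the concrete evaluation context that
the symbolic stack holds in the form of calls of P's methods by O. -/
inductive StkSim (ν : SInt → ℤ) (Q : MName → MName → Prop) :
    List (Frame Op) → List (Frame Op) → Option (ECtx Op) → Prop where
  | nil : StkSim ν Q [] [] none
  | ctx {s s' : List (Frame Op)} {F E E' : ECtx Op} {m m' : MName} :
      StkSim ν Q s s' (some F) → CtxSim ν Q E E' → E'.Valid IsVal → Q m m' →
      StkSim ν Q (Frame.ctx m E :: s) (Frame.ctx m' (F.comp E') :: s') none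
  | cnt {s s' : List (Frame Op)} {m m' : MName} {l l' : ℕ} :
      StkSim ν Q s s' none → Q m m' →
      StkSim ν Q (Frame.cnt m l :: s) (Frame.cnt m' l' :: s') (some ECtx.hole)
  | unfold {s s' : List (Frame Op)} {F E E' : ECtx Op} {m n : MName} {l : ℕ} :
      StkSim ν Q s s' (some F) → CtxSim ν Q E E' → E'.Valid IsVal → m.cod = n.cod →
      StkSim ν Q (Frame.cnt n l :: Frame.ctx m E :: s) s' (some (F.comp E'))

/-- Related repositories, stores and name sets; `ν` satisfies the symbolic environment and the
path condition. -/
structure EnvSim (I : Op → ℤ → ℤ → ℤ) (ν : SInt → ℤ) (Q : MName → MName → Prop) (R : Repo Op)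
    (pub : Finset MName) (abs : SAbs) (σ : SEnv Op) (pc : Formula Op) (R' : Repo Op) (S : Store Op)
    (pub' abs' : Finset MName) : Prop where
  names : Names ν Q R pub abs.meths R' pub' abs'
  store : ∀ r w, S.lookup r = some w → ∃ v, σ.refs.lookup r = some v ∧ Sim ν Q v w
  good : Good I ν σ pc

/-- Related configurations. -/
inductive ConfSim (I : Op → ℤ → ℤ → ℤ) (ν : SInt → ℤ) : SConf Op → Conf Op → Prop where
  | P {Q : MName → MName → Prop} {s s' : List (Frame Op)} {M M' C : Term Op} {F : ECtx Op}
      {R R' : Repo Op} {pub pub' abs' : Finset MName} {abs : SAbs} {σ : SEnv Op} {pc : Formula Op}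
      {S : Store Op} {k : ℕ} :
      StkSim ν Q s s' (some F) → C = F.plug M' → Sim ν Q M M' →
      EnvSim I ν Q R pub abs σ pc R' S pub' abs' →
      ConfSim I ν (SConf.P s M R pub abs σ pc k) (Conf.P s' C R' S pub' abs' k)
  | O {Q : MName → MName → Prop} {s s' : List (Frame Op)} {l l' : ℕ}
      {R R' : Repo Op} {pub pub' abs' : Finset MName} {abs : SAbs} {σ : SEnv Op} {pc : Formula Op}
      {S : Store Op} {k : ℕ} :
      StkSim ν Q s s' none →
      EnvSim I ν Q R pub abs σ pc R' S pub' abs' →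
      ConfSim I ν (SConf.O s l R pub abs σ pc k) (Conf.O s' l' R' S pub' abs' k)

section

variable {I : Op → ℤ → ℤ → ℤ} {ν : SInt → ℤ} {Q Q' : MName → MName → Prop}

theorem StkSim.mono {s s' : List (Frame Op)} {F : Option (ECtx Op)} (h : StkSim ν Q s s' F)
    (hQ : ∀ m m', Q m m' → Q' m m') : StkSim ν Q' s s' F := by
  induction h with
  | nil => exact .nil
  | ctx _ h₁ h₂ h₃ ih => exact .ctx ih (h₁.mono hQ) h₂ (hQ _ _ h₃)
  | cnt _ h₁ ih => exact .cnt ih (hQ _ _ h₁)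
  | unfold _ h₁ h₂ h₃ ih => exact .unfold ih (h₁.mono hQ) h₂ h₃

theorem StkSim.valid {s s' : List (Frame Op)} {F : ECtx Op} (h : StkSim ν Q s s' (some F)) :
    F.Valid IsVal := by
  generalize hF : some F = F' at h
  induction h generalizing F with
  | nil => cases hF
  | ctx => cases hF
  | cnt => cases hF; trivial
  | unfold _ _ h₂ _ ih => cases hF; exact (ih rfl).comp h₂

theorem Reach.wt {ρ ρ' : SConf Op} (h : Reach (STrans I) ρ ρ') (hw : ρ.WT) : ρ'.WT :=
  h.choose_spec.invariant (fun _ _ _ h => h.preserves) hw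

section EnvSim

variable {R R' : Repo Op} {pub pub' abs' : Finset MName} {abs : SAbs} {σ : SEnv Op}
  {pc : Formula Op} {S : Store Op}

theorem EnvSim.withNames (h : EnvSim I ν Q R pub abs σ pc R' S pub' abs')
    (hQ : ∀ m m', Q m m' → Q' m m') {R₁ R₁' : Repo Op} {pub₁ pub₁' abs₁' : Finset MName}
    {abs₁ : SAbs} (hn : Names ν Q' R₁ pub₁ abs₁.meths R₁' pub₁' abs₁') :
    EnvSim I ν Q' R₁ pub₁ abs₁ σ pc R₁' S pub₁' abs₁' := by
  refine ⟨hn, fun r w hr => ?_, h.good⟩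
  obtain ⟨v, h₁, h₂⟩ := h.store r w hr
  exact ⟨v, h₁, h₂.mono hQ⟩

theorem EnvSim.withPathCond (h : EnvSim I ν Q R pub abs σ pc R' S pub' abs') {φ : Formula Op}
    (hφ : φ.HoldsT I ν) : EnvSim I ν Q R pub abs σ (pc.and φ) R' S pub' abs' :=
  ⟨h.names, h.store, h.good.env, h.good.pathCond, hφ⟩

theorem EnvSim.insertStore (h : EnvSim I ν Q R pub abs σ pc R' S pub' abs') (r : RName)
    {v w : Term Op} (hv : Sim ν Q v w) :
    EnvSim I ν Q R pub abs ⟨σ.refs.insert r v, σ.ints⟩ pc R' (S.insert r w) pub' abs' := by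
  refine ⟨h.names, fun r' w' hr => ?_, h.good.env, h.good.pathCond⟩
  by_cases hrr : r' = r
  · subst hrr
    rw [AList.lookup_insert] at hr
    cases hr
    exact ⟨v, AList.lookup_insert _, hv⟩
  · rw [AList.lookup_insert_ne hrr] at hr
    obtain ⟨v', h₁, h₂⟩ := h.store r' w' hr
    exact ⟨v', by rw [AList.lookup_insert_ne hrr, h₁], h₂⟩

theorem EnvSim.insertInt (h : EnvSim I ν Q R pub abs σ pc R' S pub' abs') {κ : SInt}
    {t : Term Op} (ht : t.evalT I ν = some (ν κ)) :
    EnvSim I ν Q R pub abs ⟨σ.refs, σ.ints.insert κ t⟩ pc R' S pub' abs' := by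
  refine ⟨h.names, h.store, fun κ' t' hκ => ?_, h.good.pathCond⟩
  rcases lookup_insert_cases hκ with ⟨rfl, rfl⟩ | hκ
  · exact ht
  · exact h.good.env _ _ hκ

end EnvSim

/-! ### Relayed returns and exposure of redexes -/

/-- If the symbolic term is a value that is returned to one of P's own calls, then P and O can
return it. -/
theorem ConfSim.normalise (hν : ∀ (i : ℤ) (F : Finset SInt), ∃ κ ∉ F, ν κ = i)
    {s s' : List (Frame Op)} {M M' : Term Op} {F : ECtx Op}
    {R R' : Repo Op} {pub pub' abs' : Finset MName} {abs : SAbs} {σ : SEnv Op} {pc : Formula Op}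
    {S : Store Op} {k : ℕ} (hs : StkSim ν Q s s' (some F)) (hM : Sim ν Q M M')
    (he : EnvSim I ν Q R pub abs σ pc R' S pub' abs') (hw : (SConf.P s M R pub abs σ pc k).WT) :
    ∃ (Q₁ : MName → MName → Prop) (s₁ : List (Frame Op)) (M₁ M₁' : Term Op) (F₁ : ECtx Op)
      (pub₁ : Finset MName) (abs₁ : SAbs),
      Reach (STrans I) (SConf.P s M R pub abs σ pc k) (SConf.P s₁ M₁ R pub₁ abs₁ σ pc k) ∧
      StkSim ν Q₁ s₁ s' (some F₁) ∧ F.plug M' = F₁.plug M₁' ∧ Sim ν Q₁ M₁ M₁' ∧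
      EnvSim I ν Q₁ R pub₁ abs₁ σ pc R' S pub' abs' ∧
      (¬ IsVal M₁' ∨ F₁ = ECtx.hole ∧ ∃ m l s₂ m' l' s₂', s₁ = Frame.cnt m l :: s₂ ∧
        s' = Frame.cnt m' l' :: s₂' ∧ StkSim ν Q₁ s₂ s₂' none ∧ Q₁ m m') := by
  induction hlen : s.length using Nat.strong_induction_on generalizing Q s M M' F pub abs with
  | _ len ih =>
  by_cases hv : IsVal M'
  swap
  · exact ⟨Q, s, M, M', F, pub, abs, .refl _, hs, rfl, hM, he, Or.inl hv⟩
  cases hs with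
  | cnt hs hm =>
    exact ⟨_, _, M, M', .hole, pub, abs, .refl _, .cnt hs hm, rfl, hM, he,
      Or.inr ⟨rfl, _, _, _, _, _, _, rfl, rfl, hs, hm⟩⟩
  | @unfold s _ F E E' m n l hs hE hE' hmn =>
    have hw' := hw
    obtain ⟨-, -, θ, ht, hst⟩ := hw'
    cases hst
    have ht' : HasType M' m.cod := hmn ▸ Sim.hasType he.names.ty hM ht
    -- P returns the value, which publishes its names; O, now knowing them, answers its own pending
    -- call with a fresh copy.
    have hn := he.names.mono_pub (pub₁ := pubAfter pub R M) Finset.subset_union_left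
    obtain ⟨v, abs₁, Q₁, hQ, hv₁, hv₂, hn₁⟩ := hn.exists_symVal hν hv ht'
      (fun m' h₁ h₂ => he.names.exists_pubAfter hM h₁ h₂) σ
    rw [he.names.absAfter_eq hM] at hn₁
    have hr : Reach (STrans I) (SConf.P (Frame.cnt n l :: Frame.ctx m E :: s) M R pub abs σ pc k)
        (SConf.P s (E.plug v) R (pubAfter pub R M) abs₁ σ pc k) :=
      (Reach.single (.pa (Sim.isSVal hv hM))).trans (.single (.oa hv₁))
    obtain ⟨Q₂, s₂, M₂, M₂', F₂, pub₂, abs₂, h₁, h₂, h₃, h₄⟩ :=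
      -- The term obtained may again be a value that is to be relayed, but two frames have been
      -- removed from the stack.
      ih s.length (by simp [← hlen]) (hs.mono hQ) (hE Q₁ hQ _ _ hv₂) (he.withNames hQ hn₁)
        (hr.wt hw) rfl
    exact ⟨Q₂, s₂, M₂, M₂', F₂, pub₂, abs₂, hr.trans h₁, h₂, by rw [ECtx.plug_comp, h₃], h₄⟩

/-- The symbolic configuration can expose a redex that corresponds to the concrete one. -/
theorem ConfSim.focus (hν : ∀ (i : ℤ) (F : Finset SInt), ∃ κ ∉ F, ν κ = i) {ρ : SConf Op}
    {s' : List (Frame Op)} {E₁ : ECtx Op} {r' : Term Op} {R' : Repo Op} {pub' abs' : Finset MName}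
    {S : Store Op} {k : ℕ} (h : ConfSim I ν ρ (Conf.P s' (E₁.plug r') R' S pub' abs' k))
    (hw : ρ.WT) (hE₁ : E₁.Valid IsVal) (hr : IsRedex r') :
    ∃ (Q : MName → MName → Prop) (s : List (Frame Op)) (E F E' : ECtx Op) (r : Term Op)
      (R : Repo Op) (pub : Finset MName) (abs : SAbs) (σ : SEnv Op) (pc : Formula Op),
      Reach (STrans I) ρ (SConf.P s (E.plug r) R pub abs σ pc k) ∧
      StkSim ν Q s s' (some F) ∧ E₁ = F.comp E' ∧ E'.Valid IsVal ∧ E.Valid IsSVal ∧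
      CtxSim ν Q E E' ∧ Sim ν Q r r' ∧ EnvSim I ν Q R pub abs σ pc R' S pub' abs' := by
  cases h with
  | @P Q₀ s₀ _ M₀ M₀' _ F₀ R _ pub₀ _ _ abs₀ σ pc _ _ hs hC hM he =>
    obtain ⟨Q, s, M, M', F, pub, abs, h₁, h₂, h₃, h₄, h₅, h₆⟩ :=
      ConfSim.normalise hν hs hM he hw
    -- If the top term is not a value, the redex lies within it by unique decomposition; otherwise
    -- the outer context is the hole and there is nothing to split.
    have : ∃ E', E'.Valid IsVal ∧ E₁ = F.comp E' ∧ M' = E'.plug r' := by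
      rcases h₆ with h₆ | ⟨rfl, -⟩
      · exact hr.decompose h₆ h₂.valid hE₁ (by rw [← h₃, hC])
      · exact ⟨E₁, hE₁, rfl, by rw [hC, h₃]; rfl⟩
    obtain ⟨E', hE', rfl, rfl⟩ := this
    obtain ⟨E, r, rfl, h₇, h₈, h₉⟩ := Sim.plug_inv hE' h₄
    exact ⟨Q, s, E, F, E', r, R, pub, abs, σ, pc, h₁, h₂, rfl, hE', h₇, h₉, h₈, h₅⟩

/-- After focusing on the redex, the corresponding symbolic rule applies. The exception is an
internal call of a method for which an abstract name stands in: it becomes a call to O, answered by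
a call to a public representative. -/
theorem ConfSim.step (hν : ∀ (i : ℤ) (F : Finset SInt), ∃ κ ∉ F, ν κ = i) {ρ : SConf Op}
    {s' : List (Frame Op)} {pub' abs' : Finset MName} {c c' : TConf Op}
    (hw : ρ.WT) (hstep : Step I abs' c c')
    (h : ConfSim I ν ρ (Conf.P s' c.M c.R c.S pub' abs' c.k)) :
    ∃ ρ', Reach (STrans I) ρ ρ' ∧ ConfSim I ν ρ' (Conf.P s' c'.M c'.R c'.S pub' abs' c'.k) := by
  cases hstep with
  | @letin E₁ x v' M' _ _ _ hE₁ hv =>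
    obtain ⟨Q, s, E, F, E', r, R, pub, abs, σ, pc, h₁, h₂, rfl, h₃, h₄, h₅, h₆, h₇⟩ :=
      h.focus hν hw hE₁ (.letin x hv M')
    cases h₆ with
    | letin _ h₈ h₉ =>
      exact ⟨_, h₁.trans (.single (.int (.letin h₄ (Sim.isSVal hv h₈)))),
        .P h₂ (ECtx.plug_comp _ _ _) (h₅ Q (fun _ _ => id) _ _ (Sim.subst h₉ h₈ x)) h₇⟩
  | @fst E₁ v' w' _ _ _ hE₁ hv hw' =>
    obtain ⟨Q, s, E, F, E', r, R, pub, abs, σ, pc, h₁, h₂, rfl, h₃, h₄, h₅, h₆, h₇⟩ :=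
      h.focus hν hw hE₁ (.fst (hv.pair hw'))
    cases h₆ with
    | fst h₈ =>
      cases h₈ with
      | pair h₈ h₉ =>
        exact ⟨_, h₁.trans (.single (.int (.fst h₄ (Sim.isSVal hv h₈) (Sim.isSVal hw' h₉)))),
          .P h₂ (ECtx.plug_comp _ _ _) (h₅ Q (fun _ _ => id) _ _ h₈) h₇⟩
  | @snd E₁ v' w' _ _ _ hE₁ hv hw' =>
    obtain ⟨Q, s, E, F, E', r, R, pub, abs, σ, pc, h₁, h₂, rfl, h₃, h₄, h₅, h₆, h₇⟩ :=
      h.focus hν hw hE₁ (.snd (hv.pair hw'))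
    cases h₆ with
    | snd h₈ =>
      cases h₈ with
      | pair h₈ h₉ =>
        exact ⟨_, h₁.trans (.single (.int (.snd h₄ (Sim.isSVal hv h₈) (Sim.isSVal hw' h₉)))),
          .P h₂ (ECtx.plug_comp _ _ _) (h₅ Q (fun _ _ => id) _ _ h₉) h₇⟩
  | @assign E₁ r v' _ _ _ hE₁ hv =>
    obtain ⟨Q, s, E, F, E', r, R, pub, abs, σ, pc, h₁, h₂, rfl, h₃, h₄, h₅, h₆, h₇⟩ :=
      h.focus hν hw hE₁ (.assign r hv)
    cases h₆ with
    | assign _ h₈ =>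
      exact ⟨_, h₁.trans (.single (.int (.assign h₄ (Sim.isSVal hv h₈)))),
        .P h₂ (ECtx.plug_comp _ _ _) (h₅ Q (fun _ _ => id) _ _ .unit) (h₇.insertStore _ h₈)⟩
  | @deref E₁ r v' _ _ _ hE₁ hl =>
    obtain ⟨Q, s, E, F, E', r, R, pub, abs, σ, pc, h₁, h₂, rfl, h₃, h₄, h₅, h₆, h₇⟩ :=
      h.focus hν hw hE₁ (.deref r)
    cases h₆ with
    | deref _ =>
      obtain ⟨v, h₈, h₉⟩ := h₇.store _ _ hl
      exact ⟨_, h₁.trans (.single (.int (.deref h₄ h₈))),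
        .P h₂ (ECtx.plug_comp _ _ _) (h₅ Q (fun _ _ => id) _ _ h₉) h₇⟩
  | @iteTrue E₁ i M₁ M₀ _ _ _ hE₁ hi =>
    obtain ⟨Q, s, E, F, E', r, R, pub, abs, σ, pc, h₁, h₂, rfl, h₃, h₄, h₅, h₆, h₇⟩ :=
      h.focus hν hw hE₁ (.ite (.int i) M₁ M₀)
    cases h₆ with
    | ite h₈ h₉ h₁₀ =>
      have h₁₁ := h₅ Q (fun _ _ => id) _ _ h₉
      rcases Sim.of_int h₈ with rfl | ⟨κ, rfl, rfl⟩
      · exact ⟨_, h₁.trans (.single (.int (.iteTrue h₄ hi))), .P h₂ (ECtx.plug_comp _ _ _) h₁₁ h₇⟩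
      · exact ⟨_, h₁.trans (.single (.int (.iteSymTrue h₄))), .P h₂ (ECtx.plug_comp _ _ _) h₁₁
          (h₇.withPathCond (by simpa [Formula.HoldsT, Term.evalT] using Ne.symm hi))⟩
  | @iteFalse E₁ M₁ M₀ _ _ _ hE₁ =>
    obtain ⟨Q, s, E, F, E', r, R, pub, abs, σ, pc, h₁, h₂, rfl, h₃, h₄, h₅, h₆, h₇⟩ :=
      h.focus hν hw hE₁ (.ite (.int 0) M₁ M₀)
    cases h₆ with
    | ite h₈ h₉ h₁₀ =>
      have h₁₁ := h₅ Q (fun _ _ => id) _ _ h₁₀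
      rcases Sim.of_int h₈ with rfl | ⟨κ, rfl, h0⟩
      · exact ⟨_, h₁.trans (.single (.int (.iteFalse h₄))), .P h₂ (ECtx.plug_comp _ _ _) h₁₁ h₇⟩
      · exact ⟨_, h₁.trans (.single (.int (.iteSymFalse h₄))), .P h₂ (ECtx.plug_comp _ _ _) h₁₁
          (h₇.withPathCond (by simpa [Formula.HoldsT, Term.evalT] using h0.symm))⟩
  | @op E₁ o i j _ _ _ hE₁ =>
    obtain ⟨Q, s, E, F, E', r, R, pub, abs, σ, pc, h₁, h₂, rfl, h₃, h₄, h₅, h₆, h₇⟩ :=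
      h.focus hν hw hE₁ (.op o (.int i) (.int j))
    cases h₆ with
    | @op _ v _ w _ h₈ h₉ =>
      -- Two constants are computed as in the concrete run. Otherwise a fresh symbolic integer is
      -- chosen whose value under `ν` is the result, which makes the new equation true.
      by_cases hc : ∃ a b : ℤ, v = Term.int a ∧ w = Term.int b
      · obtain ⟨a, b, rfl, rfl⟩ := hc
        obtain rfl : a = i := Option.some.inj (Sim.evalT (I := I) h₈)
        obtain rfl : b = j := Option.some.inj (Sim.evalT (I := I) h₉)
        exact ⟨_, h₁.trans (.single (.int (.op h₄))),
          .P h₂ (ECtx.plug_comp _ _ _) (h₅ Q (fun _ _ => id) _ _ (.int _)) h₇⟩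
      · obtain ⟨κ, h₁₀, h₁₁⟩ := hν (I o i j) (σ.ints.keys.toFinset ∪ abs.sints)
        simp only [Finset.mem_union, List.mem_toFinset, not_or] at h₁₀
        have h₁₂ : (Term.op o v w).evalT I ν = some (ν κ) := by
          simp [Term.evalT, Sim.evalT (I := I) h₈, Sim.evalT (I := I) h₉, h₁₁]
        exact ⟨_, h₁.trans (.single (.int (.opSym h₄
          (.op o (Sim.isSVal (.int i) h₈) (Sim.isSVal (.int j) h₉) hc) h₁₀.1 h₁₀.2))),
          .P h₂ (ECtx.plug_comp _ _ _) (h₅ Q (fun _ _ => id) _ _ (.coll ⟨κ, rfl, h₁₁⟩))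
            (h₇.insertInt h₁₂)⟩
  | @lam E₁ x M' m' _ _ _ hE₁ ht hm hm' =>
    obtain ⟨Q, s, E, F, E', r, R, pub, abs, σ, pc, h₁, h₂, rfl, h₃, h₄, h₅, h₆, h₇⟩ :=
      h.focus hν hw hE₁ (.lam x M')
    obtain ⟨-, -, θ, ht₁, -⟩ := h₁.wt hw
    obtain ⟨θ', ht₂, -⟩ := ht₁.of_plug
    obtain rfl := (Sim.hasType h₇.names.ty h₆ ht₂).unique ht
    cases h₆ with
    | @lam _ M _ h₈ =>
      -- The concrete choice `m'` need not be fresh symbolically, where more abstract names are in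
      -- use.
      obtain ⟨m, h₉, h₁₀⟩ := exists_fresh_meth m'.dom m'.cod (R.keys.toFinset ∪ abs.meths)
      simp only [Finset.mem_union, List.mem_toFinset, not_or] at h₉
      have hty : m.ty = m'.ty := by rw [MName.ty, MName.ty, h₁₀.1, h₁₀.2]
      exact ⟨_, h₁.trans (.single (.int (.lam h₄ (hty ▸ ht₂) h₉.1 h₉.2))),
        .P (h₂.mono le_addPair) (ECtx.plug_comp _ _ _)
          (h₅ _ le_addPair _ _ (.meth (Or.inr ⟨rfl, rfl⟩)))
          (h₇.withNames le_addPair (h₇.names.addImpl h₁₀ h₉.1 hm hm' (h₈.mono le_addPair)))⟩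
  | @letrec E₁ f x M' N' m' _ _ _ hE₁ ht hm hm' =>
    obtain ⟨Q, s, E, F, E', r, R, pub, abs, σ, pc, h₁, h₂, rfl, h₃, h₄, h₅, h₆, h₇⟩ :=
      h.focus hν hw hE₁ (.letrec f x M' N')
    obtain ⟨-, -, θ, ht₁, -⟩ := h₁.wt hw
    obtain ⟨θ', ht₂, -⟩ := ht₁.of_plug
    cases h₆ with
    | @letrec _ _ M _ N _ h₈ h₉ =>
      cases ht₂ with
      | letrec _ _ ht₂ _ =>
        rw [(Sim.hasType h₇.names.ty (.lam x h₈) ht₂).unique ht] at ht₂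
        obtain ⟨m, h₁₀, h₁₁⟩ := exists_fresh_meth m'.dom m'.cod (R.keys.toFinset ∪ abs.meths)
        simp only [Finset.mem_union, List.mem_toFinset, not_or] at h₁₀
        have hty : m.ty = m'.ty := by rw [MName.ty, MName.ty, h₁₁.1, h₁₁.2]
        have hmm : Sim ν (addPair Q m m') (Term.meth m : Term Op) (Term.meth m') :=
          .meth (Or.inr ⟨rfl, rfl⟩)
        exact ⟨_, h₁.trans (.single (.int (.letrec h₄ (hty ▸ ht₂) h₁₀.1 h₁₀.2))),
          .P (h₂.mono le_addPair) (ECtx.plug_comp _ _ _)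
            (h₅ _ le_addPair _ _ (Sim.subst (h₉.mono le_addPair) hmm f))
            (h₇.withNames le_addPair (h₇.names.addImpl h₁₁ h₁₀.1 hm hm'
              (Sim.subst (h₈.mono le_addPair) hmm f)))⟩
  | @assert E₁ i _ _ _ hE₁ hi =>
    obtain ⟨Q, s, E, F, E', r, R, pub, abs, σ, pc, h₁, h₂, rfl, h₃, h₄, h₅, h₆, h₇⟩ :=
      h.focus hν hw hE₁ (.assert (.int i))
    cases h₆ with
    | assert h₈ =>
      have h₁₁ := h₅ Q (fun _ _ => id) _ _ .unit
      rcases Sim.of_int h₈ with rfl | ⟨κ, rfl, rfl⟩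
      · exact ⟨_, h₁.trans (.single (.int (.assert h₄ hi))), .P h₂ (ECtx.plug_comp _ _ _) h₁₁ h₇⟩
      · exact ⟨_, h₁.trans (.single (.int (.assertSymPass h₄))), .P h₂ (ECtx.plug_comp _ _ _) h₁₁
          (h₇.withPathCond (by simpa [Formula.HoldsT, Term.evalT] using Ne.symm hi))⟩
  | @box E₁ v' _ _ _ hE₁ hv =>
    obtain ⟨Q, s, E, F, E', r, R, pub, abs, σ, pc, h₁, h₂, rfl, h₃, h₄, h₅, h₆, h₇⟩ :=
      h.focus hν hw hE₁ (.box hv)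
    cases h₆ with
    | box h₈ =>
      exact ⟨_, h₁.trans (.single (.int (.box h₄ (Sim.isSVal hv h₈)))),
        .P h₂ (ECtx.plug_comp _ _ _) (h₅ Q (fun _ _ => id) _ _ h₈) h₇⟩
  | @app E₁ m' v' x N' _ _ _ hE₁ hv hl =>
    obtain ⟨Q, s, E, F, E', r, R, pub, abs, σ, pc, h₁, h₂, rfl, h₃, h₄, h₅, h₆, h₇⟩ :=
      h.focus hν hw hE₁ (.app m' hv)
    cases h₆ with
    | @app _ _ v _ h₈ h₉ =>
      cases h₈ with
      | @meth m _ h₈ =>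
        -- The called method is defined on the concrete side. Symbolically it is defined too, or
        -- abstract with a public representative `n`; a match of two abstract names is excluded by
        -- disjointness.
        rcases h₇.names.known m m' h₈ with h₁₀ | h₁₀ | ⟨h₁₀, n, h₁₁, h₁₂⟩
        · obtain ⟨-, y, N, N'', h₁₃, h₁₄, h₁₅⟩ := h₁₀
          rw [hl] at h₁₄
          cases h₁₄
          exact ⟨_, h₁.trans (.single (.int (.app h₄ (Sim.isSVal hv h₉) h₁₃))),
            .P h₂ (ECtx.plug_comp _ _ _) (h₅ Q (fun _ _ => id) _ _ (.box (Sim.subst h₁₅ h₉ x))) h₇⟩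
        · exact absurd h₁₀.2 (h₇.names.disjoint _ (AList.lookup_isSome.1 (by rw [hl]; rfl)))
        · obtain ⟨-, -, θ, ht₁, -⟩ := h₁.wt hw
          obtain ⟨θ', ht₂, -⟩ := ht₁.of_plug
          have hty := h₇.names.ty _ _ h₈
          have hty' := h₇.names.ty _ _ h₁₂.1
          have ht₃ : HasType v' n.dom := by
            rw [hty'.1, ← hty.1]
            exact Sim.hasType h₇.names.ty h₉ ht₂.app_meth.1
          have hn := h₇.names.mono_pub (pub₁ := pubAfter pub R v) Finset.subset_union_left
          obtain ⟨w, abs₁, Q₁, hQ, hw₁, hw₂, hn₁⟩ := hn.exists_symVal hν hv ht₃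
            (fun m' h₁ h₂ => h₇.names.exists_pubAfter h₉ h₁ h₂) σ
          rw [h₇.names.absAfter_eq h₉] at hn₁
          obtain ⟨-, y, N, N'', h₁₃, h₁₄, h₁₅⟩ := h₁₂
          rw [hl] at h₁₄
          cases h₁₄
          refine ⟨_, ((h₁.trans (.single (.pq h₄ (Sim.isSVal hv h₉) h₁₀))).trans (.single
            (.oq (Finset.mem_union_left _ h₁₁) hw₁))).trans (.single (.int
              (.app (E := .hole) trivial (Sim.isSVal hv hw₂) h₁₃))), ?_⟩
          -- The surrounding symbolic context has moved to the stack, and the body of `n` runs in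
          -- the empty context; the concrete context stays in place as `F.comp E'`.
          exact .P (.unfold (h₂.mono hQ) (h₅.mono hQ) h₃ (by rw [hty.2, hty'.2])) rfl
            (.box (Sim.subst (h₁₅.mono hQ) hw₂ x)) (h₇.withNames hQ hn₁)

theorem CTrans.simulate (hν : ∀ (i : ℤ) (F : Finset SInt), ∃ κ ∉ F, ν κ = i) {ρ : SConf Op}
    {c c' : Conf Op} {χ : Option (Move Op)} (h : CTrans I c χ c') (hw : ρ.WT)
    (hc : ConfSim I ν ρ c) : ∃ ρ', Reach (STrans I) ρ ρ' ∧ ConfSim I ν ρ' c' := by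
  cases h with
  | int h => exact hc.step hν hw h
  | @pq _ E₁ m' v' _ _ _ _ _ hE₁ hv hm =>
    obtain ⟨Q, s, E, F, E', r, R, pub, abs, σ, pc, h₁, h₂, rfl, h₃, h₄, h₅, h₆, h₇⟩ :=
      hc.focus hν hw hE₁ (.app m' hv)
    cases h₆ with
    | @app _ _ v _ h₈ h₉ =>
      cases h₈ with
      | @meth m _ h₈ =>
        -- Concretely this is a call to an abstract name, so no defined method can be behind it.
        have h₁₀ : m ∈ abs.meths := by
          rcases h₇.names.known m m' h₈ with h₁₀ | h₁₀ | ⟨-, n, -, h₁₂⟩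
          · exact absurd hm (h₇.names.disjoint _ h₁₀.mem_right)
          · exact h₁₀.1
          · exact absurd hm (h₇.names.disjoint _ h₁₂.mem_right)
        exact ⟨_, h₁.trans (.single (.pq h₄ (Sim.isSVal hv h₉) h₁₀)),
          .O (.ctx h₂ h₅ h₃ h₈) (h₇.withNames (fun _ _ => id) (h₇.names.pubAfter h₉))⟩
  | @pa _ _ m' v' _ _ _ _ _ hv =>
    cases hc with
    | P hs hC hM he =>
      obtain ⟨Q, s, M, M', F, pub, abs, h₁, h₂, h₃, h₄, h₅, h₆⟩ :=
        ConfSim.normalise hν hs hM he hw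
      obtain rfl := hC.trans h₃
      -- The concrete term is a value, and so is the part of it that faces the symbolic term. After
      -- normalisation the top frame is therefore a call that O also made in the concrete run.
      obtain ⟨rfl, m, l, s₂, m₁', l', s₂', rfl, h₇, h₈, h₉⟩ :=
        h₆.resolve_left (not_not.2 hv.of_plug)
      cases h₇
      exact ⟨_, h₁.trans (.single (.pa (Sim.isSVal hv h₄))),
        .O h₈ (h₅.withNames (fun _ _ => id) (h₅.names.pubAfter h₄))⟩
  | oq hm hmR hv =>
    cases hc with
    | @O _ _ _ _ _ _ _ _ _ _ _ σ _ _ _ hs he =>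
      -- Symbolic O calls the public representative of the called method.
      obtain ⟨n, hn, hn'⟩ := he.names.pub _ hm
      have hty := he.names.ty _ _ hn'.1
      obtain ⟨v, abs₁, Q₁, hQ, hv₁, hv₂, hn₁⟩ := he.names.exists_symVal hν hv.1 hv.2.1
        (fun m' h₁ h₂ => he.names.pub _ (hv.2.2 m' h₁ h₂)) σ
      rw [← hty.1] at hv₁
      exact ⟨_, .single (.oq hn hv₁), .P (.cnt (hs.mono hQ) (hQ _ _ hn'.1)) rfl
        (.app (.meth (hQ _ _ hn'.1)) hv₂) (he.withNames hQ hn₁)⟩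
  | oa hv =>
    cases hc with
    | @O _ _ _ _ _ _ _ _ _ _ _ σ _ _ _ hs he =>
      cases hs with
      | ctx hs hE hE' hm =>
        obtain ⟨v, abs₁, Q₁, hQ, hv₁, hv₂, hn₁⟩ := he.names.exists_symVal hν hv.1 hv.2.1
          (fun m' h₁ h₂ => he.names.pub _ (hv.2.2 m' h₁ h₂)) σ
        rw [← (he.names.ty _ _ hm).2] at hv₁
        exact ⟨_, .single (.oa hv₁), .P (hs.mono hQ) (ECtx.plug_comp _ _ _) (hE _ hQ _ _ hv₂)
          (he.withNames hQ hn₁)⟩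

theorem Run.simulate_conc (hν : ∀ (i : ℤ) (F : Finset SInt), ∃ κ ∉ F, ν κ = i) {ρ : SConf Op}
    {c c' : Conf Op} {τ : List (Move Op)} (h : Run (CTrans I) c τ c') (hw : ρ.WT)
    (hc : ConfSim I ν ρ c) : ∃ ρ', Reach (STrans I) ρ ρ' ∧ ConfSim I ν ρ' c' := by
  induction h generalizing ρ with
  | refl => exact ⟨ρ, .refl ρ, hc⟩
  | step ht _ ih =>
    obtain ⟨ρ₁, h₁, h₂⟩ := ht.simulate hν hw hc
    obtain ⟨ρ₂, h₃, h₄⟩ := ih (h₁.wt hw) h₂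
    exact ⟨ρ₂, h₁.trans h₃, h₄⟩

/-- If the asserted 0 is represented by a symbolic integer, one more step commits to its being zero,
which `ν` confirms. -/
theorem ConfSim.failed (hν : ∀ (i : ℤ) (F : Finset SInt), ∃ κ ∉ F, ν κ = i) {ρ : SConf Op}
    {c : Conf Op} (hc : ConfSim I ν ρ c) (hw : ρ.WT) (hf : c.Failed) :
    ∃ ρ', Reach (STrans I) ρ ρ' ∧ ρ'.Failed ∧ Good I ν ρ'.env ρ'.pathCond := by
  cases c with
  | O => exact hf.elim
  | P =>
    obtain ⟨E₁, hE₁, rfl⟩ := hf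
    obtain ⟨Q, s, E, F, E', r, R, pub, abs, σ, pc, h₁, h₂, rfl, h₃, h₄, h₅, h₆, h₇⟩ :=
      hc.focus hν hw hE₁ (.assert (.int 0))
    cases h₆ with
    | assert h₈ =>
      rcases Sim.of_int h₈ with rfl | ⟨κ, rfl, h0⟩
      · exact ⟨_, h₁, ⟨E, h₄, rfl⟩, h₇.good⟩
      · exact ⟨_, h₁.trans (.single (.int (.assertSymFail h₄))), ⟨E, h₄, rfl⟩,
          (h₇.withPathCond (by simpa [Formula.HoldsT, Term.evalT] using h0.symm)).good⟩

end

/-! ### The implication from concrete to symbolic failure -/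

theorem SymFails.of_fails {I : Op → ℤ → ℤ → ℤ} {L : Library Op} (hL : L.WellTyped)
    (h : Fails I L) : SymFails I L := by
  obtain ⟨⟨τ, c⟩, ⟨R, S, pub, abs, hb, hr⟩, hf⟩ := h
  obtain ⟨ν, hν⟩ := exists_valuation
  have hB := hL.built hb
  have himpl : ∀ m ∈ R, Impl ν (fun m m' => m = m' ∧ (m ∈ R ∨ m ∈ abs)) R R m m := by
    intro m hm
    obtain ⟨⟨x, M⟩, hl⟩ := Option.isSome_iff_exists.1 (AList.lookup_isSome.2 hm)
    exact ⟨⟨rfl, Or.inl hm⟩, x, M, M, hl, hl,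
      .refl (hB.source _ _ _ hl) fun m' hm' => ⟨rfl, hB.closed _ _ _ hl m' hm'⟩⟩
  have hc : ConfSim I ν (SConf.O [] 0 R pub ⟨abs, ∅⟩ ⟨S, ∅⟩ Formula.top 0)
      (Conf.O [] 0 R S pub abs 0) := by
    -- Initially names match by identity, restricted to those defined or abstract in the library,
    -- because every matched name must be accounted for in `Names`.
    refine .O (Q := fun m m' => m = m' ∧ (m ∈ R ∨ m ∈ abs)) .nil ⟨⟨?_, ?_, hB.disjoint, ?_⟩, ?_, ?_⟩
    · rintro m _ ⟨rfl, -⟩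
      exact ⟨rfl, rfl⟩
    · rintro m _ ⟨rfl, hm | hm⟩
      · exact Or.inl (himpl m hm)
      · exact Or.inr (Or.inl ⟨hm, hm⟩)
    · exact fun m hm => ⟨m, hm, himpl m (hB.pub m hm)⟩
    · intro r w hl
      refine ⟨w, hl, ?_⟩
      rcases hB.store _ _ hl with ⟨i, rfl⟩ | ⟨m, hm, rfl⟩
      · exact .int i
      · exact .meth ⟨rfl, Or.inl hm⟩
    · exact ⟨by simp, trivial⟩
  obtain ⟨ρ, h₁, h₂⟩ := hr.simulate_conc hν hB.wt hc
  obtain ⟨ρ', h₃, h₄, h₅⟩ := h₂.failed hν (h₁.wt hB.wt) hf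
  obtain ⟨τ', h₆⟩ := h₁.trans h₃
  exact ⟨(τ', ρ'), ⟨R, S, pub, abs, hb, h₆, h₅.exists_sat⟩, h₄⟩

end HOLi

theorem mainTheorem3 {Op : Type*} (I : Op → ℤ → ℤ → ℤ) (L : HOLi.Library Op)
    (hL : L.WellTyped) : HOLi.Fails I L ↔ HOLi.SymFails I L :=
  ⟨HOLi.SymFails.of_fails hL, HOLi.Fails.of_symFails hL⟩
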